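/- **Theorem (existence of the spectral shift function for trace class perturbations).** Let $\mathcal H$ be a complex separable Hilbert space, $H_0$ a self-adjoint operator on $\mathcal H$ that is bounded from below, $V$ a trace class operator on $\mathcal H$, and $H:=H_0+V$ with domain $\mathcal D(H_0)$. For a closed operator $A$ let $\rho(A)$ be its resolvent set and $\mathcal R_A(z)=(A-z)^{-1}$; write $\langle x\rangle=(1+x^2)^{1/2}$. Let $I\subset\mathbb R$ be an open interval such that 1. $H$ has only finitely many non-real eigenvalues with real part in $I$; 2. there are $a,n,c>0$ such that every $z$ with $\operatorname{Re}z\in I$, $0<|\operatorname{Im}z|<a$ lies in $\rho(H)$ and satisfies $$\|\mathcal R_H(z)\|\le c\,|\operatorname{Im}z|^{-1}\Big(\frac{\langle\operatorname{Re}z\rangle}{|\operatorname{Im}z|}\Big)^{n}.$$ For $f\in D(I)=C_c^\infty(I,\mathbb C)$, $N\in\mathbb N$ and $\tau\in C_c^\infty(\mathbb R,\mathbb C)$ equal to $1$ near $0$, put $$\chi(x+iy)=\tau\big(y/\langle x\rangle\big),\qquad \tilde f(x+iy)=\Big(\sum_{k=0}^N\frac{f^{(k)}(x)}{k!}(iy)^k\Big)\chi(x+iy).$$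 Call $\tau$ admissible for $A\in\{H,H_0\}$ if $\operatorname{supp}\chi$ contains no non-real eigenvalue of $A$ with real part in $I$. Then, for every $f\in D(I)$ and $A\in\{H,H_0\}$, admissible $\tau$ exist, and the integral $$f(A):=\frac1\pi\int_{\mathbb C}\partial_{\bar z}\tilde f(z)\,\mathcal R_A(z)\,dx\,dy$$ converges absolutely in operator norm for all $N>n$ and all admissible $\tau$, with a value that does not depend on $N$ and $\tau$. Moreover: * For every $f\in D(I)$ the operator $f(H)-f(H_0)$ is trace class, and $f\mapsto \operatorname{Tr}(f(H)-f(H_0))$ is a distribution on $I$, which vanishes on $I\cap\rho(H)\cap\rho(H_0)$. * There is a distribution $\xi\in D'(I)$ (the spectral shift function), unique up to an additive constant, with $\langle\xi',f\rangle=\operatorname{Tr}(f(H)-f(H_0))$ for all $f\in D(I)$. * For $z\in\rho(H)\cap\rho(H_0)$ the operator $\mathcal R_H(z)-\mathcal R_{H_0}(z)$ is trace class; let $\sigma(z)$ be its trace. For all small $\varepsilon>0$ the functions $\sigma(\cdot\pm i\varepsilon)$ are defined on $I$ and locally integrable there, and $$\xi'=\frac1{2\pi i}\lim_{\varepsilon\to0^+}\big(\sigma(\cdot+i\varepsilon)-\sigma(\cdot-i\varepsilon)\big)\quad\text{in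 } D'(I),$$ that is, $\langle\xi',f\rangle=\frac1{2\pi i}\lim_{\varepsilon\to0^+}\int_I f(\lambda)\big(\sigma(\lambda+i\varepsilon)-\sigma(\lambda-i\varepsilon)\big)\,d\lambda$ for every $f\in D(I)$. -/

import Mathlib

open scoped Distributions ContDiff Topology

namespace SSF

noncomputable section

/-! ### Trace class operators and the trace -/

section TraceClass

variable {E : Type*} [NormedAddCommGroup E] [InnerProductSpace ℂ E] [CompleteSpace E]

/-- `T` is trace class: `∑ᵢ ⟨bᵢ, |T| bᵢ⟩ < ∞` for an orthonormal (Hilbert) basis `b`, where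
`|T| = (T* T)^{1/2}`. The terms are nonnegative and the sum does not depend on the basis. -/
def IsTraceClass (T : E →L[ℂ] E) : Prop :=
  ∃ (w : Set E) (b : HilbertBasis w ℂ E),
    Summable fun i : w => (inner ℂ (b i) ((CFC.abs T) (b i))).re

variable (E) in
/-- The index set of a fixed Hilbert basis of `E`. -/
def basisIndex : Set E := (exists_hilbertBasis ℂ E).choose

variable (E) in
/-- A fixed Hilbert basis of `E`. -/
def basis : HilbertBasis (basisIndex E) ℂ E := (exists_hilbertBasis ℂ E).choose_spec.choose

/-- The trace `Tr T = ∑ᵢ ⟨bᵢ, T bᵢ⟩`. For trace class `T` the series converges absolutely and its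
sum does not depend on the Hilbert basis. -/
def trace (T : E →L[ℂ] E) : ℂ := ∑' i, inner ℂ (basis E i) (T (basis E i))

end TraceClass

/-! ### Unbounded operators: resolvent and eigenvalues -/

section Operators

variable {E : Type*} [NormedAddCommGroup E] [InnerProductSpace ℂ E]

/-- The operator `H₀ + V` with domain `𝒟(H₀)`. -/
def perturb (H₀ : E →ₗ.[ℂ] E) (V : E →L[ℂ] E) : E →ₗ.[ℂ] E := (V : E →ₗ[ℂ] E) +ᵥ H₀

/-- The quadratic form of `A` is bounded from below. -/
def IsBoundedBelow (A : E →ₗ.[ℂ] E) : Prop :=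
  ∃ γ : ℝ, ∀ x : A.domain, γ * ‖(x : E)‖ ^ 2 ≤ (inner ℂ (x : E) (A x)).re

/-- The bounded operator `R` is a two-sided inverse of `A - z : 𝒟(A) → E`. -/
def IsResolventAt (A : E →ₗ.[ℂ] E) (z : ℂ) (R : E →L[ℂ] E) : Prop :=
  (∀ u : E, ∃ h : R u ∈ A.domain, A ⟨R u, h⟩ - z • R u = u) ∧
    ∀ v : A.domain, R (A v - z • (v : E)) = v

/-- The resolvent set `ρ(A)`. -/
def resolventSet (A : E →ₗ.[ℂ] E) : Set ℂ := {z | ∃ R : E →L[ℂ] E, IsResolventAt A z R}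

open Classical in
/-- The resolvent `(A - z)⁻¹` for `z ∈ ρ(A)` (and `0` otherwise). -/
def resolvent (A : E →ₗ.[ℂ] E) (z : ℂ) : E →L[ℂ] E :=
  if h : ∃ R : E →L[ℂ] E, IsResolventAt A z R then h.choose else 0

/-- `z` is an eigenvalue of `A`. -/
def IsEigenvalue (A : E →ₗ.[ℂ] E) (z : ℂ) : Prop :=
  ∃ v : A.domain, (v : E) ≠ 0 ∧ A v = z • (v : E)

/-- The non-real eigenvalues of `A` whose real part lies in `I`. -/
def nonrealEigenvalues (A : E →ₗ.[ℂ] E) (I : Set ℝ) : Set ℂ :=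
  {z | IsEigenvalue A z ∧ z.im ≠ 0 ∧ z.re ∈ I}

end Operators

/-- The Japanese bracket `⟨x⟩ = (1 + x²)^{1/2}`. -/
def bracket (x : ℝ) : ℝ := Real.sqrt (1 + x ^ 2)

/-- `S_a(I) = {z | Re z ∈ I, 0 < |Im z| < a}`. -/
def strip (a : ℝ) (I : Set ℝ) : Set ℂ := {z | z.re ∈ I ∧ 0 < |z.im| ∧ |z.im| < a}

/-- Polynomial resolvent estimate with exponent `n` in a punctured neighbourhood of `I`. -/
def ResolventEstimate {E : Type*} [NormedAddCommGroup E] [InnerProductSpace ℂ E]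
    (A : E →ₗ.[ℂ] E) (I : Set ℝ) (n : ℝ) : Prop :=
  ∃ a > 0, ∃ c > 0, strip a I ⊆ resolventSet A ∧
    ∀ z ∈ strip a I, ‖resolvent A z‖ ≤ c * |z.im|⁻¹ * (bracket z.re / |z.im|) ^ n

/-! ### Helffer–Sjöstrand functional calculus -/

/-- `∂_{z̄} F = (∂ₓ F + i ∂_y F) / 2`. -/
def dbar (F : ℂ → ℂ) (z : ℂ) : ℂ :=
  (1 / 2) * (fderiv ℝ F z 1 + Complex.I * fderiv ℝ F z Complex.I)

/-- A cut-off function on `ℝ`: smooth, compactly supported, equal to `1` near `0`. -/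
def IsCutoff (τ : ℝ → ℂ) : Prop :=
  ContDiff ℝ ∞ τ ∧ HasCompactSupport τ ∧ ∀ᶠ s in 𝓝 0, τ s = 1

/-- `χ(x + iy) = τ(y / ⟨x⟩)`. -/
def chi (τ : ℝ → ℂ) (z : ℂ) : ℂ := τ (z.im / bracket z.re)

/-- The almost analytic extension of `f` of order `N` with cut-off `τ`. -/
def almostAnalyticExt (f : ℝ → ℂ) (N : ℕ) (τ : ℝ → ℂ) (z : ℂ) : ℂ :=
  (∑ k ∈ Finset.range (N + 1),
    iteratedDeriv k f z.re / (k.factorial : ℂ) * (Complex.I * (z.im : ℂ)) ^ k) * chi τ z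

section FunctionalCalculus

variable {E : Type*} [NormedAddCommGroup E] [InnerProductSpace ℂ E]

/-- The cut-off `τ` is admissible for `A` on `I`: the support of `χ` contains no non-real
eigenvalue of `A` whose real part lies in `I`. -/
def IsAdmissible (A : E →ₗ.[ℂ] E) (I : Set ℝ) (τ : ℝ → ℂ) : Prop :=
  IsCutoff τ ∧ Disjoint (tsupport (chi τ)) (nonrealEigenvalues A I)

/-- The integrand `∂_{z̄} f̃(z) (A - z)⁻¹`. -/
def hsIntegrand (A : E →ₗ.[ℂ] E) (f : ℝ → ℂ) (N : ℕ) (τ : ℝ → ℂ) (z : ℂ) : E →L[ℂ] E :=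
  dbar (almostAnalyticExt f N τ) z • resolvent A z

/-- `F` is the value of the Helffer–Sjöstrand integral `π⁻¹ ∫ ∂_{z̄} f̃(z) (A - z)⁻¹ dx dy`
(convergent in operator norm), for every order `N > n` and every admissible cut-off, of which
there is at least one. -/
def IsHSValue (A : E →ₗ.[ℂ] E) (I : Set ℝ) (n : ℝ) (f : ℝ → ℂ) (F : E →L[ℂ] E) : Prop :=
  (∃ τ, IsAdmissible A I τ) ∧
    ∀ N : ℕ, n < N → ∀ τ, IsAdmissible A I τ →
      MeasureTheory.Integrable (hsIntegrand A f N τ) ∧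
        F = (Real.pi : ℂ)⁻¹ • ∫ z : ℂ, hsIntegrand A f N τ z

open Classical in
/-- The operator `f(A)`: the common value of the Helffer–Sjöstrand integrals of all sufficiently
large orders and all admissible cut-offs (and `0` if there is no such common value). -/
def funcCalc (A : E →ₗ.[ℂ] E) (I : Set ℝ) (f : ℝ → ℂ) : E →L[ℂ] E :=
  if h : ∃ F : E →L[ℂ] E, ∃ n : ℝ, IsHSValue A I n f F then h.choose else 0

/-- `σ(z) = Tr((H - z)⁻¹ - (H₀ - z)⁻¹)`. -/
def sigma [CompleteSpace E] (H H₀ : E →ₗ.[ℂ] E) (z : ℂ) : ℂ :=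
  trace (resolvent H z - resolvent H₀ z)

end FunctionalCalculus

/-- The distributional derivative: `⟨ξ', f⟩ = -⟨ξ, f'⟩`. -/
def distDeriv {Ω : TopologicalSpace.Opens ℝ} (ξ : 𝓓(Ω, ℂ) →L[ℂ] ℂ) : 𝓓(Ω, ℂ) →L[ℂ] ℂ :=
  -(ξ.comp (TestFunction.lineDerivCLM ℂ (1 : ℝ) : 𝓓(Ω, ℂ) →L[ℂ] 𝓓(Ω, ℂ)))

end

end SSF

/-!
Since `∂_{z̄} f̃ = O(|Im z| ^ N)`, it absorbs the polynomial blow-up of the resolvent at the real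
axis, so that the Helffer–Sjöstrand integrals converge. The difference of two almost analytic
extensions of `f` vanishes to order `N + 1` on the real axis; Stokes' formula on both half planes,
where the resolvent is holomorphic, then shows that the value does not depend on `N` and `τ`.

By the resolvent identity `R_H(z) - R_{H₀}(z) = -R_H(z) V R_{H₀}(z)`, whose trace norm is again
bounded by a power of `|Im z|⁻¹`. Hence the trace may be taken under the integral,
`Tr (f(H) - f(H₀)) = π⁻¹ ∫ ∂_{z̄} f̃ σ`, which is bounded by a `C^{N+1}` norm of `f`, so it is a
distribution. For the limit formula, replace `σ` by its translates `σ(· ± iε)` on the upper and the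
lower half plane: these are holomorphic up to the real axis, Stokes' formula turns the integral into
boundary values, and `ε → 0` is dominated convergence.

On an interval `Ω` every distribution `T` has a primitive. Fix `f₀` with `∫ f₀ = 1`; then
`f - (∫ f) f₀` has a compactly supported primitive `P f`, and `-T ∘ P` does the job. Uniqueness up
to a constant is the decomposition `f = (P f)' + (∫ f) f₀`.
-/

namespace SSF

section Resolvent

variable {E : Type*} [NormedAddCommGroup E] [InnerProductSpace ℂ E]
  {A : E →ₗ.[ℂ] E} {V R : E →L[ℂ] E} {z w : ℂ}

theorem IsResolventAt.unique {R' : E →L[ℂ] E} (h : IsResolventAt A z R)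
    (h' : IsResolventAt A z R') : R = R' := by
  ext u
  obtain ⟨hu, hAu⟩ := h.1 u
  have := h'.2 ⟨R u, hu⟩
  rw [hAu] at this
  exact this.symm

theorem isResolventAt_resolvent (hz : z ∈ resolventSet A) : IsResolventAt A z (resolvent A z) := by
  have h : ∃ R : E →L[ℂ] E, IsResolventAt A z R := hz
  rw [resolvent, dif_pos h]
  exact h.choose_spec

theorem IsResolventAt.mem_resolventSet (h : IsResolventAt A z R) : z ∈ resolventSet A := ⟨R, h⟩

theorem IsResolventAt.resolvent_eq (h : IsResolventAt A z R) : resolvent A z = R :=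
  (isResolventAt_resolvent h.mem_resolventSet).unique h

theorem perturb_apply (A : E →ₗ.[ℂ] E) (V : E →L[ℂ] E) (v : A.domain) :
    perturb A V v = V v + A v := rfl

theorem IsResolventAt.perturb {W : E →L[ℂ] E} (h : IsResolventAt A z R)
    (hVW : (1 + V * R) * W = 1) (hWV : W * (1 + V * R) = 1) :
    IsResolventAt (perturb A V) z (R * W) := by
  refine ⟨fun u => ?_, fun v => ?_⟩
  · obtain ⟨hu, hAu⟩ := h.1 (W u)
    refine ⟨hu, ?_⟩
    calc V (R (W u)) + A ⟨R (W u), hu⟩ - z • R (W u) = W u + V (R (W u)) := by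
          rw [add_sub_assoc, hAu, add_comm]
      _ = u := DFunLike.congr_fun hVW u
  · have hRv := h.2 v
    set u := A v - z • (v : E)
    have hu : SSF.perturb A V v - z • (v : E) = (1 + V * R) u := by
      change V v + A v - z • (v : E) = u + V (R u)
      rw [hRv, add_sub_assoc, add_comm]
    rw [hu]
    change R ((W * (1 + V * R)) u) = v
    rw [hWV]
    exact hRv

theorem IsResolventAt.of_perturb_smul_one
    (h : IsResolventAt (SSF.perturb A ((w - z) • (1 : E →L[ℂ] E))) w R) : IsResolventAt A z R := by
  have hshift (v : A.domain) :
      SSF.perturb A ((w - z) • (1 : E →L[ℂ] E)) v - w • (v : E) = A v - z • (v : E) := by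
    change (w - z) • (v : E) + A v - w • (v : E) = _
    module
  refine ⟨fun u => ?_, fun v => ?_⟩
  · obtain ⟨hu, hAu⟩ := h.1 u
    exact ⟨hu, (hshift ⟨R u, hu⟩).symm.trans hAu⟩
  · rw [← hshift]
    exact h.2 v

theorem resolvent_perturb_sub_resolvent (hz : z ∈ resolventSet A)
    (hz' : z ∈ resolventSet (perturb A V)) :
    resolvent (perturb A V) z - resolvent A z =
      -(resolvent (perturb A V) z * V * resolvent A z) := by
  ext u
  obtain ⟨hu, hAu⟩ := (isResolventAt_resolvent hz).1 u
  have hinv := (isResolventAt_resolvent hz').2 (⟨_, hu⟩ : A.domain)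
  rw [perturb_apply, add_sub_assoc, hAu, map_add] at hinv
  change resolvent (perturb A V) z u - resolvent A z u =
    -resolvent (perturb A V) z (V (resolvent A z u))
  linear_combination (norm := module) hinv

theorem eventually_resolvent_eq_mul_inverse [CompleteSpace E] (hw : w ∈ resolventSet A) :
    ∀ᶠ z in 𝓝 w, z ∈ resolventSet A ∧
      resolvent A z = resolvent A w * Ring.inverse (1 + ((w - z) • 1) * resolvent A w) := by
  have hcont : Continuous fun z : ℂ => (1 : E →L[ℂ] E) + ((w - z) • 1) * resolvent A w := by
    fun_prop
  have hunit : IsUnit ((1 : E →L[ℂ] E) + ((w - w) • 1) * resolvent A w) := by simp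
  filter_upwards [hcont.continuousAt.preimage_mem_nhds (Units.isOpen.mem_nhds hunit)] with z hz
  have h := ((isResolventAt_resolvent hw).perturb (V := (w - z) • 1)
    (Ring.mul_inverse_cancel _ hz) (Ring.inverse_mul_cancel _ hz)).of_perturb_smul_one
  exact ⟨h.mem_resolventSet, h.resolvent_eq⟩

theorem isOpen_resolventSet [CompleteSpace E] (A : E →ₗ.[ℂ] E) : IsOpen (resolventSet A) :=
  isOpen_iff_mem_nhds.2 fun _ hw =>
    (eventually_resolvent_eq_mul_inverse hw).mono fun _ hz => hz.1

theorem differentiableAt_resolvent [CompleteSpace E] (hw : w ∈ resolventSet A) :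
    DifferentiableAt ℂ (resolvent A) w := by
  have heq := (eventually_resolvent_eq_mul_inverse hw).mono fun z hz => hz.2
  refine DifferentiableAt.congr_of_eventuallyEq (.const_mul ?_ _) heq
  have hinv : DifferentiableAt ℂ (Ring.inverse : (E →L[ℂ] E) → _)
      ((1 : E →L[ℂ] E) + ((w - w) • 1) * resolvent A w) := by
    simpa using differentiableAt_inverse (𝕜 := ℂ) (R := E →L[ℂ] E) isUnit_one
  exact hinv.comp w (f := fun z : ℂ => (1 : E →L[ℂ] E) + ((w - z) • 1) * resolvent A w)
    (by fun_prop)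

theorem continuousOn_resolvent [CompleteSpace E] (A : E →ₗ.[ℂ] E) :
    ContinuousOn (resolvent A) (resolventSet A) :=
  fun _ hz => (differentiableAt_resolvent hz).continuousAt.continuousWithinAt

theorem isEigenvalue_perturb_of_hasEigenvector (h : IsResolventAt A z R) {u : E}
    (hu : u ≠ 0) (hVRu : V (R u) = -u) : IsEigenvalue (perturb A V) z := by
  obtain ⟨hd, hAu⟩ := h.1 u
  refine ⟨(⟨R u, hd⟩ : A.domain), fun hRu => hu ?_, ?_⟩
  · have hRu : R u = 0 := hRu
    simpa [hRu] using hVRu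
  · rw [perturb_apply, ← sub_eq_zero, add_sub_assoc]
    change V (R u) + (A ⟨R u, hd⟩ - z • R u) = 0
    rw [hAu, hVRu, neg_add_cancel]

theorem mem_resolventSet_perturb_of_not_isEigenvalue [CompleteSpace E] (hV : IsCompactOperator V)
    (hz : z ∈ resolventSet A) (h : ¬ IsEigenvalue (perturb A V) z) :
    z ∈ resolventSet (perturb A V) := by
  have hR := isResolventAt_resolvent hz
  set R := resolvent A z
  have hcompact : IsCompactOperator (-(V * R) : E →L[ℂ] E) := (hV.comp_clm R).neg
  have hFredholm : (1 : ℂ) ∈ _root_.resolventSet ℂ (-(V * R) : E →L[ℂ] E) := by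
    refine (hcompact.hasEigenvalue_or_mem_resolventSet one_ne_zero).resolve_left fun he => ?_
    obtain ⟨u, hu⟩ := he.exists_hasEigenvector
    have huVR : -(V (R u)) = u := by simpa using hu.apply_eq_smul
    exact h (isEigenvalue_perturb_of_hasEigenvector hR hu.2 (neg_eq_iff_eq_neg.1 huVR))
  have hunit : IsUnit (1 + V * R) := by
    simpa using spectrum.mem_resolventSet_iff.1 hFredholm
  exact (hR.perturb (Ring.mul_inverse_cancel _ hunit)
    (Ring.inverse_mul_cancel _ hunit)).mem_resolventSet

end Resolvent

section LowerBound

variable {E : Type*} [NormedAddCommGroup E] [InnerProductSpace ℂ E]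
  {A : E →ₗ.[ℂ] E} {z : ℂ} {c : ℝ}

/-- The operator `A - z` as a linear map on the domain of `A`. -/
noncomputable def subScalar (A : E →ₗ.[ℂ] E) (z : ℂ) : A.domain →ₗ[ℂ] E :=
  A.toFun - z • A.domain.subtype

theorem norm_resolvent_le (hc : 0 < c) (hle : ∀ v, c * ‖v‖ ≤ ‖subScalar A z v‖)
    (hz : z ∈ resolventSet A) : ‖resolvent A z‖ ≤ c⁻¹ := by
  refine ContinuousLinearMap.opNorm_le_bound _ (inv_nonneg.2 hc.le) fun u => ?_
  obtain ⟨hd, hAu⟩ := (isResolventAt_resolvent hz).1 u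
  have hRu := hle ⟨_, hd⟩
  rwa [show subScalar A z ⟨_, hd⟩ = u from hAu, ← le_inv_mul_iff₀ hc] at hRu

theorem antilipschitzWith_subScalar (hc : 0 < c) (hle : ∀ v, c * ‖v‖ ≤ ‖subScalar A z v‖) :
    AntilipschitzWith ⟨c⁻¹, inv_nonneg.2 hc.le⟩ (subScalar A z) :=
  AddMonoidHomClass.antilipschitz_of_bound _ fun v => (le_inv_mul_iff₀ hc).2 (hle v)

theorem mem_resolventSet_of_surjective (hc : 0 < c) (hle : ∀ v, c * ‖v‖ ≤ ‖subScalar A z v‖)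
    (hsurj : Function.Surjective (subScalar A z)) : z ∈ resolventSet A := by
  let e := LinearEquiv.ofBijective (subScalar A z)
    ⟨(antilipschitzWith_subScalar hc hle).injective, hsurj⟩
  have hbound (u : E) : ‖(e.symm u : E)‖ ≤ c⁻¹ * ‖u‖ := by
    rw [le_inv_mul_iff₀ hc]
    exact (hle (e.symm u)).trans_eq (congrArg norm (e.apply_symm_apply u))
  refine ⟨(A.domain.subtype ∘ₗ e.symm.toLinearMap).mkContinuous c⁻¹ hbound,
    fun u => ⟨(e.symm u).2, e.apply_symm_apply u⟩, fun v => ?_⟩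
  exact congrArg Subtype.val (e.symm_apply_apply v)

theorem isClosed_range_subScalar [CompleteSpace E] (hA : A.IsClosed) (hc : 0 < c)
    (hle : ∀ v, c * ‖v‖ ≤ ‖subScalar A z v‖) : IsClosed ((subScalar A z).range : Set E) := by
  refine IsSeqClosed.isClosed fun u y hu hy => ?_
  choose v hv using hu
  have hcauchy : CauchySeq v := by
    have := hy.cauchySeq
    rw [cauchySeq_iff_tendsto] at this ⊢
    refine (Filter.tendsto_comap_iff.2 ?_).mono_right
      (antilipschitzWith_subScalar hc hle).comap_uniformity_le
    rwa [← funext hv] at this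
  obtain ⟨x, hx⟩ := cauchySeq_tendsto_of_complete
    (uniformContinuous_subtype_val.comp_cauchySeq hcauchy)
  have hAv (k : ℕ) : A (v k) = u k + z • (v k : E) := sub_eq_iff_eq_add.1 (hv k)
  have hgraph : (x, y + z • x) ∈ A.graph :=
    hA.mem_of_tendsto (hx.prodMk_nhds (hy.add (hx.const_smul z))) <| .of_forall fun k =>
      (A.mem_graph_iff).2 ⟨v k, rfl, hAv k⟩
  obtain ⟨x', hx', hAx'⟩ := A.mem_graph_iff.1 hgraph
  exact ⟨x', sub_eq_iff_eq_add.2 (by simpa [hx'] using hAx')⟩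

theorem mem_resolventSet_of_orthogonal_range_eq_bot [CompleteSpace E] (hA : A.IsClosed)
    (hc : 0 < c) (hle : ∀ v, c * ‖v‖ ≤ ‖subScalar A z v‖)
    (hperp : (subScalar A z).rangeᗮ = ⊥) : z ∈ resolventSet A := by
  have hcl := isClosed_range_subScalar hA hc hle
  have : CompleteSpace (subScalar A z).range := hcl.completeSpace_coe
  exact mem_resolventSet_of_surjective hc hle
    (LinearMap.range_eq_top.1 (Submodule.orthogonal_eq_bot_iff.1 hperp))

end LowerBound

section SelfAdjoint

variable {E : Type*} [NormedAddCommGroup E] [InnerProductSpace ℂ E] {A : E →ₗ.[ℂ] E} {z : ℂ}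

theorem abs_im_mul_norm_le_of_isFormalAdjoint (hA : A.IsFormalAdjoint A) (z : ℂ) (v : A.domain) :
    |z.im| * ‖v‖ ≤ ‖subScalar A z v‖ := by
  have hreal : (inner ℂ (v : E) (A v)).im = 0 := by
    rw [← Complex.conj_eq_iff_im, inner_conj_symm, hA v v]
  have him : (inner ℂ (v : E) (subScalar A z v)).im = -(z.im * ‖v‖ ^ 2) := by
    change (inner ℂ (v : E) (A v - z • (v : E))).im = -(z.im * ‖(v : E)‖ ^ 2)
    rw [inner_sub_right, inner_smul_right, inner_self_eq_norm_sq_to_K, Complex.sub_im, hreal]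
    simp [← Complex.ofReal_pow]
  have hsq : ‖v‖ * (|z.im| * ‖v‖) ≤ ‖v‖ * ‖subScalar A z v‖ :=
    calc ‖v‖ * (|z.im| * ‖v‖) = |(inner ℂ (v : E) (subScalar A z v)).im| := by
          rw [him, abs_neg, abs_mul, abs_of_nonneg (sq_nonneg ‖v‖)]
          ring
      _ ≤ ‖inner ℂ (v : E) (subScalar A z v)‖ := Complex.abs_im_le_norm _
      _ ≤ _ := norm_inner_le_norm _ _
  rcases (norm_nonneg v).eq_or_lt with hv | hv
  · simp [← hv]
  · exact le_of_mul_le_mul_left hsq hv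

theorem nonrealEigenvalues_eq_empty_of_isFormalAdjoint (hA : A.IsFormalAdjoint A) (I : Set ℝ) :
    nonrealEigenvalues A I = ∅ := by
  refine Set.eq_empty_of_forall_notMem ?_
  rintro z ⟨⟨v, hv, hAv⟩, hz, -⟩
  have hle : |z.im| * ‖(v : E)‖ ≤ ‖A v - z • (v : E)‖ :=
    abs_im_mul_norm_le_of_isFormalAdjoint hA z v
  rw [hAv, sub_self, norm_zero] at hle
  exact hv (norm_le_zero_iff.1 (nonpos_of_mul_nonpos_right hle (abs_pos.2 hz)))

variable [CompleteSpace E]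

theorem isFormalAdjoint_self_of_isSelfAdjoint (hA : IsSelfAdjoint A) : A.IsFormalAdjoint A := by
  simpa only [LinearPMap.isSelfAdjoint_def.1 hA] using
    LinearPMap.adjoint_isFormalAdjoint hA.dense_domain

theorem orthogonal_range_subScalar_eq_bot (hA : IsSelfAdjoint A) (hz : z.im ≠ 0) :
    (subScalar A z).rangeᗮ = ⊥ := by
  rw [Submodule.eq_bot_iff]
  intro y hy
  have hyA (v : A.domain) : inner ℂ ((starRingEnd ℂ) z • y) (v : E) = inner ℂ y (A v) := by
    have hort : inner ℂ y (A v - z • (v : E)) = 0 :=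
      Submodule.inner_left_of_mem_orthogonal (LinearMap.mem_range_self (subScalar A z) v) hy
    rw [inner_smul_left, Complex.conj_conj, ← inner_smul_right, ← sub_eq_zero, ← neg_eq_zero,
      ← hort, inner_sub_right, neg_sub]
  have hgraph : (y, (starRingEnd ℂ) z • y) ∈ A.graph := by
    have hd := LinearPMap.mem_adjoint_domain_of_exists y ⟨_, hyA⟩
    rw [← LinearPMap.isSelfAdjoint_def.1 hA, LinearPMap.mem_graph_iff]
    exact ⟨⟨y, hd⟩, rfl, LinearPMap.adjoint_apply_eq hA.dense_domain ⟨y, hd⟩ hyA⟩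
  obtain ⟨v, rfl, hAv⟩ := A.mem_graph_iff.1 hgraph
  by_contra hv
  have : (starRingEnd ℂ) z ∈ nonrealEigenvalues A Set.univ := ⟨⟨v, hv, hAv⟩, by simpa, trivial⟩
  rwa [nonrealEigenvalues_eq_empty_of_isFormalAdjoint
    (isFormalAdjoint_self_of_isSelfAdjoint hA)] at this

theorem mem_resolventSet_of_im_ne_zero (hA : IsSelfAdjoint A) (hz : z.im ≠ 0) :
    z ∈ resolventSet A :=
  mem_resolventSet_of_orthogonal_range_eq_bot hA.isClosed (abs_pos.2 hz)
    (abs_im_mul_norm_le_of_isFormalAdjoint (isFormalAdjoint_self_of_isSelfAdjoint hA) z)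
    (orthogonal_range_subScalar_eq_bot hA hz)

theorem norm_resolvent_le_inv_abs_im (hA : IsSelfAdjoint A) (hz : z.im ≠ 0) :
    ‖resolvent A z‖ ≤ |z.im|⁻¹ :=
  norm_resolvent_le (abs_pos.2 hz)
    (abs_im_mul_norm_le_of_isFormalAdjoint (isFormalAdjoint_self_of_isSelfAdjoint hA) z)
    (mem_resolventSet_of_im_ne_zero hA hz)

theorem one_le_bracket (x : ℝ) : 1 ≤ bracket x :=
  Real.one_le_sqrt.2 (le_add_of_nonneg_right (sq_nonneg x))

theorem resolventEstimate_of_isSelfAdjoint (hA : IsSelfAdjoint A) (I : Set ℝ) {n : ℝ}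
    (hn : 0 ≤ n) : ResolventEstimate A I n := by
  refine ⟨1, one_pos, 1, one_pos, fun z hz => ?_, fun z hz => ?_⟩
  · exact mem_resolventSet_of_im_ne_zero hA (abs_pos.1 hz.2.1)
  · refine (norm_resolvent_le_inv_abs_im hA (abs_pos.1 hz.2.1)).trans ?_
    rw [one_mul]
    refine le_mul_of_one_le_right (by positivity) (Real.one_le_rpow ?_ hn)
    rw [le_div_iff₀ hz.2.1, one_mul]
    exact hz.2.2.le.trans (one_le_bracket _)

end SelfAdjoint

section PolarDecomposition

open ContinuousLinearMap

variable {E F G : Type*} [NormedAddCommGroup E] [InnerProductSpace ℂ E]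
  [NormedAddCommGroup F] [InnerProductSpace ℂ F] [CompleteSpace F]
  [NormedAddCommGroup G] [InnerProductSpace ℂ G] [CompleteSpace G]

theorem exists_comp_eq_of_norm_le (A : E →L[ℂ] F) (B : E →L[ℂ] G) (h : ∀ x, ‖B x‖ ≤ ‖A x‖) :
    ∃ U : F →L[ℂ] G, ‖U‖ ≤ 1 ∧ U ∘L A = B := by
  let S := A.range.topologicalClosure
  have : CompleteSpace S := A.range.isClosed_topologicalClosure.completeSpace_coe
  let e : E →L[ℂ] S :=
    A.codRestrict S fun x => A.range.le_topologicalClosure (LinearMap.mem_range_self _ x)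
  have hdense : DenseRange e := by
    intro y
    rw [closure_subtype, ← Set.range_comp]
    exact y.2
  have hle (x : E) : ‖B x‖ ≤ 1 * ‖e x‖ := (h x).trans_eq (one_mul _).symm
  refine ⟨(B.toLinearMap.extendOfNorm e.toLinearMap) ∘L S.orthogonalProjectionOnto,
    (opNorm_comp_le _ _).trans (mul_le_one₀
      (LinearMap.opNorm_extendOfNorm_le hdense zero_le_one hle) (norm_nonneg _)
      S.orthogonalProjectionOnto_norm_le), ?_⟩
  ext x
  have hproj : S.orthogonalProjectionOnto (A x) = e x :=
    S.orthogonalProjectionOnto_mem_subspace_eq_self (e x)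
  change B.toLinearMap.extendOfNorm e.toLinearMap (S.orthogonalProjectionOnto (A x)) = B x
  rw [hproj]
  exact LinearMap.extendOfNorm_eq hdense ⟨1, hle⟩ x

theorem norm_abs_apply (T : F →L[ℂ] F) (x : F) : ‖CFC.abs T x‖ = ‖T x‖ := by
  have hsa : IsSelfAdjoint (CFC.abs T) := (CFC.abs_nonneg T).isSelfAdjoint
  have hinner : inner ℂ (CFC.abs T x) (CFC.abs T x) = inner ℂ (T x) (T x) := by
    rw [← adjoint_inner_right, ← adjoint_inner_right T, hsa.adjoint_eq]
    exact congrArg (fun S : F →L[ℂ] F => inner ℂ x (S x)) (CFC.abs_mul_abs T)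
  rw [← sq_eq_sq₀ (norm_nonneg _) (norm_nonneg _), ← inner_self_eq_norm_sq (𝕜 := ℂ),
    ← inner_self_eq_norm_sq (𝕜 := ℂ), hinner]

theorem exists_polar_decomposition (T : F →L[ℂ] F) :
    ∃ U : F →L[ℂ] F, ‖U‖ ≤ 1 ∧ U * CFC.abs T = T ∧ U.adjoint * T = CFC.abs T := by
  obtain ⟨U, hU, hUT⟩ :=
    exists_comp_eq_of_norm_le (CFC.abs T) T fun x => (norm_abs_apply T x).ge
  refine ⟨U, hU, hUT, ?_⟩
  ext x
  change U.adjoint (T x) = CFC.abs T x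
  have hle : ‖U.adjoint (T x)‖ ≤ ‖T x‖ :=
    le_of_opNorm_le _ ((LinearIsometryEquiv.norm_map _ U).trans_le hU) _ |>.trans_eq (one_mul _)
  have hinner : RCLike.re (inner ℂ (U.adjoint (T x)) (CFC.abs T x)) = ‖T x‖ ^ 2 := by
    rw [adjoint_inner_left, ← comp_apply, hUT, inner_self_eq_norm_sq]
  -- The inner product attains the Cauchy–Schwarz bound, so the two vectors agree.
  have hsub := norm_sub_sq (𝕜 := ℂ) (U.adjoint (T x)) (CFC.abs T x)
  rw [hinner, norm_abs_apply] at hsub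
  rw [← sub_eq_zero, ← norm_eq_zero, ← sq_eq_zero_iff]
  nlinarith [sq_nonneg ‖U.adjoint (T x) - CFC.abs T x‖, norm_nonneg (U.adjoint (T x))]

end PolarDecomposition

section HilbertSchmidt

open ContinuousLinearMap

variable {E : Type*} [NormedAddCommGroup E] [InnerProductSpace ℂ E]
  {ι κ : Type*} (b : HilbertBasis ι ℂ E) (c : HilbertBasis κ ℂ E)

theorem tsum_enorm_inner_sq (x : E) : ∑' i, ‖inner ℂ (b i) x‖ₑ ^ 2 = ‖x‖ₑ ^ 2 := by
  have hre : HasSum (fun i => ‖inner ℂ (b i) x‖ ^ 2) (‖x‖ ^ 2) := by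
    rw [← inner_self_eq_norm_sq (𝕜 := ℂ) x]
    refine ((b.hasSum_inner_mul_inner x x).mapL Complex.reCLM).congr_fun fun i => ?_
    rw [← inner_conj_symm x (b i), mul_comm, Complex.mul_conj, ← Complex.sq_norm]
    exact (Complex.ofReal_re _).symm
  simp only [← ofReal_norm, ← ENNReal.ofReal_pow (norm_nonneg _)]
  rw [← hre.tsum_eq, ENNReal.ofReal_tsum_of_nonneg (fun _ => by positivity) hre.summable]

/-- The square `∑ᵢ ‖T bᵢ‖²` of the Hilbert–Schmidt norm of `T`, computed in the basis `b`. -/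
noncomputable def hilbertSchmidtSq (T : E →L[ℂ] E) : ENNReal := ∑' i, ‖T (b i)‖ₑ ^ 2

theorem hilbertSchmidtSq_mul_le (S T : E →L[ℂ] E) :
    hilbertSchmidtSq b (S * T) ≤ ‖S‖ₑ ^ 2 * hilbertSchmidtSq b T := by
  rw [hilbertSchmidtSq, hilbertSchmidtSq, ← ENNReal.tsum_mul_left]
  refine ENNReal.tsum_le_tsum fun i => ?_
  rw [← mul_pow]
  exact pow_le_pow_left₀ zero_le (S.le_opENorm _) 2

/-- The restriction of `T` to the span of the basis vectors indexed by `s`, extended by zero. -/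
noncomputable def finsetTruncation (T : E →L[ℂ] E) (s : Finset ι) : E →L[ℂ] E :=
  ∑ i ∈ s, InnerProductSpace.rankOne ℂ (T (b i)) (b i)

theorem isCompactOperator_finsetTruncation (T : E →L[ℂ] E) (s : Finset ι) :
    IsCompactOperator (finsetTruncation b T s) :=
  Submodule.sum_mem (compactOperator (RingHom.id ℂ) E E) fun i _ =>
    (isCompactOperator_of_locallyCompactSpace_dom (innerSL ℂ (b i)) :
      IsCompactOperator (innerSL ℂ (b i))).clm_comp (toSpanSingleton ℂ (T (b i)))

theorem hilbertSchmidtSq_sub_finsetTruncation (T : E →L[ℂ] E) (s : Finset ι) :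
    hilbertSchmidtSq b (T - finsetTruncation b T s) = ∑' i : {i // i ∉ s}, ‖T (b i)‖ₑ ^ 2 := by
  classical
  have happly (j : ι) : finsetTruncation b T s (b j) = if j ∈ s then T (b j) else 0 := by
    simp only [finsetTruncation, sum_apply, InnerProductSpace.rankOne_apply,
      orthonormal_iff_ite.1 b.orthonormal, ite_smul, one_smul, zero_smul, Finset.sum_ite_eq']
  rw [hilbertSchmidtSq]
  refine Eq.trans (tsum_congr fun j => ?_)
    (tsum_subtype {i | i ∉ s} fun i => ‖T (b i)‖ₑ ^ 2).symm
  by_cases hj : j ∈ s <;> simp [happly, hj]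

variable [CompleteSpace E]

theorem hilbertSchmidtSq_adjoint (T : E →L[ℂ] E) :
    hilbertSchmidtSq b T.adjoint = hilbertSchmidtSq c T := by
  simp_rw [hilbertSchmidtSq, ← tsum_enorm_inner_sq c (T.adjoint _), ← tsum_enorm_inner_sq b (T _)]
  rw [ENNReal.tsum_comm]
  refine tsum_congr fun k => tsum_congr fun i => ?_
  rw [adjoint_inner_right, ← inner_conj_symm, RCLike.enorm_conj]

theorem hilbertSchmidtSq_mul_le' (S T : E →L[ℂ] E) :
    hilbertSchmidtSq b (S * T) ≤ hilbertSchmidtSq b S * ‖T‖ₑ ^ 2 := by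
  calc hilbertSchmidtSq b (S * T) = hilbertSchmidtSq b (T.adjoint * S.adjoint) := by
        rw [← hilbertSchmidtSq_adjoint b b]
        exact congrArg _ (adjoint_comp S T)
    _ ≤ ‖T.adjoint‖ₑ ^ 2 * hilbertSchmidtSq b S.adjoint := hilbertSchmidtSq_mul_le b _ _
    _ = hilbertSchmidtSq b S * ‖T‖ₑ ^ 2 := by
        rw [hilbertSchmidtSq_adjoint b b, mul_comm, LinearIsometryEquiv.enorm_map]

theorem enorm_le_rpow_hilbertSchmidtSq (T : E →L[ℂ] E) :
    ‖T‖ₑ ≤ hilbertSchmidtSq b T ^ (2⁻¹ : ℝ) := by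
  have happly (x : E) : ‖T x‖ₑ ^ 2 ≤ hilbertSchmidtSq b T * ‖x‖ₑ ^ 2 := by
    rw [← tsum_enorm_inner_sq b, ← hilbertSchmidtSq_adjoint b b, hilbertSchmidtSq,
      ← ENNReal.tsum_mul_right]
    refine ENNReal.tsum_le_tsum fun i => ?_
    rw [← adjoint_inner_left, ← mul_pow]
    exact pow_le_pow_left₀ zero_le (ENNReal.coe_le_coe.2 (nnnorm_inner_le_nnnorm _ _)) 2
  refine T.opENorm_le_bound fun x => (ENNReal.pow_le_pow_left_iff two_ne_zero).1 ?_
  rw [mul_pow, ← ENNReal.rpow_mul_natCast]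
  simpa using happly x

theorem isCompactOperator_of_hilbertSchmidtSq_ne_top {T : E →L[ℂ] E}
    (h : hilbertSchmidtSq b T ≠ ⊤) : IsCompactOperator T := by
  refine isCompactOperator_of_tendsto (l := Filter.atTop) (F := finsetTruncation b T) ?_
    (.of_forall (isCompactOperator_finsetTruncation b T))
  have htail := ENNReal.tendsto_tsum_compl_atTop_zero h
  simp only [← hilbertSchmidtSq_sub_finsetTruncation b T] at htail
  have hsqrt := (ENNReal.continuous_rpow_const (y := 2⁻¹)).tendsto 0 |>.comp htail
  rw [ENNReal.zero_rpow_of_pos (by norm_num)] at hsqrt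
  rw [tendsto_iff_edist_tendsto_0]
  refine tendsto_of_tendsto_of_tendsto_of_le_of_le tendsto_const_nhds hsqrt
    (fun _ => zero_le) fun s => ?_
  rw [edist_comm, edist_eq_enorm_sub]
  exact enorm_le_rpow_hilbertSchmidtSq b _

theorem IsTraceClass.exists_eq_mul_mul {V : E →L[ℂ] E} (hV : IsTraceClass V) :
    ∃ U B : E →L[ℂ] E, ‖U‖ ≤ 1 ∧ IsSelfAdjoint B ∧ V = U * B * B ∧
      hilbertSchmidtSq (basis E) B ≠ ⊤ := by
  obtain ⟨w, b, hb⟩ := hV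
  obtain ⟨U, hU, hUV, -⟩ := exists_polar_decomposition V
  set B := CFC.sqrt (CFC.abs V)
  have hBB : B * B = CFC.abs V := CFC.sqrt_mul_sqrt_self _ (CFC.abs_nonneg V)
  have hB : IsSelfAdjoint B := (CFC.sqrt_nonneg _).isSelfAdjoint
  refine ⟨U, B, hU, hB, by rw [mul_assoc, hBB, hUV], ?_⟩
  have hnorm (i : w) : ‖B (b i)‖ₑ ^ 2 = ENNReal.ofReal (inner ℂ (b i) (CFC.abs V (b i))).re := by
    rw [← ofReal_norm, ← ENNReal.ofReal_pow (norm_nonneg _), ← inner_self_eq_norm_sq (𝕜 := ℂ),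
      ← adjoint_inner_right, hB.adjoint_eq, ← hBB]
    rfl
  rw [← hB.adjoint_eq, hilbertSchmidtSq_adjoint (basis E) b, hilbertSchmidtSq]
  simp_rw [hnorm]
  exact hb.tsum_ofReal_ne_top

theorem IsTraceClass.isCompactOperator {V : E →L[ℂ] E} (hV : IsTraceClass V) :
    IsCompactOperator V := by
  obtain ⟨U, B, -, -, rfl, h⟩ := hV.exists_eq_mul_mul
  exact (isCompactOperator_of_hilbertSchmidtSq_ne_top (basis E) h).clm_comp (U * B)

theorem sum_norm_sq_apply_le {B : E →L[ℂ] E} (h : hilbertSchmidtSq b B ≠ ⊤) (C : E →L[ℂ] E)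
    (s : Finset ι) : ∑ i ∈ s, ‖B (C (b i))‖ ^ 2 ≤ (hilbertSchmidtSq b B).toReal * ‖C‖ ^ 2 := by
  have hle := (ENNReal.sum_le_tsum s).trans (hilbertSchmidtSq_mul_le' b B C)
  have hreal := ENNReal.toReal_mono (by finiteness) hle
  rw [ENNReal.toReal_sum fun _ _ => by finiteness] at hreal
  simpa using hreal

end HilbertSchmidt

section TraceNorm

open ContinuousLinearMap MeasureTheory

variable {E : Type*} [NormedAddCommGroup E] [InnerProductSpace ℂ E] [CompleteSpace E]
  {S T : E →L[ℂ] E} {C : ℝ}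

/-- `C` bounds the trace norm of `T`. The trace norm is expressed by duality with the unit ball of
bounded operators, which makes it compatible with integrals for free. -/
def TraceNormLE (T : E →L[ℂ] E) (C : ℝ) : Prop :=
  ∀ U : E →L[ℂ] E, ‖U‖ ≤ 1 → ∀ s : Finset (basisIndex E),
    ∑ i ∈ s, ‖inner ℂ (U (basis E i)) (T (basis E i))‖ ≤ C

namespace TraceNormLE

theorem smul (hT : TraceNormLE T C) (a : ℂ) : TraceNormLE (a • T) (‖a‖ * C) := by
  intro U hU s
  simp_rw [smul_apply, inner_smul_right, norm_mul]
  rw [← Finset.mul_sum]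
  exact mul_le_mul_of_nonneg_left (hT U hU s) (norm_nonneg a)

theorem neg (hT : TraceNormLE T C) : TraceNormLE (-T) C := by
  simpa using hT.smul (-1)

theorem isTraceClass (h : TraceNormLE T C) : IsTraceClass T := by
  obtain ⟨U, hU, -, hUT⟩ := exists_polar_decomposition T
  refine ⟨basisIndex E, basis E, .of_norm ?_⟩
  refine summable_of_sum_le (c := C) (fun _ => norm_nonneg _) fun s =>
    (Finset.sum_le_sum fun i _ => ?_).trans (h U hU s)
  rw [← hUT, ← adjoint_inner_right]
  exact Complex.abs_re_le_norm _

theorem sum_norm_inner_le (h : TraceNormLE T C) (s : Finset (basisIndex E)) :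
    ∑ i ∈ s, ‖inner ℂ (basis E i) (T (basis E i))‖ ≤ C :=
  h 1 norm_id_le s

theorem summable_norm_inner (h : TraceNormLE T C) :
    Summable fun i => ‖inner ℂ (basis E i) (T (basis E i))‖ :=
  summable_of_sum_le (fun _ => norm_nonneg _) h.sum_norm_inner_le

theorem hasSum_inner (h : TraceNormLE T C) :
    HasSum (fun i => inner ℂ (basis E i) (T (basis E i))) (trace T) :=
  h.summable_norm_inner.of_norm.hasSum

theorem norm_trace_le (h : TraceNormLE T C) : ‖trace T‖ ≤ C :=
  (norm_tsum_le_tsum_norm h.summable_norm_inner).trans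
    (h.summable_norm_inner.tsum_le_of_sum_le h.sum_norm_inner_le)

end TraceNormLE

theorem IsTraceClass.exists_traceNormLE_mul_mul {V : E →L[ℂ] E} (hV : IsTraceClass V) :
    ∃ K, 0 ≤ K ∧ ∀ A C : E →L[ℂ] E, TraceNormLE (A * V * C) (K * ‖A‖ * ‖C‖) := by
  obtain ⟨U, B, hU, hB, rfl, h⟩ := hV.exists_eq_mul_mul
  set K := (hilbertSchmidtSq (basis E) B).toReal
  have hK : 0 ≤ K := ENNReal.toReal_nonneg
  refine ⟨K, hK, fun A C W hW s => ?_⟩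
  have hinner (i : basisIndex E) : ‖inner ℂ (W (basis E i)) ((A * (U * B * B) * C) (basis E i))‖ ≤
      ‖B ((U.adjoint * A.adjoint * W) (basis E i))‖ * ‖B (C (basis E i))‖ := by
    change ‖inner ℂ (W (basis E i)) (A (U (B (B (C (basis E i))))))‖ ≤ _
    rw [← adjoint_inner_left, ← adjoint_inner_left, ← adjoint_inner_left, hB.adjoint_eq]
    exact norm_inner_le_norm _ _
  have hUAW : ‖U.adjoint * A.adjoint * W‖ ≤ ‖A‖ := by
    calc ‖U.adjoint * A.adjoint * W‖ ≤ ‖U‖ * ‖A‖ * ‖W‖ := by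
          rw [← LinearIsometryEquiv.norm_map adjoint U, ← LinearIsometryEquiv.norm_map adjoint A]
          exact norm_mul₃_le
      _ ≤ 1 * ‖A‖ * 1 := by gcongr
      _ = ‖A‖ := by ring
  calc _ ≤ ∑ i ∈ s,
        ‖B ((U.adjoint * A.adjoint * W) (basis E i))‖ * ‖B (C (basis E i))‖ :=
        Finset.sum_le_sum fun i _ => hinner i
    _ ≤ √(K * ‖U.adjoint * A.adjoint * W‖ ^ 2) * √(K * ‖C‖ ^ 2) := by
        refine (Real.sum_mul_le_sqrt_mul_sqrt _ _ _).trans ?_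
        gcongr <;> exact sum_norm_sq_apply_le _ h _ s
    _ = K * ‖U.adjoint * A.adjoint * W‖ * ‖C‖ := by
        rw [← Real.sqrt_mul (by positivity), ← Real.sqrt_sq (x := _ * ‖C‖) (by positivity)]
        ring_nf
    _ ≤ K * ‖A‖ * ‖C‖ := by gcongr

theorem IsTraceClass.exists_traceNormLE {V : E →L[ℂ] E} (hV : IsTraceClass V) :
    ∃ C, TraceNormLE V C := by
  obtain ⟨K, -, hK⟩ := hV.exists_traceNormLE_mul_mul
  exact ⟨_, by simpa only [one_mul, mul_one] using hK 1 1⟩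

theorem trace_add (hS : IsTraceClass S) (hT : IsTraceClass T) :
    trace (S + T) = trace S + trace T := by
  obtain ⟨C, hC⟩ := hS.exists_traceNormLE
  obtain ⟨D, hD⟩ := hT.exists_traceNormLE
  rw [← (hC.hasSum_inner.add hD.hasSum_inner).tsum_eq]
  exact tsum_congr fun i => inner_add_right _ _ _

theorem trace_smul (a : ℂ) (T : E →L[ℂ] E) : trace (a • T) = a * trace T := by
  rw [trace, trace, ← tsum_mul_left]
  exact tsum_congr fun i => inner_smul_right _ _ _

variable {α : Type*} [MeasurableSpace α] {μ : Measure α} {R : α → E →L[ℂ] E} {m : α → ℝ}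

omit [CompleteSpace E] in
theorem integrable_inner_apply (hR : Integrable R μ) (x y : E) :
    Integrable (fun z => inner ℂ x (R z y)) μ :=
  (innerSL ℂ x).integrable_comp (hR.apply_continuousLinearMap y)

theorem inner_integral_apply (hR : Integrable R μ) (x y : E) :
    inner ℂ x ((∫ z, R z ∂μ) y) = ∫ z, inner ℂ x (R z y) ∂μ := by
  rw [ContinuousLinearMap.integral_apply hR]
  exact ((innerSL ℂ x).integral_comp_comm (hR.apply_continuousLinearMap y)).symm

namespace TraceNormLE

theorem sum_integral_norm_inner_le (hR : Integrable R μ) (hm : Integrable m μ)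
    (h : ∀ᵐ z ∂μ, TraceNormLE (R z) (m z)) {U : E →L[ℂ] E} (hU : ‖U‖ ≤ 1)
    (s : Finset (basisIndex E)) :
    ∑ i ∈ s, ∫ z, ‖inner ℂ (U (basis E i)) (R z (basis E i))‖ ∂μ ≤ ∫ z, m z ∂μ := by
  have hint (i : basisIndex E) := (integrable_inner_apply hR (U (basis E i)) (basis E i)).norm
  rw [← integral_finsetSum _ fun i _ => hint i]
  exact integral_mono_ae (integrable_finsetSum _ fun i _ => hint i) hm
    (h.mono fun z hz => hz U hU s)

theorem integral (hR : Integrable R μ) (hm : Integrable m μ)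
    (h : ∀ᵐ z ∂μ, TraceNormLE (R z) (m z)) : TraceNormLE (∫ z, R z ∂μ) (∫ z, m z ∂μ) := by
  intro U hU s
  refine le_trans (Finset.sum_le_sum fun i _ => ?_) (sum_integral_norm_inner_le hR hm h hU s)
  rw [inner_integral_apply hR]
  exact norm_integral_le_integral_norm _

-- The Hilbert basis may be uncountable, but the values of `R` are essentially separable, and each
-- operator in a countable dense set of trace class values has only countably many diagonal entries.
theorem exists_countable_forall_inner_eq_zero (hR : AEStronglyMeasurable R μ)
    (h : ∀ᵐ z ∂μ, TraceNormLE (R z) (m z)) :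
    ∃ J : Set (basisIndex E), J.Countable ∧
      ∀ᵐ z ∂μ, ∀ i ∉ J, inner ℂ (basis E i) (R z (basis E i)) = 0 := by
  obtain ⟨t, ht, hRt⟩ := hR.isSeparable_ae_range
  obtain ⟨d, hd, hdc, htd⟩ :=
    (ht.mono (t.inter_subset_left (t := {T | ∃ C, TraceNormLE T C}))).exists_countable_dense_subset
  refine ⟨⋃ T ∈ d, Function.support fun i => inner ℂ (basis E i) (T (basis E i)),
    hdc.biUnion fun T hT => ?_, ?_⟩
  · obtain ⟨C, hC⟩ := (hd hT).2
    exact hC.hasSum_inner.summable.countable_support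
  · filter_upwards [hRt, h] with z hzt hz i hi
    have hclosed : IsClosed {T : E →L[ℂ] E | inner ℂ (basis E i) (T (basis E i)) = 0} :=
      isClosed_eq (by fun_prop) continuous_const
    refine closure_minimal (fun T hT => ?_) hclosed (htd ⟨hzt, m z, hz⟩)
    by_contra hne
    exact hi (Set.mem_biUnion hT hne)

theorem trace_integral (hR : Integrable R μ) (hm : Integrable m μ)
    (h : ∀ᵐ z ∂μ, TraceNormLE (R z) (m z)) :
    trace (∫ z, R z ∂μ) = ∫ z, trace (R z) ∂μ := by
  obtain ⟨J, hJ, hzero⟩ := exists_countable_forall_inner_eq_zero hR.aestronglyMeasurable h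
  have : Countable J := hJ.to_subtype
  have hint (i : J) := integrable_inner_apply hR (basis E i) (basis E i)
  have htrace : ∀ᵐ z ∂μ,
      HasSum (fun i : J => inner ℂ (basis E i) (R z (basis E i))) (trace (R z)) := by
    filter_upwards [h, hzero] with z hz hzJ
    exact (hasSum_subtype_iff_of_support_subset
      (Function.support_subset_iff'.2 hzJ)).2 hz.hasSum_inner
  have hsum : Summable fun i : J => ∫ z, ‖inner ℂ (basis E i) (R z (basis E i))‖ ∂μ :=
    (summable_of_sum_le (fun _ => integral_nonneg fun _ => norm_nonneg _)
      (sum_integral_norm_inner_le hR hm h norm_id_le)).subtype J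
  have hdiag (i) (hi : i ∉ J) : inner ℂ (basis E i) ((∫ z, R z ∂μ) (basis E i)) = 0 := by
    rw [inner_integral_apply hR]
    exact integral_eq_zero_of_ae (hzero.mono fun z hz => hz i hi)
  calc trace (∫ z, R z ∂μ)
      = ∑' i : J, inner ℂ (basis E i) ((∫ z, R z ∂μ) (basis E i)) :=
        (tsum_subtype_eq_of_support_subset (Function.support_subset_iff'.2 hdiag)).symm
    _ = ∑' i : J, ∫ z, inner ℂ (basis E i) (R z (basis E i)) ∂μ :=
        tsum_congr fun i => inner_integral_apply hR _ _
    _ = ∫ z, ∑' i : J, inner ℂ (basis E i) (R z (basis E i)) ∂μ :=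
        (hasSum_integral_of_summable_integral_norm hint hsum).tsum_eq
    _ = ∫ z, trace (R z) ∂μ := integral_congr_ae (htrace.mono fun z hz => hz.tsum_eq)

end TraceNormLE

end TraceNorm

section Stokes

open MeasureTheory Set Complex

variable {F : Type*} [NormedAddCommGroup F] [NormedSpace ℂ F]

/-- `G` is real differentiable at `z` and `∂_{z̄} G(z) = d`; for vector-valued `G`, for which `dbar`
is not available. -/
def HasDbarAt (G : ℂ → F) (d : F) (z : ℂ) : Prop :=
  ∃ G' : ℂ →L[ℝ] F, HasFDerivAt G G' z ∧ d = (1 / 2 : ℂ) • (G' 1 + I • G' I)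

theorem HasDbarAt.unique {G : ℂ → F} {d d' : F} {z : ℂ} (h : HasDbarAt G d z)
    (h' : HasDbarAt G d' z) : d = d' := by
  obtain ⟨G₁, h₁, rfl⟩ := h
  obtain ⟨G₂, h₂, rfl⟩ := h'
  rw [h₁.unique h₂]

theorem HasDbarAt.eq_zero_of_eventuallyEq {G : ℂ → F} {d : F} {z : ℂ} (h : HasDbarAt G d z)
    (h0 : G =ᶠ[𝓝 z] 0) : d = 0 :=
  h.unique ⟨0, (hasFDerivAt_const (0 : F) z).congr_of_eventuallyEq h0, by simp⟩

theorem HasDbarAt.I_smul_fderiv_sub {G : ℂ → F} {d : F} {z : ℂ} (h : HasDbarAt G d z) :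
    I • fderiv ℝ G z 1 - fderiv ℝ G z I = (2 * I) • d := by
  obtain ⟨G', hG', rfl⟩ := h
  rw [hG'.fderiv, smul_smul, smul_add, smul_smul, show 2 * I * (1 / 2) = I by ring, I_mul_I,
    neg_one_smul, sub_eq_add_neg]

theorem hasDbarAt_smul {g : ℂ → ℂ} {R : ℂ → F} {z : ℂ} (hg : DifferentiableAt ℝ g z)
    (hR : DifferentiableAt ℂ R z) : HasDbarAt (fun w => g w • R w) (dbar g z • R z) z := by
  refine ⟨_, hg.hasFDerivAt.smul (hR.hasFDerivAt.restrictScalars ℝ), ?_⟩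
  have hI : fderiv ℂ R z I = I • fderiv ℂ R z 1 := by rw [← map_smul, smul_eq_mul, mul_one]
  simp only [dbar, add_apply, smul_apply, ContinuousLinearMap.smulRight_apply,
    ContinuousLinearMap.coe_restrictScalars', hI, smul_add, smul_smul]
  rw [show I * (g z * I) = -g z by linear_combination g z * I_mul_I]
  module

theorem reProdIm_ae_eq {s s' t t' : Set ℝ} (hs : s =ᵐ[volume] s') (ht : t =ᵐ[volume] t') :
    (s ×ℂ t : Set ℂ) =ᵐ[volume] s' ×ℂ t' :=
  volume_preserving_equiv_real_prod.quasiMeasurePreserving.preimage_ae_eq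
    (Measure.set_prod_ae_eq hs ht)

theorem setIntegral_reProdIm {Φ : ℂ → F} {a b c d : ℝ} (hab : a ≤ b) (hcd : c ≤ d)
    (hΦ : IntegrableOn Φ (Ioo a b ×ℂ Ioo c d)) :
    ∫ z in Ioo a b ×ℂ Ioo c d, Φ z = ∫ x in a..b, ∫ y in c..d, Φ (x + y * I) := by
  have hmp := volume_preserving_equiv_real_prod.symm
  have hpre : measurableEquivRealProd.symm ⁻¹' (Ioc a b ×ℂ Ioc c d) = Ioc a b ×ˢ Ioc c d := rfl
  have hcoe (p : ℝ × ℝ) : (p.1 + p.2 * I : ℂ) = measurableEquivRealProd.symm p := by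
    apply Complex.ext <;> simp [measurableEquivRealProd]
  have hae : (Ioo a b ×ℂ Ioo c d : Set ℂ) =ᵐ[volume] Ioc a b ×ℂ Ioc c d :=
    reProdIm_ae_eq Ioo_ae_eq_Ioc Ioo_ae_eq_Ioc
  have hint := (hmp.integrableOn_comp_preimage measurableEquivRealProd.symm.measurableEmbedding).2
    (hΦ.congr_set_ae hae.symm)
  rw [hpre, Measure.volume_eq_prod] at hint
  rw [setIntegral_congr_set hae,
    ← hmp.setIntegral_preimage_emb measurableEquivRealProd.symm.measurableEmbedding, hpre,
    Measure.volume_eq_prod]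
  refine (setIntegral_prod _ hint).trans ?_
  simp only [intervalIntegral.integral_of_le hab, intervalIntegral.integral_of_le hcd,
    Function.comp_apply, ← hcoe]

theorem smul_setIntegral_reProdIm_dbar [CompleteSpace F] {G D : ℂ → F} {a b c d : ℝ}
    (hab : a ≤ b) (hcd : c ≤ d) (hc : ContinuousOn G (Icc a b ×ℂ Icc c d))
    (hd : ∀ z ∈ Ioo a b ×ℂ Ioo c d, HasDbarAt G (D z) z)
    (hi : IntegrableOn D (Ioo a b ×ℂ Ioo c d)) :
    (2 * I) • ∫ z in Ioo a b ×ℂ Ioo c d, D z =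
      (∫ x in a..b, G (x + c * I)) - (∫ x in a..b, G (x + d * I)) +
        I • (∫ y in c..d, G (b + y * I)) - I • ∫ y in c..d, G (a + y * I) := by
  have hmeas : MeasurableSet (Ioo a b ×ℂ Ioo c d) :=
    (measurable_re measurableSet_Ioo).inter (measurable_im measurableSet_Ioo)
  have hΦ : IntegrableOn (fun z => I • fderiv ℝ G z 1 - fderiv ℝ G z I)
      (Ioo a b ×ℂ Ioo c d) :=
    IntegrableOn.congr_fun (hi.smul (2 * I)) (fun z hz => (hd z hz).I_smul_fderiv_sub.symm) hmeas
  have hstokes := integral_boundary_rect_of_continuousOn_of_hasFDerivAt_real G (fderiv ℝ G)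
    (⟨a, c⟩ : ℂ) ⟨b, d⟩
  simp only [uIcc_of_le hab, uIcc_of_le hcd, min_eq_left hab, min_eq_left hcd, max_eq_right hab,
    max_eq_right hcd] at hstokes
  rw [hstokes hc, ← setIntegral_reProdIm hab hcd hΦ, ← integral_smul]
  · exact setIntegral_congr_fun hmeas fun z hz => (hd z hz).I_smul_fderiv_sub.symm
  · exact fun z hz => (hd z hz).choose_spec.1.differentiableAt.hasFDerivAt
  · exact hΦ.congr_set_ae (reProdIm_ae_eq Ioo_ae_eq_Icc Ioo_ae_eq_Icc).symm

theorem HasDbarAt.eq_zero_of_lt {G D : ℂ → F} {u : ℂ → ℝ} (hu : Continuous u) {M : ℝ}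
    (h0 : ∀ z, M ≤ u z → G z = 0) {z : ℂ} (hd : HasDbarAt G (D z) z) (hz : M < u z) : D z = 0 := by
  refine hd.eq_zero_of_eventuallyEq ?_
  filter_upwards [(isOpen_lt continuous_const hu).mem_nhds hz] with w hw
  exact h0 w (le_of_lt hw)

theorem smul_setIntegral_strip_dbar [CompleteSpace F] {G D : ℂ → F} {M c d : ℝ} (hM : 0 < M)
    (hcd : c ≤ d) (h0 : ∀ z : ℂ, M ≤ |z.re| → G z = 0) (hc : ContinuousOn G (im ⁻¹' Icc c d))
    (hd : ∀ z ∈ im ⁻¹' Ioo c d, HasDbarAt G (D z) z) (hi : IntegrableOn D (im ⁻¹' Ioo c d)) :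
    (2 * I) • ∫ z in im ⁻¹' Ioo c d, D z =
      (∫ x : ℝ, G (x + c * I)) - ∫ x : ℝ, G (x + d * I) := by
  obtain ⟨L, hML⟩ := exists_gt M
  have hL : 0 < L := hM.trans hML
  have hsub : Ioo (-L) L ×ℂ Ioo c d ⊆ im ⁻¹' Ioo c d := inter_subset_right
  have hD : ∀ z ∈ im ⁻¹' Ioo c d \ (Ioo (-L) L ×ℂ Ioo c d), D z = 0 := by
    rintro z ⟨hz, hz'⟩
    refine (hd z hz).eq_zero_of_lt (continuous_abs.comp continuous_re) h0 (hML.trans_le ?_)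
    contrapose! hz'
    exact ⟨abs_lt.1 hz', hz⟩
  have hside (x : ℝ) (hx : |x| = L) : ∫ y in c..d, G (x + y * I) = 0 := by
    refine (intervalIntegral.integral_congr fun y _ => ?_).trans intervalIntegral.integral_zero
    exact h0 _ (by simp [hx, hML.le])
  have hline (y : ℝ) : ∫ x in -L..L, G (x + y * I) = ∫ x : ℝ, G (x + y * I) := by
    rw [intervalIntegral.integral_of_le (by linarith)]
    refine setIntegral_eq_integral_of_forall_compl_eq_zero fun x hx => h0 _ ?_
    contrapose! hx
    have hxL : |x| < L := by simpa using hx.trans hML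
    exact ⟨(abs_lt.1 hxL).1, (abs_lt.1 hxL).2.le⟩
  rw [setIntegral_eq_of_subset_of_forall_sdiff_eq_zero (measurable_im measurableSet_Ioo) hsub hD,
    smul_setIntegral_reProdIm_dbar (by linarith) hcd (hc.mono inter_subset_right)
      (fun z hz => hd z (hsub hz)) (hi.mono_set hsub),
    hline, hline, hside L (abs_of_pos hL), hside (-L) (by rw [abs_neg, abs_of_pos hL])]
  simp

theorem ae_im_ne_zero : ∀ᵐ z : ℂ, z.im ≠ 0 := by
  have hker : ({z : ℂ | z.im = 0} : Set ℂ) = (LinearMap.ker imLm : Submodule ℝ ℂ) := by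
    ext z; simp
  simp only [ae_iff, not_not]
  rw [hker]
  refine Measure.addHaar_submodule _ _ fun htop => ?_
  have hI : I ∈ LinearMap.ker imLm := by rw [htop]; trivial
  simp at hI

theorem measurableSet_halfPlane (s : ℝ) : MeasurableSet {z : ℂ | 0 < s * z.im} :=
  measurableSet_lt measurable_const (measurable_im.const_mul s)

theorem integral_halfPlane_dbar [CompleteSpace F] {s : ℝ} (hs : s = 1 ∨ s = -1) {G D : ℂ → F}
    {M : ℝ} (hM : 0 < M) (h0 : ∀ z : ℂ, M ≤ |z.re| ∨ M ≤ |z.im| → G z = 0)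
    (hc : ContinuousOn G {z | 0 ≤ s * z.im})
    (hd : ∀ z : ℂ, 0 < s * z.im → HasDbarAt G (D z) z)
    (hi : IntegrableOn D {z | 0 < s * z.im}) :
    ∫ z in {z : ℂ | 0 < s * z.im}, D z = (s : ℂ) • (2 * I)⁻¹ • ∫ x : ℝ, G x := by
  obtain ⟨L, hML⟩ := exists_gt M
  have hL : 0 < L := hM.trans hML
  have hD (z : ℂ) (hz : 0 < s * z.im) (hzL : L ≤ |z.im|) : D z = 0 :=
    (hd z hz).eq_zero_of_lt (continuous_abs.comp continuous_im) (fun w hw => h0 w (Or.inr hw))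
      (hML.trans_le hzL)
  have hline (y : ℝ) (hy : |y| = L) : ∫ x : ℝ, G (x + y * I) = 0 :=
    integral_eq_zero_of_ae (.of_forall fun x => h0 _ (Or.inr (by simp [hy, hML.le])))
  have hstrip (c d : ℝ) (hcd : c ≤ d) (h₁ : im ⁻¹' Icc c d ⊆ {z | 0 ≤ s * z.im})
      (h₂ : im ⁻¹' Ioo c d ⊆ {z | 0 < s * z.im})
      (h₃ : ∀ z : ℂ, 0 < s * z.im → z ∉ im ⁻¹' Ioo c d → L ≤ |z.im|) :
      ∫ z in {z : ℂ | 0 < s * z.im}, D z =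
        (2 * I)⁻¹ • ((∫ x : ℝ, G (x + c * I)) - ∫ x : ℝ, G (x + d * I)) := by
    rw [← smul_setIntegral_strip_dbar hM hcd (fun z hz => h0 z (Or.inl hz)) (hc.mono h₁)
        (fun z hz => hd z (h₂ hz)) (hi.mono_set h₂), inv_smul_smul₀ (by simp),
      setIntegral_eq_of_subset_of_forall_sdiff_eq_zero (measurableSet_halfPlane s) h₂
        fun z hz => hD z hz.1 (h₃ z hz.1 hz.2)]
  rcases hs with rfl | rfl
  · rw [hstrip 0 L hL.le (fun z hz => by simpa using hz.1) (fun z hz => by simpa using hz.1),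
      hline L (abs_of_pos hL)]
    · simp
    · intro z hz hzL
      contrapose! hzL
      exact ⟨by simpa using hz, (abs_lt.1 hzL).2⟩
  · rw [hstrip (-L) 0 (by linarith) (fun z hz => by simpa using hz.2)
      (fun z hz => by simpa using hz.2), hline (-L) (by rw [abs_neg, abs_of_pos hL])]
    · simp
    · intro z hz hzL
      contrapose! hzL
      exact ⟨(abs_lt.1 hzL).1, by simpa using hz⟩

theorem integral_eq_add_halfPlanes {D : ℂ → F} (hi : Integrable D) :
    ∫ z, D z = (∫ z in {z : ℂ | 0 < (1 : ℝ) * z.im}, D z) +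
      ∫ z in {z : ℂ | 0 < (-1 : ℝ) * z.im}, D z := by
  rw [← integral_add_compl (measurableSet_halfPlane 1) hi]
  congr 1
  refine setIntegral_congr_set ?_
  filter_upwards [ae_im_ne_zero] with z hz
  simp only [one_mul, neg_mul, Left.neg_pos_iff, eq_iff_iff]
  change ¬ (0 < z.im) ↔ z.im < 0
  rw [not_lt]
  exact ⟨fun h => lt_of_le_of_ne h hz, le_of_lt⟩

theorem integral_dbar_eq_zero [CompleteSpace F] {G D : ℂ → F} {M : ℝ} (hM : 0 < M)
    (h0 : ∀ z : ℂ, M ≤ |z.re| ∨ M ≤ |z.im| → G z = 0) (hc : Continuous G)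
    (hd : ∀ z : ℂ, z.im ≠ 0 → HasDbarAt G (D z) z) (hi : Integrable D) :
    ∫ z, D z = 0 := by
  rw [integral_eq_add_halfPlanes hi,
    integral_halfPlane_dbar (Or.inl rfl) hM h0 hc.continuousOn
      (fun z hz => hd z (fun h => by simp [h] at hz)) hi.integrableOn,
    integral_halfPlane_dbar (Or.inr rfl) hM h0 hc.continuousOn
      (fun z hz => hd z (fun h => by simp [h] at hz)) hi.integrableOn]
  simp

end Stokes


section IntegrablePowers

open MeasureTheory Set Complex

theorem integrableOn_abs_rpow {r : ℝ} (hr : -1 < r) (M : ℝ) :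
    IntegrableOn (fun y : ℝ => |y| ^ r) (Ioc (-M) M) := by
  refine (intervalIntegrable_of_even (fun y => by rw [abs_neg]) (fun x hx => ?_)).1
  exact (intervalIntegral.intervalIntegrable_rpow' hr).congr fun y hy => by
    rw [uIoc_of_le hx.le] at hy
    rw [abs_of_pos hy.1]

theorem integrableOn_box_abs_im_rpow {r : ℝ} (hr : -1 < r) (M : ℝ) :
    IntegrableOn (fun z : ℂ => |z.im| ^ r) (Ioc (-M) M ×ℂ Ioc (-M) M) := by
  have hmp := volume_preserving_equiv_real_prod
  have h1 : Integrable (fun p : ℝ × ℝ => (1 : ℝ) * |p.2| ^ r)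
      ((volume.restrict (Ioc (-M) M)).prod (volume.restrict (Ioc (-M) M))) :=
    Integrable.mul_prod (f := fun _ : ℝ => (1 : ℝ))
      (integrableOn_const (by simp) (by simp)) (integrableOn_abs_rpow hr M)
  rw [Measure.prod_restrict] at h1
  have h2 := (hmp.integrableOn_comp_preimage measurableEquivRealProd.measurableEmbedding).2 h1
  simp only [one_mul] at h2
  exact h2

theorem integrable_of_norm_le_abs_im_rpow {Y : Type*} [NormedAddCommGroup Y] {ψ : ℂ → Y}
    (hm : AEStronglyMeasurable ψ volume)
    {r C M : ℝ} (hr : -1 < r) (h0 : ∀ z : ℂ, M ≤ |z.re| ∨ M ≤ |z.im| → ψ z = 0)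
    (h : ∀ z : ℂ, z.im ≠ 0 → ‖ψ z‖ ≤ C * |z.im| ^ r) : Integrable ψ := by
  have hs : Function.support ψ ⊆ Ioc (-M) M ×ℂ Ioc (-M) M := by
    intro z hz
    have : ¬ (M ≤ |z.re| ∨ M ≤ |z.im|) := fun h => hz (h0 z h)
    simp only [not_or, not_le, abs_lt] at this
    exact ⟨⟨this.1.1, this.1.2.le⟩, ⟨this.2.1, this.2.2.le⟩⟩
  rw [← integrableOn_iff_integrable_of_support_subset hs]
  refine Integrable.mono' ((integrableOn_box_abs_im_rpow hr M).const_mul C) hm.restrict ?_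
  exact ae_restrict_of_ae (ae_im_ne_zero.mono h)

end IntegrablePowers

section Dbar

open Complex

theorem hasDbarAt_dbar {g : ℂ → ℂ} {z : ℂ} (hg : DifferentiableAt ℝ g z) :
    HasDbarAt g (dbar g z) z := ⟨_, hg.hasFDerivAt, rfl⟩

theorem HasDbarAt.dbar_eq {g : ℂ → ℂ} {d z : ℂ} (h : HasDbarAt g d z) : dbar g z = d := by
  have hd : DifferentiableAt ℝ g z := h.choose_spec.1.differentiableAt
  exact (hasDbarAt_dbar hd).unique h

theorem HasDbarAt.add {F : Type*} [NormedAddCommGroup F] [NormedSpace ℂ F] {g h : ℂ → F} {d e : F}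
    {z : ℂ} (hg : HasDbarAt g d z) (hh : HasDbarAt h e z) :
    HasDbarAt (fun w => g w + h w) (d + e) z := by
  obtain ⟨L, hL, rfl⟩ := hg
  obtain ⟨L', hL', rfl⟩ := hh
  refine ⟨_, hL.add hL', ?_⟩
  simp only [add_apply]
  module

theorem HasDbarAt.mul {g h : ℂ → ℂ} {d e z : ℂ} (hg : HasDbarAt g d z) (hh : HasDbarAt h e z) :
    HasDbarAt (fun w => g w * h w) (d * h z + g z * e) z := by
  obtain ⟨L, hL, rfl⟩ := hg
  obtain ⟨L', hL', rfl⟩ := hh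
  refine ⟨_, hL.mul hL', ?_⟩
  simp only [add_apply, smul_apply, smul_eq_mul]
  ring

theorem HasDbarAt.comp_re {u : ℝ → ℂ} {u' z : ℂ} (hu : HasDerivAt u u' z.re) :
    HasDbarAt (fun w => u w.re) (1 / 2 * u') z := by
  have h1 : HasFDerivAt (fun w : ℂ => w.re) reCLM z := reCLM.hasFDerivAt
  refine ⟨_, HasFDerivAt.comp z hu.hasFDerivAt h1, ?_⟩
  simp

theorem hasDbarAt_I_mul_im (z : ℂ) : HasDbarAt (fun w => I * (w.im : ℂ)) (-(1 / 2)) z := by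
  have h1 : HasFDerivAt (fun w : ℂ => (w.im : ℂ)) (ofRealCLM.comp imCLM) z :=
    (ofRealCLM.comp imCLM).hasFDerivAt
  refine ⟨_, h1.const_mul I, ?_⟩
  simp

theorem HasDbarAt.pow_succ {g : ℂ → ℂ} {d z : ℂ} (hg : HasDbarAt g d z) (k : ℕ) :
    HasDbarAt (fun w => g w ^ (k + 1)) ((k + 1) * g z ^ k * d) z := by
  obtain ⟨L, hL, rfl⟩ := hg
  refine ⟨_, hL.pow (k + 1), ?_⟩
  simp only [smul_apply, smul_eq_mul]
  push_cast
  simp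
  ring

/-- The Taylor polynomial part of the almost analytic extension. -/
noncomputable def taylorExt (f : ℝ → ℂ) (N : ℕ) (z : ℂ) : ℂ :=
  ∑ k ∈ Finset.range (N + 1),
    iteratedDeriv k f z.re / (k.factorial : ℂ) * (I * (z.im : ℂ)) ^ k

theorem almostAnalyticExt_eq (f : ℝ → ℂ) (N : ℕ) (τ : ℝ → ℂ) (z : ℂ) :
    almostAnalyticExt f N τ z = taylorExt f N z * chi τ z := rfl

theorem taylorExt_succ (f : ℝ → ℂ) (N : ℕ) (z : ℂ) :
    taylorExt f (N + 1) z = taylorExt f N z +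
      iteratedDeriv (N + 1) f z.re / ((N + 1).factorial : ℂ) * (I * (z.im : ℂ)) ^ (N + 1) := by
  rw [taylorExt, Finset.sum_range_succ, taylorExt]

theorem hasDerivAt_iteratedDeriv {f : ℝ → ℂ} (hf : ContDiff ℝ ∞ f) (k : ℕ) (x : ℝ) :
    HasDerivAt (iteratedDeriv k f) (iteratedDeriv (k + 1) f x) x := by
  rw [iteratedDeriv_succ]
  exact (hf.differentiable_iteratedDeriv k (mod_cast ENat.natCast_lt_top k) x).hasDerivAt

theorem hasDbarAt_taylorExt {f : ℝ → ℂ} (hf : ContDiff ℝ ∞ f) (N : ℕ) (z : ℂ) :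
    HasDbarAt (taylorExt f N)
      (1 / 2 * (iteratedDeriv (N + 1) f z.re / (N.factorial : ℂ) * (I * (z.im : ℂ)) ^ N)) z := by
  induction N with
  | zero =>
    have : taylorExt f 0 = fun w => f w.re := by
      ext w; simp [taylorExt]
    rw [this]
    have h := HasDbarAt.comp_re (hasDerivAt_iteratedDeriv hf 0 z.re)
    simpa using h
  | succ N ih =>
    have h1 := (HasDbarAt.comp_re
      ((hasDerivAt_iteratedDeriv hf (N + 1) z.re).div_const ((N + 1).factorial : ℂ))).mul
      ((hasDbarAt_I_mul_im z).pow_succ N)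
    have h2 := ih.add h1
    have e : taylorExt f (N + 1) = fun w => taylorExt f N w +
        iteratedDeriv (N + 1) f w.re / ((N + 1).factorial : ℂ) * (I * (w.im : ℂ)) ^ (N + 1) :=
      funext fun w => taylorExt_succ f N w
    rw [e]
    convert h2 using 1
    have hN : ((N + 1).factorial : ℂ) = (N + 1) * N.factorial := by
      rw [Nat.factorial_succ]; push_cast; ring
    have h3 : (N.factorial : ℂ) ≠ 0 := by exact_mod_cast N.factorial_ne_zero
    have h4 : (N + 1 : ℂ) ≠ 0 := by exact_mod_cast N.succ_ne_zero
    rw [hN]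
    field_simp
    ring

theorem contDiff_iteratedDeriv {f : ℝ → ℂ} (hf : ContDiff ℝ ∞ f) (k : ℕ) :
    ContDiff ℝ ∞ (iteratedDeriv k f) := by
  rw [iteratedDeriv_eq_iterate]
  exact hf.iterate_deriv k

theorem contDiff_taylorExt {f : ℝ → ℂ} (hf : ContDiff ℝ ∞ f) (N : ℕ) :
    ContDiff ℝ ∞ (taylorExt f N) := by
  refine ContDiff.sum fun k _ => ?_
  have h1 : ContDiff ℝ ∞ fun z : ℂ => iteratedDeriv k f z.re :=
    (contDiff_iteratedDeriv hf k).comp reCLM.contDiff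
  have h2 : ContDiff ℝ ∞ fun z : ℂ => I * (z.im : ℂ) :=
    contDiff_const.mul (ofRealCLM.comp imCLM).contDiff
  exact (h1.div_const _).mul (h2.pow k)

theorem contDiff_bracket : ContDiff ℝ ∞ bracket :=
  ContDiff.sqrt (by fun_prop) fun x => by positivity

theorem bracket_pos (x : ℝ) : 0 < bracket x := one_pos.trans_le (one_le_bracket x)

theorem contDiff_chi {τ : ℝ → ℂ} (hτ : IsCutoff τ) : ContDiff ℝ ∞ (chi τ) := by
  have h1 : ContDiff ℝ ∞ fun z : ℂ => z.im / bracket z.re :=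
    imCLM.contDiff.div (contDiff_bracket.comp reCLM.contDiff) fun z => (bracket_pos _).ne'
  exact hτ.1.comp h1

theorem contDiff_almostAnalyticExt {f : ℝ → ℂ} (hf : ContDiff ℝ ∞ f) (N : ℕ) {τ : ℝ → ℂ}
    (hτ : IsCutoff τ) : ContDiff ℝ ∞ (almostAnalyticExt f N τ) :=
  (contDiff_taylorExt hf N).mul (contDiff_chi hτ)

theorem continuous_dbar {g : ℂ → ℂ} (hg : ContDiff ℝ ∞ g) : Continuous (dbar g) := by
  have h := hg.continuous_fderiv (by simp)
  unfold dbar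
  fun_prop

theorem dbar_almostAnalyticExt {f : ℝ → ℂ} (hf : ContDiff ℝ ∞ f) (N : ℕ) {τ : ℝ → ℂ}
    (hτ : IsCutoff τ) (z : ℂ) :
    dbar (almostAnalyticExt f N τ) z =
      1 / 2 * (iteratedDeriv (N + 1) f z.re / (N.factorial : ℂ) * (I * (z.im : ℂ)) ^ N) * chi τ z +
        taylorExt f N z * dbar (chi τ) z :=
  ((hasDbarAt_taylorExt hf N z).mul
    (hasDbarAt_dbar ((contDiff_chi hτ).differentiable (by simp) z))).dbar_eq

end Dbar

section Supports

open Complex Set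

theorem IsCutoff.exists_bounds {τ : ℝ → ℂ} (hτ : IsCutoff τ) :
    ∃ δ > 0, ∃ R > 0, (∀ s, |s| < δ → τ s = 1) ∧ ∀ s, R ≤ |s| → τ s = 0 := by
  obtain ⟨-, hc, h1⟩ := hτ
  obtain ⟨δ, hδ, h⟩ := Metric.eventually_nhds_iff.1 h1
  obtain ⟨R, hR, h'⟩ := hc.isCompact.isBounded.subset_ball_lt 0 0
  refine ⟨δ, hδ, R, hR, fun s hs => h (by simpa using hs), fun s hs => ?_⟩
  by_contra hne
  have := h' (subset_tsupport τ hne)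
  rw [mem_ball_zero_iff, Real.norm_eq_abs] at this
  linarith

theorem exists_cutoff {r : ℝ} (hr : 0 < r) : ∃ τ, IsCutoff τ ∧ ∀ s, r ≤ |s| → τ s = 0 := by
  let φ : ContDiffBump (0 : ℝ) := ⟨r / 2, r, by positivity, by linarith⟩
  refine ⟨fun s => (φ s : ℂ), ⟨?_, ?_, ?_⟩, fun s hs => ?_⟩
  · exact ofRealCLM.contDiff.comp φ.contDiff
  · exact φ.hasCompactSupport.comp_left (g := ((↑) : ℝ → ℂ)) ofReal_zero
  · filter_upwards [φ.eventuallyEq_one] with s hs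
    rw [hs, Pi.one_apply, ofReal_one]
  · beta_reduce
    rw [φ.zero_of_le_dist (by simpa using hs), ofReal_zero]

theorem chi_eq_one {τ : ℝ → ℂ} {δ : ℝ} (h : ∀ s, |s| < δ → τ s = 1) {z : ℂ} (hz : |z.im| < δ) :
    chi τ z = 1 := by
  refine h _ (lt_of_le_of_lt ?_ hz)
  rw [abs_div, abs_of_pos (bracket_pos _)]
  exact div_le_self (abs_nonneg _) (one_le_bracket _)

theorem chi_eq_zero {τ : ℝ → ℂ} {R : ℝ} (h : ∀ s, R ≤ |s| → τ s = 0) {z : ℂ}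
    (hz : R * bracket z.re ≤ |z.im|) : chi τ z = 0 := by
  refine h _ ?_
  rwa [abs_div, abs_of_pos (bracket_pos _), le_div_iff₀ (bracket_pos _)]

theorem almostAnalyticExt_ofReal (f : ℝ → ℂ) (N : ℕ) {τ : ℝ → ℂ} (hτ : IsCutoff τ) (x : ℝ) :
    almostAnalyticExt f N τ x = f x := by
  have h : chi τ x = 1 := by simpa [chi] using hτ.2.2.self_of_nhds
  rw [almostAnalyticExt_eq, h, mul_one, taylorExt, Finset.sum_range_succ']
  simp

theorem tsupport_chi_subset {τ : ℝ → ℂ} {R : ℝ} (h : ∀ s, R ≤ |s| → τ s = 0) :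
    tsupport (chi τ) ⊆ {z | |z.im| ≤ R * bracket z.re} := by
  refine closure_minimal (fun z hz => ?_) ?_
  · by_contra hlt
    exact hz (chi_eq_zero h (le_of_lt (not_le.1 hlt)))
  · exact isClosed_le (continuous_abs.comp continuous_im)
      (continuous_const.mul (contDiff_bracket.continuous.comp continuous_re))

theorem exists_abs_im_le_of_mem_tsupport_chi {τ : ℝ → ℂ} (hτ : IsCutoff τ) {K : Set ℝ}
    (hK : IsCompact K) : ∃ Y > 0, ∀ z ∈ tsupport (chi τ), z.re ∈ K → |z.im| ≤ Y := by
  obtain ⟨-, -, R, hR, -, h⟩ := hτ.exists_bounds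
  obtain ⟨B, hB⟩ := hK.exists_bound_of_continuousOn contDiff_bracket.continuous.continuousOn
  refine ⟨max (R * B) 1, by positivity, fun z hz hzK => ?_⟩
  have hbr : bracket z.re ≤ B := (le_abs_self _).trans (hB _ hzK)
  exact (tsupport_chi_subset h hz).trans ((by gcongr : _ ≤ R * B).trans (le_max_left _ _))

theorem exists_cutoff_abs_im_le {K : Set ℝ} (hK : IsCompact K) {r : ℝ} (hr : 0 < r) :
    ∃ τ, IsCutoff τ ∧ ∀ z ∈ tsupport (chi τ), z.re ∈ K → |z.im| ≤ r := by
  obtain ⟨B, hB⟩ := hK.exists_bound_of_continuousOn contDiff_bracket.continuous.continuousOn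
  have hB' : 0 < max B 1 := by positivity
  obtain ⟨τ, hτ, h⟩ := exists_cutoff (div_pos hr hB')
  refine ⟨τ, hτ, fun z hz hzK => ?_⟩
  have hbr : bracket z.re ≤ max B 1 :=
    (le_abs_self _).trans ((hB _ hzK).trans (le_max_left _ _))
  calc |z.im| ≤ r / max B 1 * bracket z.re := tsupport_chi_subset h hz
    _ ≤ r / max B 1 * max B 1 := by gcongr
    _ = r := div_mul_cancel₀ _ hB'.ne'

theorem iteratedDeriv_eq_zero_of_notMem_tsupport {f : ℝ → ℂ} {x : ℝ} (hx : x ∉ tsupport f)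
    (k : ℕ) : iteratedDeriv k f x = 0 := by
  have h : f =ᶠ[𝓝 x] fun _ => (0 : ℂ) := notMem_tsupport_iff_eventuallyEq.1 hx
  rw [h.iteratedDeriv_eq k]
  simp

theorem taylorExt_eq_zero {f : ℝ → ℂ} {z : ℂ} (hz : z.re ∉ tsupport f) (N : ℕ) :
    taylorExt f N z = 0 :=
  Finset.sum_eq_zero fun k _ => by simp [iteratedDeriv_eq_zero_of_notMem_tsupport hz k]

theorem tsupport_almostAnalyticExt_subset (f : ℝ → ℂ) (N : ℕ) (τ : ℝ → ℂ) :
    tsupport (almostAnalyticExt f N τ) ⊆ re ⁻¹' tsupport f ∩ tsupport (chi τ) := by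
  refine subset_inter ?_ (closure_mono fun z hz => right_ne_zero_of_mul hz)
  refine closure_minimal (fun z hz => ?_) ((isClosed_tsupport f).preimage continuous_re)
  by_contra h
  exact hz (by rw [almostAnalyticExt_eq, taylorExt_eq_zero h, zero_mul])

theorem hasCompactSupport_almostAnalyticExt {f : ℝ → ℂ} (hf : HasCompactSupport f) (N : ℕ)
    {τ : ℝ → ℂ} (hτ : IsCutoff τ) : HasCompactSupport (almostAnalyticExt f N τ) := by
  obtain ⟨Y, -, hY⟩ := exists_abs_im_le_of_mem_tsupport_chi hτ hf.isCompact
  refine (hf.isCompact.reProdIm (isCompact_Icc (a := -Y) (b := Y))).of_isClosed_subset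
    (isClosed_tsupport _) fun z hz => ?_
  obtain ⟨h1, h2⟩ := tsupport_almostAnalyticExt_subset f N τ hz
  exact ⟨h1, abs_le.1 (hY z h2 h1)⟩

theorem exists_box {g : ℂ → ℂ} (hg : HasCompactSupport g) :
    ∃ M > 0, ∀ z : ℂ, M ≤ |z.re| ∨ M ≤ |z.im| → z ∉ tsupport g := by
  obtain ⟨M, hM, h⟩ := hg.isCompact.isBounded.subset_ball_lt 0 0
  refine ⟨M, hM, fun z hz hmem => ?_⟩
  have := h hmem
  rw [mem_ball_zero_iff] at this
  rcases hz with hz | hz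
  · exact absurd (hz.trans (abs_re_le_norm z)) (not_le.2 this)
  · exact absurd (hz.trans (abs_im_le_norm z)) (not_le.2 this)

theorem dbar_eq_zero_of_notMem_tsupport {g : ℂ → ℂ} {z : ℂ} (hz : z ∉ tsupport g) :
    dbar g z = 0 := by
  have h : g =ᶠ[𝓝 z] fun _ => 0 := notMem_tsupport_iff_eventuallyEq.1 hz
  simp [dbar, h.fderiv_eq]

end Supports

section Admissible

variable {E : Type*} [NormedAddCommGroup E] [InnerProductSpace ℂ E] {A : E →ₗ.[ℂ] E} {I : Set ℝ}

theorem exists_isAdmissible_of_finite (h : (nonrealEigenvalues A I).Finite) :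
    ∃ τ, IsAdmissible A I τ := by
  have hsmall : ∀ᶠ r in 𝓝[>] (0 : ℝ), ∀ z ∈ nonrealEigenvalues A I, r * bracket z.re < |z.im| := by
    rw [Filter.eventually_all_finite h]
    intro z hz
    have hc : Continuous fun r : ℝ => r * bracket z.re := by fun_prop
    have hlim := hc.tendsto 0
    rw [zero_mul] at hlim
    exact (hlim.mono_left nhdsWithin_le_nhds).eventually_lt_const (abs_pos.2 hz.2.1)
  obtain ⟨r, hr, hr0⟩ := (hsmall.and self_mem_nhdsWithin).exists
  obtain ⟨τ, hτ, hτr⟩ := exists_cutoff hr0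
  exact ⟨τ, hτ, Set.disjoint_left.2 fun z hz hz' =>
    (tsupport_chi_subset hτr hz).not_gt (hr z hz')⟩

theorem IsCutoff.mul {τ τ' : ℝ → ℂ} (hτ : IsCutoff τ) (hτ' : IsCutoff τ') :
    IsCutoff fun s => τ s * τ' s := by
  refine ⟨hτ.1.mul hτ'.1, hτ.2.1.mul_right, ?_⟩
  filter_upwards [hτ.2.2, hτ'.2.2] with s h h'
  rw [h, h', one_mul]

theorem tsupport_chi_mul_subset (τ τ' : ℝ → ℂ) :
    tsupport (chi fun s => τ s * τ' s) ⊆ tsupport (chi τ) ∩ tsupport (chi τ') :=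
  Set.subset_inter (closure_mono fun _ => left_ne_zero_of_mul)
    (closure_mono fun _ => right_ne_zero_of_mul)

theorem exists_isAdmissible_abs_im_le {B : E →ₗ.[ℂ] E} (hA : ∃ τ, IsAdmissible A I τ)
    (hB : ∃ τ, IsAdmissible B I τ) {K : Set ℝ} (hK : IsCompact K) {r : ℝ} (hr : 0 < r) :
    ∃ τ, IsAdmissible A I τ ∧ IsAdmissible B I τ ∧
      ∀ z ∈ tsupport (chi τ), z.re ∈ K → |z.im| ≤ r := by
  obtain ⟨τ₁, hτ₁⟩ := hA
  obtain ⟨τ₂, hτ₂⟩ := hB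
  obtain ⟨τ₃, hτ₃, h⟩ := exists_cutoff_abs_im_le hK hr
  have hsub {z : ℂ} (hz : z ∈ tsupport (chi fun s => τ₁ s * (τ₂ s * τ₃ s))) :
      z ∈ tsupport (chi τ₁) ∧ z ∈ tsupport (chi τ₂) ∧ z ∈ tsupport (chi τ₃) :=
    (tsupport_chi_mul_subset _ _ hz).imp_right fun hz => tsupport_chi_mul_subset _ _ hz
  have hτ := hτ₁.1.mul (hτ₂.1.mul hτ₃)
  exact ⟨_, ⟨hτ, hτ₁.2.mono_left fun z hz => (hsub hz).1⟩,
    ⟨hτ, hτ₂.2.mono_left fun z hz => (hsub hz).2.1⟩, fun z hz => h z (hsub hz).2.2⟩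

end Admissible

section Bounds

open Complex Set

theorem exists_norm_le_mul_abs_im_pow {F : Type*} [SeminormedAddCommGroup F] {S : Set ℂ}
    {h : ℂ → F} {B C δ : ℝ} (hδ : 0 < δ) (m : ℕ) (hB : ∀ z ∈ S, ‖h z‖ ≤ B)
    (hC : ∀ z ∈ S, |z.im| < δ → ‖h z‖ ≤ C * |z.im| ^ m) :
    ∃ C' ≥ 0, ∀ z ∈ S, ‖h z‖ ≤ C' * |z.im| ^ m := by
  refine ⟨max (|B| / δ ^ m) C, by positivity, fun z hz => ?_⟩
  rcases lt_or_ge |z.im| δ with hlt | hge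
  · exact (hC z hz hlt).trans (by gcongr; exact le_max_right _ _)
  · calc ‖h z‖ ≤ |B| / δ ^ m * δ ^ m := by
          rw [div_mul_cancel₀ _ (by positivity)]
          exact (hB z hz).trans (le_abs_self B)
      _ ≤ max (|B| / δ ^ m) C * |z.im| ^ m := by gcongr; exact le_max_left _ _

/-- The size of the `N`-jet of `f` at `x`, in terms of which all bounds on almost analytic
extensions are stated: for continuity in `f` they have to be uniform in `f`. -/
noncomputable def jetNorm (f : ℝ → ℂ) (N : ℕ) (x : ℝ) : ℝ :=
  ∑ k ∈ Finset.range (N + 1), ‖iteratedDeriv k f x‖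

theorem jetNorm_nonneg (f : ℝ → ℂ) (N : ℕ) (x : ℝ) : 0 ≤ jetNorm f N x :=
  Finset.sum_nonneg fun _ _ => norm_nonneg _

theorem norm_iteratedDeriv_le_jetNorm (f : ℝ → ℂ) {k N : ℕ} (h : k ≤ N) (x : ℝ) :
    ‖iteratedDeriv k f x‖ ≤ jetNorm f N x :=
  Finset.single_le_sum (f := fun k => ‖iteratedDeriv k f x‖) (fun _ _ => norm_nonneg _)
    (Finset.mem_range_succ_iff.2 h)

theorem jetNorm_mono (f : ℝ → ℂ) (x : ℝ) : Monotone fun N => jetNorm f N x := fun _ _ h =>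
  Finset.sum_le_sum_of_subset_of_nonneg (Finset.range_subset_range.2 (by lia))
    fun _ _ _ => norm_nonneg _

theorem exists_norm_iteratedDeriv_le {f : ℝ → ℂ} (hf : ContDiff ℝ ∞ f) (hc : HasCompactSupport f)
    (k : ℕ) : ∃ B ≥ 0, ∀ x, ‖iteratedDeriv k f x‖ ≤ B := by
  have h : HasCompactSupport (iteratedDeriv k f) :=
    HasCompactSupport.intro hc.isCompact fun x hx => iteratedDeriv_eq_zero_of_notMem_tsupport hx k
  obtain ⟨B, hB⟩ := (contDiff_iteratedDeriv hf k).continuous.bounded_above_of_compact_support h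
  exact ⟨B, (norm_nonneg _).trans (hB 0), hB⟩

theorem exists_jetNorm_le {f : ℝ → ℂ} (hf : ContDiff ℝ ∞ f) (hc : HasCompactSupport f) (N : ℕ) :
    ∃ B ≥ 0, ∀ x, jetNorm f N x ≤ B := by
  choose B hB hfB using exists_norm_iteratedDeriv_le hf hc
  exact ⟨∑ k ∈ Finset.range (N + 1), B k, Finset.sum_nonneg fun k _ => hB k,
    fun x => Finset.sum_le_sum fun k _ => hfB k x⟩

theorem norm_div_factorial_mul_le (c : ℂ) (k m : ℕ) (y : ℝ) :
    ‖c / (k.factorial : ℂ) * (I * (y : ℂ)) ^ m‖ ≤ ‖c‖ * |y| ^ m := by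
  rw [norm_mul, norm_div, norm_pow, norm_mul, norm_I, one_mul, norm_real, Real.norm_eq_abs,
    Complex.norm_natCast]
  gcongr
  exact div_le_self (norm_nonneg _) (by exact_mod_cast k.factorial_pos)

theorem norm_taylorExt_le (f : ℝ → ℂ) (N : ℕ) {z : ℂ} {Y : ℝ} (hz : |z.im| ≤ Y) :
    ‖taylorExt f N z‖ ≤ (1 + Y) ^ N * jetNorm f N z.re := by
  rw [jetNorm, Finset.mul_sum]
  refine norm_sum_le_of_le _ fun k hk => (norm_div_factorial_mul_le _ _ _ _).trans ?_
  have hY : 0 ≤ Y := (abs_nonneg _).trans hz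
  have hpow : |z.im| ^ k ≤ (1 + Y) ^ N :=
    calc |z.im| ^ k ≤ (1 + Y) ^ k := by gcongr; linarith
      _ ≤ _ := pow_le_pow_right₀ (by linarith) (Finset.mem_range_succ_iff.1 hk)
  rw [mul_comm]
  gcongr

theorem exists_dbar_chi_bound {τ : ℝ → ℂ} (hτ : IsCutoff τ) {K : Set ℝ} (hK : IsCompact K)
    (m : ℕ) : ∃ C ≥ 0, ∀ z ∈ re ⁻¹' K, ‖dbar (chi τ) z‖ ≤ C * |z.im| ^ m := by
  obtain ⟨δ, hδ, -, -, h1, -⟩ := hτ.exists_bounds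
  obtain ⟨Y, -, hY⟩ := exists_abs_im_le_of_mem_tsupport_chi hτ hK
  obtain ⟨B, hB⟩ := (hK.reProdIm (isCompact_Icc (a := -Y) (b := Y))).exists_bound_of_continuousOn
    (continuous_dbar (contDiff_chi hτ)).continuousOn
  refine exists_norm_le_mul_abs_im_pow (B := max B 0) (C := 0) hδ m (fun z hz => ?_)
    fun z _ hz => ?_
  · by_cases hsupp : z ∈ tsupport (chi τ)
    · exact (hB z ⟨hz, abs_le.1 (hY z hsupp hz)⟩).trans (le_max_left _ _)
    · rw [dbar_eq_zero_of_notMem_tsupport hsupp, norm_zero]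
      exact le_max_right _ _
  · have hone : chi τ =ᶠ[𝓝 z] fun _ => 1 := by
      filter_upwards [(continuous_abs.comp continuous_im).continuousAt.eventually_lt_const hz]
        with w hw using chi_eq_one h1 hw
    simp [dbar, hone.fderiv_eq]

theorem exists_dbar_bound {τ : ℝ → ℂ} (hτ : IsCutoff τ) {K : Set ℝ} (hK : IsCompact K) (N : ℕ) :
    ∃ C ≥ 0, ∀ f : ℝ → ℂ, ContDiff ℝ ∞ f → ∀ z ∈ re ⁻¹' K,
      ‖dbar (almostAnalyticExt f N τ) z‖ ≤ C * jetNorm f (N + 1) z.re * |z.im| ^ N := by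
  obtain ⟨Y, hY, hsupp⟩ := exists_abs_im_le_of_mem_tsupport_chi hτ hK
  obtain ⟨C, hC, hchi⟩ := exists_dbar_chi_bound hτ hK N
  obtain ⟨T, hT⟩ := hτ.1.continuous.bounded_above_of_compact_support hτ.2.1
  have hT0 : 0 ≤ T := (norm_nonneg _).trans (hT 0)
  refine ⟨T + (1 + Y) ^ N * C, by positivity, fun f hf z hz => ?_⟩
  rw [dbar_almostAnalyticExt hf N hτ]
  set J := jetNorm f (N + 1) z.re
  have hJ0 : 0 ≤ J := jetNorm_nonneg _ _ _
  have hremainder : ‖1 / 2 * (iteratedDeriv (N + 1) f z.re / (N.factorial : ℂ) *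
      (I * (z.im : ℂ)) ^ N) * chi τ z‖ ≤ 1 * (J * |z.im| ^ N) * T := by
    rw [norm_mul, norm_mul]
    gcongr
    · norm_num
    · refine (norm_div_factorial_mul_le _ _ _ _).trans ?_
      gcongr
      exact norm_iteratedDeriv_le_jetNorm f le_rfl _
    · exact hT _
  have hcutoff : ‖taylorExt f N z * dbar (chi τ) z‖ ≤ (1 + Y) ^ N * J * (C * |z.im| ^ N) := by
    by_cases hz' : z ∈ tsupport (chi τ)
    · rw [norm_mul]
      gcongr
      · refine (norm_taylorExt_le f N (hsupp z hz' hz)).trans ?_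
        gcongr
        exact jetNorm_mono f _ N.le_succ
      · exact hchi z hz
    · rw [dbar_eq_zero_of_notMem_tsupport hz', mul_zero, norm_zero]
      positivity
  exact (norm_add_le_of_le hremainder hcutoff).trans_eq (by ring)

theorem exists_dbar_almostAnalyticExt_bound {f : ℝ → ℂ} (hf : ContDiff ℝ ∞ f)
    (hc : HasCompactSupport f) (N : ℕ) {τ : ℝ → ℂ} (hτ : IsCutoff τ) :
    ∃ C ≥ 0, ∀ z : ℂ, ‖dbar (almostAnalyticExt f N τ) z‖ ≤ C * |z.im| ^ N := by
  obtain ⟨C, hC, h⟩ := exists_dbar_bound hτ hc.isCompact N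
  obtain ⟨B, hB, hfB⟩ := exists_jetNorm_le hf hc (N + 1)
  refine ⟨C * B, by positivity, fun z => ?_⟩
  by_cases hz : z.re ∈ tsupport f
  · refine (h f hf z hz).trans ?_
    gcongr
    exact hfB _
  · rw [dbar_eq_zero_of_notMem_tsupport fun h' =>
      hz (tsupport_almostAnalyticExt_subset f N τ h').1, norm_zero]
    positivity

theorem exists_taylorExt_sub_bound {f : ℝ → ℂ} (hf : ContDiff ℝ ∞ f) (hc : HasCompactSupport f)
    {Y : ℝ} (hY : 0 < Y) {N N' : ℕ} (h : N ≤ N') :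
    ∃ C ≥ 0, ∀ z : ℂ, |z.im| ≤ Y →
      ‖taylorExt f N' z - taylorExt f N z‖ ≤ C * |z.im| ^ (N + 1) := by
  induction N', h using Nat.le_induction with
  | base => exact ⟨0, le_rfl, fun z _ => by simp⟩
  | succ m hm ih =>
    obtain ⟨C, hC, h⟩ := ih
    obtain ⟨B, hB, hfB⟩ := exists_norm_iteratedDeriv_le hf hc (m + 1)
    refine ⟨C + B * Y ^ (m - N), by positivity, fun z hz => ?_⟩
    rw [taylorExt_succ, add_sub_right_comm, add_mul]
    refine norm_add_le_of_le (h z hz) ((norm_div_factorial_mul_le _ _ _ _).trans ?_)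
    have hsplit : |z.im| ^ (m + 1) = |z.im| ^ (m - N) * |z.im| ^ (N + 1) := by
      rw [← pow_add, show m - N + (N + 1) = m + 1 by lia]
    rw [hsplit, mul_assoc]
    gcongr
    exact hfB _

theorem exists_almostAnalyticExt_sub_bound {f : ℝ → ℂ} (hf : ContDiff ℝ ∞ f)
    (hc : HasCompactSupport f) {N N' : ℕ} (h : N ≤ N') {τ τ' : ℝ → ℂ} (hτ : IsCutoff τ)
    (hτ' : IsCutoff τ') :
    ∃ C ≥ 0, ∀ z : ℂ, ‖almostAnalyticExt f N' τ' z - almostAnalyticExt f N τ z‖ ≤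
      C * |z.im| ^ (N + 1) := by
  obtain ⟨δ, hδ, -, -, h1, -⟩ := hτ.exists_bounds
  obtain ⟨δ', hδ', -, -, h1', -⟩ := hτ'.exists_bounds
  have hδ₀ : 0 < min δ δ' := lt_min hδ hδ'
  obtain ⟨C, -, hC⟩ := exists_taylorExt_sub_bound hf hc hδ₀ h
  obtain ⟨B, hB⟩ := ((contDiff_almostAnalyticExt hf N' hτ').continuous.sub
    (contDiff_almostAnalyticExt hf N hτ).continuous).bounded_above_of_compact_support
    ((hasCompactSupport_almostAnalyticExt hc N' hτ').sub
      (hasCompactSupport_almostAnalyticExt hc N hτ))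
  simpa using exists_norm_le_mul_abs_im_pow (S := univ) hδ₀ (N + 1) (fun z _ => hB z)
    fun z _ hz => by
      rw [Pi.sub_apply, almostAnalyticExt_eq, almostAnalyticExt_eq,
        chi_eq_one h1 (hz.trans_le (min_le_left _ _)),
        chi_eq_one h1' (hz.trans_le (min_le_right _ _)), mul_one, mul_one]
      exact hC z hz.le

end Bounds

section ModerateGrowth

open MeasureTheory Complex Set

variable {F : Type*} [NormedAddCommGroup F] {R : ℂ → F} {S : Set ℂ} {p : ℝ}

/-- Off the real axis `R` is continuous at the points of `S`, and on `S` it grows at most like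
`|Im z|⁻ᵖ`: the condition under which `∂_{z̄} f̃ R` is integrable for `f̃` of large order. -/
structure HasModerateGrowth (R : ℂ → F) (S : Set ℂ) (p : ℝ) : Prop where
  continuousAt : ∀ z ∈ S, z.im ≠ 0 → ContinuousAt R z
  exists_bound : ∃ C ≥ 0, ∀ z ∈ S, z.im ≠ 0 → ‖R z‖ ≤ C * |z.im| ^ (-p)

theorem HasModerateGrowth.mono {S' : Set ℂ} (hR : HasModerateGrowth R S p) (h : S' ⊆ S) :
    HasModerateGrowth R S' p := by
  obtain ⟨C, hC, hb⟩ := hR.exists_bound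
  exact ⟨fun z hz => hR.continuousAt z (h hz), C, hC, fun z hz => hb z (h hz)⟩

theorem HasModerateGrowth.union {S' : Set ℂ} (h : HasModerateGrowth R S p)
    (h' : HasModerateGrowth R S' p) : HasModerateGrowth R (S ∪ S') p := by
  obtain ⟨C, hC, hb⟩ := h.exists_bound
  obtain ⟨C', hC', hb'⟩ := h'.exists_bound
  refine ⟨fun z hz => hz.elim (h.continuousAt z) (h'.continuousAt z), C + C', by positivity,
    fun z hz h0 => ?_⟩
  rw [add_mul]
  exact hz.elim (fun hz => le_add_of_le_of_nonneg (hb z hz h0) (by positivity))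
    fun hz => le_add_of_nonneg_of_le (by positivity) (hb' z hz h0)

theorem HasModerateGrowth.norm_mul_norm {G : Type*} [NormedAddCommGroup G] {R' : ℂ → G} {q : ℝ}
    (hR : HasModerateGrowth R S p) (hR' : HasModerateGrowth R' S q) :
    HasModerateGrowth (fun z => ‖R z‖ * ‖R' z‖) S (p + q) := by
  obtain ⟨C, hC, hb⟩ := hR.exists_bound
  obtain ⟨C', hC', hb'⟩ := hR'.exists_bound
  refine ⟨fun z hz h0 => (hR.continuousAt z hz h0).norm.mul (hR'.continuousAt z hz h0).norm,
    C * C', by positivity, fun z hz h0 => ?_⟩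
  rw [norm_mul, norm_norm, norm_norm, neg_add, Real.rpow_add (abs_pos.2 h0), mul_mul_mul_comm]
  exact mul_le_mul (hb z hz h0) (hb' z hz h0) (norm_nonneg _) (by positivity)

variable {𝕜 : Type*} [NormedField 𝕜] [NormedSpace 𝕜 F]

theorem HasModerateGrowth.exists_norm_smul_le (hR : HasModerateGrowth R S p) {ψ : ℂ → 𝕜}
    (hψS : tsupport ψ ⊆ S) {m : ℕ} {C : ℝ} (hψ : ∀ z, ‖ψ z‖ ≤ C * |z.im| ^ m) :
    ∃ C' ≥ 0, ∀ z : ℂ, z.im ≠ 0 → ‖ψ z • R z‖ ≤ C' * |z.im| ^ (m - p) := by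
  obtain ⟨D, hD, hb⟩ := hR.exists_bound
  refine ⟨|C| * D, by positivity, fun z hz => ?_⟩
  by_cases hzS : z ∈ tsupport ψ
  · rw [norm_smul, sub_eq_add_neg, Real.rpow_add (abs_pos.2 hz), Real.rpow_natCast,
      mul_mul_mul_comm]
    refine mul_le_mul ((hψ z).trans ?_) (hb z (hψS hzS) hz) (norm_nonneg _) (by positivity)
    gcongr
    exact le_abs_self C
  · rw [image_eq_zero_of_notMem_tsupport hzS, zero_smul, norm_zero]
    positivity

theorem HasModerateGrowth.integrable_smul (hR : HasModerateGrowth R S p) {ψ : ℂ → 𝕜}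
    (hψ : Continuous ψ) (hψc : HasCompactSupport ψ) (hψS : tsupport ψ ⊆ S) {m : ℕ} {C : ℝ}
    (hψb : ∀ z, ‖ψ z‖ ≤ C * |z.im| ^ m) (hp : p < m + 1) : Integrable fun z => ψ z • R z := by
  obtain ⟨M, -, hM⟩ := hψc.isCompact.isBounded.subset_ball_lt 0 0
  obtain ⟨C', -, hb⟩ := hR.exists_norm_smul_le hψS hψb
  have hmeas : AEStronglyMeasurable (fun z => ψ z • R z) := by
    have hU : IsOpen (Function.support ψ ∩ {z : ℂ | z.im ≠ 0}) :=
      hψ.isOpen_support.inter (isOpen_ne_fun continuous_im continuous_const)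
    have hcont : ContinuousOn (fun z => ψ z • R z) (Function.support ψ ∩ {z : ℂ | z.im ≠ 0}) :=
      fun z hz => (hψ.continuousAt.smul
        (hR.continuousAt z (hψS (subset_tsupport ψ hz.1)) hz.2)).continuousWithinAt
    refine ((aestronglyMeasurable_indicator_iff hU.measurableSet).2
      (hcont.aestronglyMeasurable hU.measurableSet)).congr ?_
    filter_upwards [ae_im_ne_zero] with z hz
    refine indicator_apply_eq_self.2 fun hzU => ?_
    rw [show ψ z = 0 from not_not.1 fun h => hzU ⟨h, hz⟩, zero_smul]
  refine integrable_of_norm_le_abs_im_rpow hmeas (by linarith) (M := M) (fun z hz => ?_) hb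
  suffices z ∉ tsupport ψ by rw [image_eq_zero_of_notMem_tsupport this, zero_smul]
  intro hmem
  have hlt := mem_ball_zero_iff.1 (hM hmem)
  rcases hz with hz | hz
  · exact (hz.trans (abs_re_le_norm z)).not_gt hlt
  · exact (hz.trans (abs_im_le_norm z)).not_gt hlt

theorem HasModerateGrowth.continuous_smul (hR : HasModerateGrowth R S p) {ψ : ℂ → 𝕜}
    (hψ : Continuous ψ) (hψS : tsupport ψ ⊆ S) {m : ℕ} {C : ℝ}
    (hψb : ∀ z, ‖ψ z‖ ≤ C * |z.im| ^ (m + 1)) (hp : p < m + 1) :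
    Continuous fun z => ψ z • R z := by
  obtain ⟨C', hC', hb⟩ := hR.exists_norm_smul_le hψS hψb
  have hexp : 0 < ((m + 1 : ℕ) : ℝ) - p := by push_cast; linarith
  have haxis (z : ℂ) (hz : z.im = 0) : ψ z = 0 := by simpa [hz] using hψb z
  have hb' (z : ℂ) : ‖ψ z • R z‖ ≤ C' * |z.im| ^ (((m + 1 : ℕ) : ℝ) - p) := by
    by_cases hz : z.im = 0
    · rw [haxis z hz, zero_smul, norm_zero]
      positivity
    · exact hb z hz
  refine continuous_iff_continuousAt.2 fun z => ?_
  by_cases hz : z.im = 0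
  · rw [ContinuousAt, haxis z hz, zero_smul]
    refine squeeze_zero_norm hb' ?_
    have hcont : Continuous fun w : ℂ => C' * |w.im| ^ (((m + 1 : ℕ) : ℝ) - p) :=
      continuous_const.mul ((continuous_abs.comp continuous_im).rpow_const
        fun _ => Or.inr hexp.le)
    have := hcont.tendsto z
    rwa [hz, abs_zero, Real.zero_rpow hexp.ne', mul_zero] at this
  · by_cases hzS : z ∈ tsupport ψ
    · exact hψ.continuousAt.smul (hR.continuousAt z (hψS hzS) hz)
    · refine (continuousAt_const (y := (0 : F))).congr ?_
      filter_upwards [notMem_tsupport_iff_eventuallyEq.1 hzS] with w hw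
      rw [hw, Pi.zero_apply, zero_smul]

end ModerateGrowth

section StokesSmul

open MeasureTheory Complex Set

variable {F : Type*} [NormedAddCommGroup F] [NormedSpace ℂ F] {g : ℂ → ℂ} {R : ℂ → F}

theorem tsupport_dbar_subset (g : ℂ → ℂ) : tsupport (dbar g) ⊆ tsupport g :=
  closure_minimal (fun _ hz => not_not.1 fun h => hz (dbar_eq_zero_of_notMem_tsupport h))
    (isClosed_tsupport g)

theorem hasDbarAt_smul_of_tsupport (hg : Differentiable ℝ g) {z : ℂ}
    (hR : z ∈ tsupport g → DifferentiableAt ℂ R z) :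
    HasDbarAt (fun w => g w • R w) (dbar g z • R z) z := by
  by_cases hz : z ∈ tsupport g
  · exact hasDbarAt_smul (hg z) (hR hz)
  · rw [dbar_eq_zero_of_notMem_tsupport hz, zero_smul]
    refine ⟨0, (hasFDerivAt_const (0 : F) z).congr_of_eventuallyEq ?_, by simp⟩
    filter_upwards [notMem_tsupport_iff_eventuallyEq.1 hz] with w hw
    rw [hw, Pi.zero_apply, zero_smul]

theorem integral_dbar_smul_eq_zero [CompleteSpace F] (hg : Differentiable ℝ g)
    (hgc : HasCompactSupport g) (hR : ∀ z ∈ tsupport g, z.im ≠ 0 → DifferentiableAt ℂ R z)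
    (hc : Continuous fun z => g z • R z) (hi : Integrable fun z => dbar g z • R z) :
    ∫ z, dbar g z • R z = 0 := by
  obtain ⟨M, hM, hb⟩ := exists_box hgc
  exact integral_dbar_eq_zero hM (fun z hz => by
    rw [image_eq_zero_of_notMem_tsupport (hb z hz), zero_smul]) hc
    (fun z hz => hasDbarAt_smul_of_tsupport hg fun h => hR z h hz) hi

theorem dbar_sub {g h : ℂ → ℂ} {z : ℂ} (hg : DifferentiableAt ℝ g z)
    (hh : DifferentiableAt ℝ h z) : dbar (fun w => g w - h w) z = dbar g z - dbar h z := by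
  simp only [dbar, fderiv_fun_sub hg hh, sub_apply]
  ring

end StokesSmul

section HelfferSjostrand

open MeasureTheory Complex Set

variable {F : Type*} [NormedAddCommGroup F] {p : ℝ} {f : ℝ → ℂ} {N : ℕ} {τ : ℝ → ℂ}

theorem HasModerateGrowth.integrable_norm_dbar_mul {R : ℂ → ℝ}
    (hR : HasModerateGrowth R (tsupport (almostAnalyticExt f N τ)) p) (hf : ContDiff ℝ ∞ f)
    (hfc : HasCompactSupport f) (hτ : IsCutoff τ) (hp : p < N + 1) :
    Integrable fun z => ‖dbar (almostAnalyticExt f N τ) z‖ * R z := by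
  obtain ⟨C, -, hC⟩ := exists_dbar_almostAnalyticExt_bound hf hfc N hτ
  have hcont := continuous_dbar (contDiff_almostAnalyticExt hf N hτ)
  have hsub : tsupport (fun z => ‖dbar (almostAnalyticExt f N τ) z‖) ⊆
      tsupport (almostAnalyticExt f N τ) :=
    (tsupport_comp_subset norm_zero _).trans (tsupport_dbar_subset _)
  exact hR.integrable_smul hcont.norm
    ((hasCompactSupport_almostAnalyticExt hfc N hτ).mono' ((subset_tsupport _).trans hsub)) hsub
    (fun z => (norm_norm _).trans_le (hC z)) hp

variable [NormedSpace ℂ F] {R : ℂ → F}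

theorem HasModerateGrowth.integrable_dbar_smul
    (hR : HasModerateGrowth R (tsupport (almostAnalyticExt f N τ)) p) (hf : ContDiff ℝ ∞ f)
    (hfc : HasCompactSupport f) (hτ : IsCutoff τ) (hp : p < N + 1) :
    Integrable fun z => dbar (almostAnalyticExt f N τ) z • R z := by
  obtain ⟨C, -, hC⟩ := exists_dbar_almostAnalyticExt_bound hf hfc N hτ
  have hsub := tsupport_dbar_subset (almostAnalyticExt f N τ)
  exact hR.integrable_smul (continuous_dbar (contDiff_almostAnalyticExt hf N hτ))
    ((hasCompactSupport_almostAnalyticExt hfc N hτ).mono' ((subset_tsupport _).trans hsub)) hsub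
    hC hp

/-- The difference of the two extensions is `O(|Im z|ᴺ⁺¹)`, so Stokes' theorem applies to its
product with `R` across the real axis. -/
theorem HasModerateGrowth.integral_dbar_smul_eq_of_le [CompleteSpace F] {N' : ℕ} {τ' : ℝ → ℂ}
    (hR : HasModerateGrowth R (tsupport (almostAnalyticExt f N τ)) p)
    (hR' : HasModerateGrowth R (tsupport (almostAnalyticExt f N' τ')) p)
    (hd : ∀ z ∈ tsupport (almostAnalyticExt f N' τ') ∪ tsupport (almostAnalyticExt f N τ),
      z.im ≠ 0 → DifferentiableAt ℂ R z)
    (hf : ContDiff ℝ ∞ f) (hfc : HasCompactSupport f) (hτ : IsCutoff τ) (hτ' : IsCutoff τ')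
    (hp : p < N + 1) (hN : N ≤ N') :
    ∫ z, dbar (almostAnalyticExt f N τ) z • R z =
      ∫ z, dbar (almostAnalyticExt f N' τ') z • R z := by
  have hi := hR.integrable_dbar_smul hf hfc hτ hp
  have hi' := hR'.integrable_dbar_smul hf hfc hτ' (hp.trans_le (by gcongr))
  have hg := (contDiff_almostAnalyticExt hf N hτ).differentiable (by simp)
  have hg' := (contDiff_almostAnalyticExt hf N' hτ').differentiable (by simp)
  obtain ⟨C, -, hC⟩ := exists_almostAnalyticExt_sub_bound hf hfc hN hτ hτ'
  have hsub := tsupport_sub (almostAnalyticExt f N' τ') (almostAnalyticExt f N τ)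
  have he (z : ℂ) : dbar (almostAnalyticExt f N' τ' - almostAnalyticExt f N τ) z • R z =
      dbar (almostAnalyticExt f N' τ') z • R z - dbar (almostAnalyticExt f N τ) z • R z := by
    rw [← sub_smul, ← dbar_sub (hg' z) (hg z)]
    rfl
  have h0 : ∫ z, dbar (almostAnalyticExt f N' τ' - almostAnalyticExt f N τ) z • R z = 0 := by
    refine integral_dbar_smul_eq_zero (hg'.sub hg)
      ((hasCompactSupport_almostAnalyticExt hfc N' hτ').sub
        (hasCompactSupport_almostAnalyticExt hfc N hτ))
      (fun z hz => hd z (hsub hz))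
      ((hR'.union hR).continuous_smul (hg'.sub hg).continuous hsub hC hp) ?_
    simp_rw [he]
    exact hi'.sub hi
  simp_rw [he] at h0
  rw [integral_sub hi' hi, sub_eq_zero] at h0
  exact h0.symm

theorem integral_dbar_smul_eq_zero_of_differentiableAt [CompleteSpace F]
    (hd : ∀ z ∈ tsupport (almostAnalyticExt f N τ), DifferentiableAt ℂ R z)
    (hf : ContDiff ℝ ∞ f) (hfc : HasCompactSupport f) (hτ : IsCutoff τ)
    (hi : Integrable fun z => dbar (almostAnalyticExt f N τ) z • R z) :
    ∫ z, dbar (almostAnalyticExt f N τ) z • R z = 0 := by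
  have hg := (contDiff_almostAnalyticExt hf N hτ).differentiable (by simp)
  refine integral_dbar_smul_eq_zero hg (hasCompactSupport_almostAnalyticExt hfc N hτ)
    (fun z hz _ => hd z hz) (continuous_iff_continuousAt.2 fun z => ?_) hi
  obtain ⟨L, hL, -⟩ := hasDbarAt_smul_of_tsupport hg (hd z)
  exact hL.continuousAt

end HelfferSjostrand

section FunctionalCalculus

open MeasureTheory Complex Set TopologicalSpace

variable {E : Type*} [NormedAddCommGroup E] [InnerProductSpace ℂ E] [CompleteSpace E]
  {A : E →ₗ.[ℂ] E} {n : ℝ}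

theorem ResolventEstimate.exists_bound_of_abs_im_lt {E : Type*} [NormedAddCommGroup E]
    [InnerProductSpace ℂ E] {A : E →ₗ.[ℂ] E} {I : Set ℝ} (hE : ResolventEstimate A I n)
    {Q : Set ℂ} (hQ : IsCompact Q) (hQI : ∀ z ∈ Q, z.re ∈ I) :
    ∃ a > 0, ∃ C ≥ 0, ∀ z ∈ Q, z.im ≠ 0 → |z.im| < a →
      ‖resolvent A z‖ ≤ C * |z.im| ^ (-(n + 1)) := by
  obtain ⟨a, ha, c, hc, -, hb⟩ := hE
  have hcont : Continuous fun z : ℂ => bracket z.re ^ n :=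
    (contDiff_bracket.continuous.comp continuous_re).rpow_const
      fun z => Or.inl (bracket_pos z.re).ne'
  obtain ⟨B, hB⟩ := hQ.exists_bound_of_continuousOn hcont.continuousOn
  refine ⟨a, ha, c * |B|, by positivity, fun z hz h0 h => ?_⟩
  have hpos : 0 < |z.im| := abs_pos.2 h0
  calc ‖resolvent A z‖ ≤ c * |z.im|⁻¹ * (bracket z.re / |z.im|) ^ n := hb z ⟨hQI z hz, hpos, h⟩
    _ = c * bracket z.re ^ n * |z.im| ^ (-(n + 1)) := by
      rw [Real.div_rpow (bracket_pos _).le hpos.le, neg_add, Real.rpow_add hpos,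
        Real.rpow_neg_one, Real.rpow_neg hpos.le]
      ring
    _ ≤ c * |B| * |z.im| ^ (-(n + 1)) := by
      gcongr
      exact (Real.le_norm_self _).trans ((hB z hz).trans (le_abs_self B))

theorem ResolventEstimate.hasModerateGrowth {I : Set ℝ} (hE : ResolventEstimate A I n) {Q : Set ℂ}
    (hQ : IsCompact Q) (hQI : ∀ z ∈ Q, z.re ∈ I)
    (hQρ : ∀ z ∈ Q, z.im ≠ 0 → z ∈ resolventSet A) :
    HasModerateGrowth (resolvent A) Q (n + 1) := by
  obtain ⟨a, ha, C, hC, hnear⟩ := hE.exists_bound_of_abs_im_lt hQ hQI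
  have hfar : IsCompact (Q ∩ {z : ℂ | a ≤ |z.im|}) :=
    hQ.inter_right (isClosed_le continuous_const (continuous_abs.comp continuous_im))
  have hne : ∀ z ∈ Q ∩ {z : ℂ | a ≤ |z.im|}, z.im ≠ 0 := fun z hz => abs_pos.1 (ha.trans_le hz.2)
  have hcont : ContinuousOn (fun z : ℂ => |z.im| ^ (n + 1) * ‖resolvent A z‖)
      (Q ∩ {z : ℂ | a ≤ |z.im|}) :=
    ((continuous_abs.comp continuous_im).continuousOn.rpow_const
      fun z hz => Or.inl (abs_pos.2 (hne z hz)).ne').mul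
      ((continuousOn_resolvent A).mono fun z hz => hQρ z hz.1 (hne z hz)).norm
  obtain ⟨D, hD⟩ := hfar.exists_bound_of_continuousOn hcont
  refine ⟨fun z hz h0 => (differentiableAt_resolvent (hQρ z hz h0)).continuousAt, C + |D|,
    by positivity, fun z hz h0 => ?_⟩
  have hpos : 0 < |z.im| := abs_pos.2 h0
  rw [add_mul]
  rcases lt_or_ge |z.im| a with h | h
  · exact le_add_of_le_of_nonneg (hnear z hz h0 h) (by positivity)
  · refine le_add_of_nonneg_of_le (by positivity) ?_
    rw [Real.rpow_neg hpos.le, ← div_eq_mul_inv, le_div_iff₀ (by positivity), mul_comm]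
    exact (Real.le_norm_self _).trans ((hD z ⟨hz, h⟩).trans (le_abs_self D))

/-- What the Helffer–Sjöstrand calculus on `I` needs of `A`: a resolvent estimate of exponent `n`
near `I`, eigenvalues as only spectrum off the real axis over `I`, and a cut-off whose `χ` avoids
them. -/
structure HasFunctionalCalculus {E : Type*} [NormedAddCommGroup E] [InnerProductSpace ℂ E]
    (A : E →ₗ.[ℂ] E) (I : Set ℝ) (n : ℝ) : Prop where
  resolventEstimate : ResolventEstimate A I n
  mem_resolventSet : ∀ z : ℂ, z.im ≠ 0 → z.re ∈ I → z ∉ nonrealEigenvalues A I → z ∈ resolventSet A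
  exists_isAdmissible : ∃ τ, IsAdmissible A I τ

theorem hasFunctionalCalculus_of_isSelfAdjoint (hA : IsSelfAdjoint A) (I : Set ℝ) (hn : 0 ≤ n) :
    HasFunctionalCalculus A I n where
  resolventEstimate := resolventEstimate_of_isSelfAdjoint hA I hn
  mem_resolventSet _ hz _ _ := mem_resolventSet_of_im_ne_zero hA hz
  exists_isAdmissible := exists_isAdmissible_of_finite (by
    rw [nonrealEigenvalues_eq_empty_of_isFormalAdjoint (isFormalAdjoint_self_of_isSelfAdjoint hA)]
    exact finite_empty)

theorem hasFunctionalCalculus_perturb {V : E →L[ℂ] E} {I : Set ℝ} (hA : IsSelfAdjoint A)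
    (hV : IsCompactOperator V) (hE : ResolventEstimate (perturb A V) I n)
    (hfin : (nonrealEigenvalues (perturb A V) I).Finite) :
    HasFunctionalCalculus (perturb A V) I n where
  resolventEstimate := hE
  mem_resolventSet _ hz hI hev := mem_resolventSet_perturb_of_not_isEigenvalue hV
    (mem_resolventSet_of_im_ne_zero hA hz) fun h => hev ⟨h, hz, hI⟩
  exists_isAdmissible := exists_isAdmissible_of_finite hfin

variable {I : Opens ℝ} {τ : ℝ → ℂ}

theorem IsAdmissible.mem_resolventSet {E : Type*} [NormedAddCommGroup E] [InnerProductSpace ℂ E]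
    {A : E →ₗ.[ℂ] E} {I : Set ℝ} (hτ : IsAdmissible A I τ) (hA : HasFunctionalCalculus A I n)
    {z : ℂ} (hzI : z.re ∈ I) (hz : z ∈ tsupport (chi τ)) (h0 : z.im ≠ 0) : z ∈ resolventSet A :=
  hA.mem_resolventSet z h0 hzI fun h => disjoint_left.1 hτ.2 hz h

theorem isCompact_re_preimage_inter_tsupport_chi (hτ : IsCutoff τ) {K : Set ℝ} (hK : IsCompact K) :
    IsCompact (re ⁻¹' K ∩ tsupport (chi τ)) := by
  obtain ⟨Y, -, hY⟩ := exists_abs_im_le_of_mem_tsupport_chi hτ hK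
  refine (hK.reProdIm (isCompact_Icc (a := -Y) (b := Y))).of_isClosed_subset
    ((hK.isClosed.preimage continuous_re).inter (isClosed_tsupport _)) fun z hz => ?_
  exact ⟨hz.1, abs_le.1 (hY z hz.2 hz.1)⟩

theorem HasFunctionalCalculus.hasModerateGrowth (hA : HasFunctionalCalculus A I n)
    (hτ : IsAdmissible A I τ) {K : Set ℝ} (hK : IsCompact K) (hKI : K ⊆ I) :
    HasModerateGrowth (resolvent A) (re ⁻¹' K ∩ tsupport (chi τ)) (n + 1) :=
  hA.resolventEstimate.hasModerateGrowth (isCompact_re_preimage_inter_tsupport_chi hτ.1 hK)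
    (fun _ hz => hKI hz.1) fun _ hz h0 => hτ.mem_resolventSet hA (hKI hz.1) hz.2 h0

theorem HasFunctionalCalculus.hasModerateGrowth_tsupport (hA : HasFunctionalCalculus A I n)
    (hτ : IsAdmissible A I τ) (f : 𝓓(I, ℂ)) (N : ℕ) :
    HasModerateGrowth (resolvent A) (tsupport (almostAnalyticExt f N τ)) (n + 1) :=
  (hA.hasModerateGrowth hτ f.hasCompactSupport f.tsupport_subset).mono
    (tsupport_almostAnalyticExt_subset f N τ)

theorem HasFunctionalCalculus.differentiableAt_resolvent (hA : HasFunctionalCalculus A I n)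
    (hτ : IsAdmissible A I τ) (f : 𝓓(I, ℂ)) {N : ℕ} {z : ℂ}
    (hz : z ∈ tsupport (almostAnalyticExt f N τ)) (h0 : z.im ≠ 0) :
    DifferentiableAt ℂ (resolvent A) z := by
  obtain ⟨hzf, hzτ⟩ := tsupport_almostAnalyticExt_subset f N τ hz
  exact SSF.differentiableAt_resolvent (hτ.mem_resolventSet hA (f.tsupport_subset hzf) hzτ h0)

theorem HasFunctionalCalculus.integrable_hsIntegrand (hA : HasFunctionalCalculus A I n)
    (hτ : IsAdmissible A I τ) (f : 𝓓(I, ℂ)) {N : ℕ} (hN : n < N) :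
    Integrable (hsIntegrand A f N τ) :=
  (hA.hasModerateGrowth_tsupport hτ f N).integrable_dbar_smul f.contDiff f.hasCompactSupport hτ.1
    (by linarith)

theorem HasFunctionalCalculus.integral_hsIntegrand_eq_of_le (hA : HasFunctionalCalculus A I n)
    {τ' : ℝ → ℂ} (hτ : IsAdmissible A I τ) (hτ' : IsAdmissible A I τ') (f : 𝓓(I, ℂ)) {N N' : ℕ}
    (hN : n < N) (hNN' : N ≤ N') :
    ∫ z, hsIntegrand A f N τ z = ∫ z, hsIntegrand A f N' τ' z :=
  (hA.hasModerateGrowth_tsupport hτ f N).integral_dbar_smul_eq_of_le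
    (hA.hasModerateGrowth_tsupport hτ' f N')
    (fun _ hz => hz.elim (hA.differentiableAt_resolvent hτ' f) (hA.differentiableAt_resolvent hτ f))
    f.contDiff f.hasCompactSupport hτ.1 hτ'.1 (by linarith) hNN'

theorem HasFunctionalCalculus.exists_isHSValue (hA : HasFunctionalCalculus A I n) (f : 𝓓(I, ℂ)) :
    ∃ F, IsHSValue A I n f F := by
  obtain ⟨τ, hτ⟩ := hA.exists_isAdmissible
  obtain ⟨N, hN⟩ := exists_nat_gt n
  refine ⟨(Real.pi : ℂ)⁻¹ • ∫ z : ℂ, hsIntegrand A f N τ z, ⟨τ, hτ⟩, fun N' hN' τ' hτ' =>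
    ⟨hA.integrable_hsIntegrand hτ' f hN', ?_⟩⟩
  congr 1
  rcases le_total N N' with h | h
  · exact hA.integral_hsIntegrand_eq_of_le hτ hτ' f hN h
  · exact (hA.integral_hsIntegrand_eq_of_le hτ' hτ f hN' h).symm

section HSValue

variable {E : Type*} [NormedAddCommGroup E] [InnerProductSpace ℂ E] {A : E →ₗ.[ℂ] E} {I : Set ℝ}
  {f g : ℝ → ℂ} {F G : E →L[ℂ] E}

theorem IsHSValue.unique {m : ℝ} (hF : IsHSValue A I n f F) (hG : IsHSValue A I m f G) :
    F = G := by
  obtain ⟨⟨τ, hτ⟩, hF⟩ := hF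
  obtain ⟨N, hN⟩ := exists_nat_gt (max n m)
  rw [(hF N ((le_max_left _ _).trans_lt hN) τ hτ).2,
    (hG.2 N ((le_max_right _ _).trans_lt hN) τ hτ).2]

theorem IsHSValue.funcCalc_eq (hF : IsHSValue A I n f F) : funcCalc A I f = F := by
  have h : ∃ F : E →L[ℂ] E, ∃ n : ℝ, IsHSValue A I n f F := ⟨F, n, hF⟩
  rw [funcCalc, dif_pos h]
  obtain ⟨m, hm⟩ := h.choose_spec
  exact hm.unique hF

theorem almostAnalyticExt_add {f g : ℝ → ℂ} (hf : ContDiff ℝ ∞ f) (hg : ContDiff ℝ ∞ g) (N : ℕ)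
    (τ : ℝ → ℂ) :
    almostAnalyticExt (f + g) N τ = almostAnalyticExt f N τ + almostAnalyticExt g N τ := by
  funext z
  rw [Pi.add_apply, almostAnalyticExt, almostAnalyticExt, almostAnalyticExt, ← add_mul,
    ← Finset.sum_add_distrib]
  refine congrArg (· * chi τ z) (Finset.sum_congr rfl fun k _ => ?_)
  rw [iteratedDeriv_add (hf.of_le (by exact_mod_cast le_top)).contDiffAt
    (hg.of_le (by exact_mod_cast le_top)).contDiffAt]
  ring

theorem almostAnalyticExt_smul (c : ℂ) (f : ℝ → ℂ) (N : ℕ) (τ : ℝ → ℂ) :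
    almostAnalyticExt (c • f) N τ = c • almostAnalyticExt f N τ := by
  funext z
  rw [Pi.smul_apply, almostAnalyticExt, almostAnalyticExt, smul_eq_mul, ← mul_assoc,
    Finset.mul_sum]
  refine congrArg (· * chi τ z) (Finset.sum_congr rfl fun k _ => ?_)
  rw [iteratedDeriv_const_smul_field, smul_eq_mul]
  ring

theorem dbar_add {g h : ℂ → ℂ} {z : ℂ} (hg : DifferentiableAt ℝ g z)
    (hh : DifferentiableAt ℝ h z) : dbar (g + h) z = dbar g z + dbar h z := by
  simp only [dbar, fderiv_add hg hh, add_apply]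
  ring

theorem dbar_smul {g : ℂ → ℂ} {z : ℂ} (hg : DifferentiableAt ℝ g z) (c : ℂ) :
    dbar (c • g) z = c * dbar g z := by
  simp only [dbar, fderiv_const_smul hg, smul_apply, smul_eq_mul]
  ring

theorem hsIntegrand_add (hf : ContDiff ℝ ∞ f) (hg : ContDiff ℝ ∞ g) (A : E →ₗ.[ℂ] E) (N : ℕ)
    {τ : ℝ → ℂ} (hτ : IsCutoff τ) (z : ℂ) :
    hsIntegrand A (f + g) N τ z = hsIntegrand A f N τ z + hsIntegrand A g N τ z := by
  rw [hsIntegrand, almostAnalyticExt_add hf hg,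
    dbar_add ((contDiff_almostAnalyticExt hf N hτ).differentiable (by simp) z)
      ((contDiff_almostAnalyticExt hg N hτ).differentiable (by simp) z), add_smul, hsIntegrand,
    hsIntegrand]

theorem hsIntegrand_smul (hf : ContDiff ℝ ∞ f) (c : ℂ) (A : E →ₗ.[ℂ] E) (N : ℕ) {τ : ℝ → ℂ}
    (hτ : IsCutoff τ) (z : ℂ) : hsIntegrand A (c • f) N τ z = c • hsIntegrand A f N τ z := by
  rw [hsIntegrand, almostAnalyticExt_smul,
    dbar_smul ((contDiff_almostAnalyticExt hf N hτ).differentiable (by simp) z), mul_smul,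
    hsIntegrand]

theorem IsHSValue.add (hF : IsHSValue A I n f F) (hG : IsHSValue A I n g G)
    (hf : ContDiff ℝ ∞ f) (hg : ContDiff ℝ ∞ g) : IsHSValue A I n (f + g) (F + G) := by
  refine ⟨hF.1, fun N hN τ hτ => ?_⟩
  obtain ⟨hi, hF⟩ := hF.2 N hN τ hτ
  obtain ⟨hi', hG⟩ := hG.2 N hN τ hτ
  rw [funext (hsIntegrand_add hf hg A N hτ.1), integral_add hi hi', smul_add, ← hF, ← hG]
  exact ⟨Integrable.add (ε' := E →L[ℂ] E) hi hi', rfl⟩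

theorem IsHSValue.smul (hF : IsHSValue A I n f F) (hf : ContDiff ℝ ∞ f) (c : ℂ) :
    IsHSValue A I n (c • f) (c • F) := by
  refine ⟨hF.1, fun N hN τ hτ => ?_⟩
  obtain ⟨hi, hF⟩ := hF.2 N hN τ hτ
  rw [funext (hsIntegrand_smul hf c A N hτ.1), integral_smul, smul_comm, ← hF]
  exact ⟨hi.smul c, rfl⟩

end HSValue

theorem HasFunctionalCalculus.isHSValue_funcCalc (hA : HasFunctionalCalculus A I n)
    (f : 𝓓(I, ℂ)) : IsHSValue A I n f (funcCalc A I f) := by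
  obtain ⟨F, hF⟩ := hA.exists_isHSValue f
  exact hF.funcCalc_eq.symm ▸ hF

theorem HasFunctionalCalculus.funcCalc_eq (hA : HasFunctionalCalculus A I n)
    (hτ : IsAdmissible A I τ) (f : 𝓓(I, ℂ)) {N : ℕ} (hN : n < N) :
    funcCalc A I f = (Real.pi : ℂ)⁻¹ • ∫ z, hsIntegrand A f N τ z :=
  ((hA.isHSValue_funcCalc f).2 N hN τ hτ).2

theorem HasFunctionalCalculus.funcCalc_add (hA : HasFunctionalCalculus A I n) (f g : 𝓓(I, ℂ)) :
    funcCalc A I (f + g : 𝓓(I, ℂ)) = funcCalc A I f + funcCalc A I g :=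
  ((hA.isHSValue_funcCalc f).add (hA.isHSValue_funcCalc g) f.contDiff g.contDiff).funcCalc_eq

theorem HasFunctionalCalculus.funcCalc_smul (hA : HasFunctionalCalculus A I n) (c : ℂ)
    (f : 𝓓(I, ℂ)) : funcCalc A I (c • f : 𝓓(I, ℂ)) = c • funcCalc A I f :=
  ((hA.isHSValue_funcCalc f).smul f.contDiff c).funcCalc_eq

theorem HasFunctionalCalculus.funcCalc_eq_zero (hA : HasFunctionalCalculus A I n) (f : 𝓓(I, ℂ))
    (hρ : ∀ x ∈ tsupport f, (x : ℂ) ∈ resolventSet A) : funcCalc A I f = 0 := by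
  obtain ⟨τ, hτ⟩ := hA.exists_isAdmissible
  obtain ⟨N, hN⟩ := exists_nat_gt n
  have hd : ∀ z ∈ tsupport (almostAnalyticExt f N τ), DifferentiableAt ℂ (resolvent A) z := by
    intro z hz
    by_cases h0 : z.im = 0
    · have hz' : (z.re : ℂ) = z := Complex.ext (ofReal_re _) ((ofReal_im _).trans h0.symm)
      exact SSF.differentiableAt_resolvent
        (hz' ▸ hρ z.re (tsupport_almostAnalyticExt_subset f N τ hz).1)
    · exact hA.differentiableAt_resolvent hτ f hz h0
  rw [hA.funcCalc_eq hτ f hN, smul_eq_zero]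
  exact Or.inr (integral_dbar_smul_eq_zero_of_differentiableAt hd f.contDiff f.hasCompactSupport
    hτ.1 (hA.integrable_hsIntegrand hτ f hN))

end FunctionalCalculus

section SpectralShift

open MeasureTheory Complex Set TopologicalSpace

variable {E : Type*} [NormedAddCommGroup E] [InnerProductSpace ℂ E] [CompleteSpace E]
  {H₀ : E →ₗ.[ℂ] E} {V : E →L[ℂ] E} {z : ℂ}

theorem IsTraceClass.exists_clm_trace_mul_mul (hV : IsTraceClass V) :
    ∃ B : (E →L[ℂ] E) →L[ℂ] (E →L[ℂ] E) →L[ℂ] ℂ, ∀ A C, B A C = trace (A * V * C) := by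
  obtain ⟨K, -, hK⟩ := hV.exists_traceNormLE_mul_mul
  have htc (A C : E →L[ℂ] E) : IsTraceClass (A * V * C) := (hK A C).isTraceClass
  refine ⟨LinearMap.mkContinuous₂ (LinearMap.mk₂ ℂ (fun A C : E →L[ℂ] E => trace (A * V * C))
    (fun A A' C => ?_) (fun c A C => ?_) (fun A C C' => ?_) (fun c A C => ?_)) K
    fun A C => (hK A C).norm_trace_le, fun A C => rfl⟩
  · rw [add_mul, add_mul, trace_add (htc A C) (htc A' C)]
  · rw [smul_mul_assoc, smul_mul_assoc, trace_smul, smul_eq_mul]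
  · rw [mul_add, trace_add (htc A C) (htc A C')]
  · rw [mul_smul_comm, trace_smul, smul_eq_mul]

theorem exists_traceNormLE_resolvent_sub (hV : IsTraceClass V) (H₀ : E →ₗ.[ℂ] E) :
    ∃ K ≥ 0, ∀ z ∈ resolventSet (perturb H₀ V) ∩ resolventSet H₀,
      TraceNormLE (resolvent (perturb H₀ V) z - resolvent H₀ z)
        (K * (‖resolvent (perturb H₀ V) z‖ * ‖resolvent H₀ z‖)) := by
  obtain ⟨K, hK0, hK⟩ := hV.exists_traceNormLE_mul_mul
  refine ⟨K, hK0, fun z hz => ?_⟩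
  rw [resolvent_perturb_sub_resolvent hz.2 hz.1, ← mul_assoc]
  exact (hK _ _).neg

theorem isTraceClass_resolvent_sub (hV : IsTraceClass V)
    (hz : z ∈ resolventSet (perturb H₀ V) ∩ resolventSet H₀) :
    IsTraceClass (resolvent (perturb H₀ V) z - resolvent H₀ z) := by
  obtain ⟨K, -, hK⟩ := exists_traceNormLE_resolvent_sub hV H₀
  exact (hK z hz).isTraceClass

theorem differentiableAt_sigma (hV : IsTraceClass V)
    (hz : z ∈ resolventSet (perturb H₀ V) ∩ resolventSet H₀) :
    DifferentiableAt ℂ (sigma (perturb H₀ V) H₀) z := by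
  obtain ⟨B, hB⟩ := hV.exists_clm_trace_mul_mul
  have hd : DifferentiableAt ℂ (fun w => B (resolvent (perturb H₀ V) w) (resolvent H₀ w)) z :=
    ((B.differentiableAt.comp z (differentiableAt_resolvent hz.1)).clm_apply
      (differentiableAt_resolvent hz.2))
  refine hd.neg.congr_of_eventuallyEq ?_
  filter_upwards [(isOpen_resolventSet _).mem_nhds hz.1, (isOpen_resolventSet _).mem_nhds hz.2]
    with w hw hw₀
  rw [sigma, resolvent_perturb_sub_resolvent hw₀ hw, ← neg_one_smul ℂ, trace_smul, ← hB,
    neg_one_mul]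
  rfl

theorem HasModerateGrowth.sigma {S : Set ℂ} {p q : ℝ} (hV : IsTraceClass V)
    (h : HasModerateGrowth (resolvent (perturb H₀ V)) S p)
    (h₀ : HasModerateGrowth (resolvent H₀) S q)
    (hρ : ∀ z ∈ S, z.im ≠ 0 → z ∈ resolventSet (perturb H₀ V) ∩ resolventSet H₀) :
    HasModerateGrowth (sigma (perturb H₀ V) H₀) S (p + q) := by
  obtain ⟨K, hK0, hK⟩ := exists_traceNormLE_resolvent_sub hV H₀
  obtain ⟨C, hC0, hC⟩ := (h.norm_mul_norm h₀).exists_bound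
  refine ⟨fun z hz h0 => (differentiableAt_sigma hV (hρ z hz h0)).continuousAt, K * C,
    by positivity, fun z hz h0 => ((hK z (hρ z hz h0)).norm_trace_le).trans ?_⟩
  rw [mul_assoc]
  exact mul_le_mul_of_nonneg_left ((Real.le_norm_self _).trans (hC z hz h0)) hK0

variable {I : Opens ℝ} {n : ℝ} {τ : ℝ → ℂ} {N : ℕ}

theorem exists_traceNormLE_hsIntegrand_sub (hV : IsTraceClass V)
    (hH : HasFunctionalCalculus (perturb H₀ V) I n) (hH₀ : HasFunctionalCalculus H₀ I n)
    (hτ : IsAdmissible (perturb H₀ V) I τ) (hτ₀ : IsAdmissible H₀ I τ) (f : 𝓓(I, ℂ))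
    (hN : n + 1 + (n + 1) < N + 1) :
    ∃ m : ℂ → ℝ, Integrable m ∧ ∀ᵐ z,
      TraceNormLE (hsIntegrand (perturb H₀ V) f N τ z - hsIntegrand H₀ f N τ z) (m z) := by
  obtain ⟨K, -, hK⟩ := exists_traceNormLE_resolvent_sub hV H₀
  have hint := ((hH.hasModerateGrowth_tsupport hτ f N).norm_mul_norm
    (hH₀.hasModerateGrowth_tsupport hτ₀ f N)).integrable_norm_dbar_mul f.contDiff
      f.hasCompactSupport hτ.1 hN
  refine ⟨_, hint.const_mul K, ?_⟩
  filter_upwards [ae_im_ne_zero] with z h0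
  rw [hsIntegrand, hsIntegrand, ← smul_sub]
  by_cases hz : z ∈ tsupport (almostAnalyticExt f N τ)
  · obtain ⟨hzf, hzτ⟩ := tsupport_almostAnalyticExt_subset f N τ hz
    have hzI := f.tsupport_subset hzf
    rw [mul_left_comm]
    exact (hK z ⟨hτ.mem_resolventSet hH hzI hzτ h0, hτ₀.mem_resolventSet hH₀ hzI hzτ h0⟩).smul _
  · rw [dbar_eq_zero_of_notMem_tsupport hz, norm_zero, zero_mul, mul_zero]
    intro U _ s
    simp

theorem funcCalc_sub_eq {A B : E →ₗ.[ℂ] E} (hA : HasFunctionalCalculus A I n)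
    (hB : HasFunctionalCalculus B I n) (hτ : IsAdmissible A I τ) (hτ' : IsAdmissible B I τ)
    (f : 𝓓(I, ℂ)) (hN : n < N) :
    funcCalc A I f - funcCalc B I f =
      (Real.pi : ℂ)⁻¹ • ∫ z, (hsIntegrand A f N τ z - hsIntegrand B f N τ z) := by
  rw [hA.funcCalc_eq hτ f hN, hB.funcCalc_eq hτ' f hN, ← smul_sub,
    integral_sub (hA.integrable_hsIntegrand hτ f hN) (hB.integrable_hsIntegrand hτ' f hN)]

theorem isTraceClass_funcCalc_sub (hV : IsTraceClass V)
    (hH : HasFunctionalCalculus (perturb H₀ V) I n) (hH₀ : HasFunctionalCalculus H₀ I n)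
    (f : 𝓓(I, ℂ)) : IsTraceClass (funcCalc (perturb H₀ V) I f - funcCalc H₀ I f) := by
  obtain ⟨τ, hτ, hτ₀, -⟩ := exists_isAdmissible_abs_im_le hH.exists_isAdmissible
    hH₀.exists_isAdmissible f.hasCompactSupport one_pos
  obtain ⟨N, hN⟩ := exists_nat_gt (max n (n + 1 + (n + 1)))
  obtain ⟨hN, hN'⟩ := max_lt_iff.1 hN
  obtain ⟨m, hm, hle⟩ := exists_traceNormLE_hsIntegrand_sub hV hH hH₀ hτ hτ₀ f
    (hN'.trans (lt_add_one _))
  rw [funcCalc_sub_eq hH hH₀ hτ hτ₀ f hN]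
  exact ((TraceNormLE.integral ((hH.integrable_hsIntegrand hτ f hN).sub
    (hH₀.integrable_hsIntegrand hτ₀ f hN)) hm hle).smul _).isTraceClass

theorem trace_funcCalc_sub (hV : IsTraceClass V)
    (hH : HasFunctionalCalculus (perturb H₀ V) I n) (hH₀ : HasFunctionalCalculus H₀ I n)
    (hτ : IsAdmissible (perturb H₀ V) I τ) (hτ₀ : IsAdmissible H₀ I τ) (f : 𝓓(I, ℂ))
    (hN : n < N) (hN' : n + 1 + (n + 1) < N + 1) :
    trace (funcCalc (perturb H₀ V) I f - funcCalc H₀ I f) =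
      (Real.pi : ℂ)⁻¹ * ∫ z, dbar (almostAnalyticExt f N τ) z • sigma (perturb H₀ V) H₀ z := by
  obtain ⟨m, hm, hle⟩ := exists_traceNormLE_hsIntegrand_sub hV hH hH₀ hτ hτ₀ f hN'
  have hint : Integrable fun z => hsIntegrand (perturb H₀ V) f N τ z - hsIntegrand H₀ f N τ z :=
    (hH.integrable_hsIntegrand hτ f hN).sub (hH₀.integrable_hsIntegrand hτ₀ f hN)
  rw [funcCalc_sub_eq hH hH₀ hτ hτ₀ f hN, trace_smul,
    TraceNormLE.trace_integral hint hm hle]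
  congr 2 with z
  rw [hsIntegrand, hsIntegrand, ← smul_sub, trace_smul, smul_eq_mul, sigma]

theorem trace_funcCalc_sub_add (hV : IsTraceClass V)
    (hH : HasFunctionalCalculus (perturb H₀ V) I n) (hH₀ : HasFunctionalCalculus H₀ I n)
    (f g : 𝓓(I, ℂ)) :
    trace (funcCalc (perturb H₀ V) I (f + g : 𝓓(I, ℂ)) - funcCalc H₀ I (f + g : 𝓓(I, ℂ))) =
      trace (funcCalc (perturb H₀ V) I f - funcCalc H₀ I f) +
        trace (funcCalc (perturb H₀ V) I g - funcCalc H₀ I g) := by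
  rw [hH.funcCalc_add, hH₀.funcCalc_add, add_sub_add_comm,
    trace_add (isTraceClass_funcCalc_sub hV hH hH₀ f) (isTraceClass_funcCalc_sub hV hH hH₀ g)]

theorem trace_funcCalc_sub_smul {A B : E →ₗ.[ℂ] E} (hA : HasFunctionalCalculus A I n)
    (hB : HasFunctionalCalculus B I n) (c : ℂ) (f : 𝓓(I, ℂ)) :
    trace (funcCalc A I (c • f : 𝓓(I, ℂ)) - funcCalc B I (c • f : 𝓓(I, ℂ))) =
      c * trace (funcCalc A I f - funcCalc B I f) := by
  rw [hA.funcCalc_smul, hB.funcCalc_smul, ← smul_sub, trace_smul]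

end SpectralShift

section OrderBound

open MeasureTheory Complex Set

theorem integrableOn_abs_im_rpow {Q : Set ℂ} (hQ : IsCompact Q) {r : ℝ} (hr : -1 < r) :
    IntegrableOn (fun z : ℂ => |z.im| ^ r) Q := by
  obtain ⟨M, -, hQM⟩ := hQ.isBounded.subset_ball_lt 0 0
  refine (integrableOn_box_abs_im_rpow hr M).mono_set fun z hz => ?_
  have hz := mem_ball_zero_iff.1 (hQM hz)
  have hre := abs_lt.1 ((abs_re_le_norm z).trans_lt hz)
  have him := abs_lt.1 ((abs_im_le_norm z).trans_lt hz)
  exact ⟨⟨hre.1, hre.2.le⟩, him.1, him.2.le⟩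

theorem HasModerateGrowth.exists_norm_integral_dbar_smul_le {F : Type*} [NormedAddCommGroup F]
    [NormedSpace ℂ F] {R : ℂ → F} {K : Set ℝ} {τ : ℝ → ℂ} {p : ℝ} {N : ℕ}
    (hR : HasModerateGrowth R (re ⁻¹' K ∩ tsupport (chi τ)) p) (hK : IsCompact K)
    (hτ : IsCutoff τ) (hp : p < N + 1) :
    ∃ W ≥ 0, ∀ f : ℝ → ℂ, ContDiff ℝ ∞ f → tsupport f ⊆ K → ∀ B : ℝ,
      (∀ x, jetNorm f (N + 1) x ≤ B) →
        ‖∫ z, dbar (almostAnalyticExt f N τ) z • R z‖ ≤ W * B := by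
  obtain ⟨D, hD, hb⟩ := exists_dbar_bound hτ hK N
  obtain ⟨C, hC, hRC⟩ := hR.exists_bound
  set Q := re ⁻¹' K ∩ tsupport (chi τ)
  have hQ : IsCompact Q := isCompact_re_preimage_inter_tsupport_chi hτ hK
  refine ⟨∫ z in Q, D * C * |z.im| ^ ((N : ℝ) - p), integral_nonneg fun z => by positivity,
    fun f hf hfK B hB => ?_⟩
  rw [← integral_mul_const, ← integral_indicator hQ.measurableSet]
  refine norm_integral_le_of_norm_le
    ((integrable_indicator_iff hQ.measurableSet).2
      (((integrableOn_abs_im_rpow hQ (by linarith)).const_mul _).mul_const B)) ?_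
  filter_upwards [ae_im_ne_zero] with z h0
  by_cases hz : z ∈ tsupport (almostAnalyticExt f N τ)
  · have hzQ : z ∈ Q := (tsupport_almostAnalyticExt_subset f N τ hz).imp_left fun h => hfK h
    have hB0 : 0 ≤ B := (jetNorm_nonneg f (N + 1) 0).trans (hB 0)
    rw [indicator_of_mem hzQ, norm_smul, sub_eq_add_neg, Real.rpow_add (abs_pos.2 h0),
      Real.rpow_natCast]
    calc ‖dbar (almostAnalyticExt f N τ) z‖ * ‖R z‖
        ≤ D * B * |z.im| ^ N * (C * |z.im| ^ (-p)) := by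
          gcongr
          · exact (hb f hf z hzQ.1).trans (by gcongr; exact hB _)
          · exact hRC z hzQ h0
      _ = D * C * (|z.im| ^ N * |z.im| ^ (-p)) * B := by ring
  · rw [dbar_eq_zero_of_notMem_tsupport hz, zero_smul, norm_zero]
    refine indicator_nonneg (fun w _ => ?_) z
    have hB0 : 0 ≤ B := (jetNorm_nonneg f (N + 1) 0).trans (hB 0)
    positivity

end OrderBound

section BoundaryLimit

open MeasureTheory Complex Set Filter

variable {F : Type*} [NormedAddCommGroup F] {R : ℂ → F} {K : Set ℝ} {p r s : ℝ}

theorem HasModerateGrowth.max_zero {S : Set ℂ} (hR : HasModerateGrowth R S p) {M : ℝ}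
    (hS : ∀ z ∈ S, |z.im| ≤ M) : HasModerateGrowth R S (max p 0) := by
  rcases le_total 0 p with h | h
  · rwa [max_eq_left h]
  obtain ⟨C, hC, hb⟩ := hR.exists_bound
  refine ⟨hR.continuousAt, C * |M| ^ (-p), by positivity, fun z hz h0 => ?_⟩
  rw [max_eq_right h, neg_zero, Real.rpow_zero, mul_one]
  exact (hb z hz h0).trans (mul_le_mul_of_nonneg_left (Real.rpow_le_rpow (abs_nonneg _)
    ((hS z hz).trans (le_abs_self M)) (by linarith)) hC)

theorem abs_im_add_mul_I (hs : s = 1 ∨ s = -1) {z : ℂ} (hz : 0 ≤ s * z.im) {ε : ℝ} (hε : 0 ≤ ε) :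
    |(z + (s * ε : ℝ) * I).im| = |z.im| + ε := by
  have him : (z + (s * ε : ℝ) * I).im = z.im + s * ε := by simp
  rw [him]
  rcases hs with rfl | rfl
  · rw [abs_of_nonneg (by linarith), abs_of_nonneg (by linarith), one_mul]
  · rw [abs_of_nonpos (by linarith), abs_of_nonpos (by linarith)]
    ring

theorem add_mul_I_mem (hs : s = 1 ∨ s = -1) {z : ℂ} (hz : z ∈ re ⁻¹' K ∩ {z | |z.im| ≤ r})
    (hsz : 0 ≤ s * z.im) {ε : ℝ} (hε : ε ∈ Ioo 0 r) :
    z + (s * ε : ℝ) * I ∈ re ⁻¹' K ∩ {z | |z.im| ≤ 2 * r} ∧ (z + (s * ε : ℝ) * I).im ≠ 0 := by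
  have him := abs_im_add_mul_I hs hsz hε.1.le
  have hz2 : |z.im| ≤ r := hz.2
  refine ⟨⟨?_, ?_⟩, abs_pos.1 (him ▸ add_pos_of_nonneg_of_pos (abs_nonneg _) hε.1)⟩
  · rw [mem_preimage, add_re, re_ofReal_mul, I_re, mul_zero, add_zero]
    exact hz.1
  · change |(z + (s * ε : ℝ) * I).im| ≤ 2 * r
    rw [him]
    linarith [hε.2]

variable [NormedSpace ℂ F]

theorem integrableOn_dbar_smul_halfPlane {g : ℂ → ℂ} (hg : ContDiff ℝ ∞ g)
    (hgc : HasCompactSupport g)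
    (hR : ∀ z ∈ tsupport g, 0 ≤ s * z.im → DifferentiableAt ℂ R z) :
    IntegrableOn (fun z => dbar g z • R z) {z | 0 < s * z.im} := by
  have hQ : IsCompact (tsupport g ∩ {z : ℂ | 0 ≤ s * z.im}) :=
    hgc.isCompact.inter_right (isClosed_le continuous_const (continuous_const.mul continuous_im))
  have hcont : ContinuousOn (fun z => dbar g z • R z) (tsupport g ∩ {z : ℂ | 0 ≤ s * z.im}) :=
    (continuous_dbar hg).continuousOn.smul fun z hz =>
      (hR z hz.1 hz.2).continuousAt.continuousWithinAt
  have hi := hcont.integrableOn_compact (μ := volume) hQ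
  refine hi.of_forall_sdiff_eq_zero (measurableSet_halfPlane s) fun z hz => ?_
  have hzg : z ∉ tsupport g := fun h => hz.2 ⟨h, show 0 ≤ s * z.im from le_of_lt hz.1⟩
  rw [dbar_eq_zero_of_notMem_tsupport hzg, zero_smul]

theorem integral_halfPlane_dbar_smul [CompleteSpace F] {g : ℂ → ℂ} (hs : s = 1 ∨ s = -1)
    (hg : ContDiff ℝ ∞ g) (hgc : HasCompactSupport g)
    (hR : ∀ z ∈ tsupport g, 0 ≤ s * z.im → DifferentiableAt ℂ R z) :
    ∫ z in {z : ℂ | 0 < s * z.im}, dbar g z • R z =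
      (s : ℂ) • (2 * I)⁻¹ • ∫ x : ℝ, g x • R x := by
  obtain ⟨M, hM, hbox⟩ := exists_box hgc
  have hd (z : ℂ) (hz : 0 ≤ s * z.im) : HasDbarAt (fun w => g w • R w) (dbar g z • R z) z :=
    hasDbarAt_smul_of_tsupport (hg.differentiable (by simp)) fun h => hR z h hz
  refine integral_halfPlane_dbar hs (G := fun z => g z • R z) hM
    (fun z hz => by rw [image_eq_zero_of_notMem_tsupport (hbox z hz), zero_smul])
    (fun z hz => ?_) (fun z hz => hd z (le_of_lt hz)) (integrableOn_dbar_smul_halfPlane hg hgc hR)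
  obtain ⟨L, hL, -⟩ := hd z hz
  exact hL.continuousAt.continuousWithinAt

theorem HasModerateGrowth.exists_norm_dbar_smul_shift_le {g : ℂ → ℂ} {m : ℕ} {C : ℝ}
    (hR : HasModerateGrowth R (re ⁻¹' K ∩ {z | |z.im| ≤ 2 * r}) p) (hs : s = 1 ∨ s = -1)
    (hgK : tsupport g ⊆ re ⁻¹' K ∩ {z | |z.im| ≤ r}) (hgb : ∀ z, ‖dbar g z‖ ≤ C * |z.im| ^ m) :
    ∃ W : ℝ, ∀ ε ∈ Ioo 0 r, ∀ z : ℂ, 0 < s * z.im →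
      ‖dbar g z • R (z + (s * ε : ℝ) * I)‖ ≤
        (tsupport g).indicator (fun z => W * |z.im| ^ ((m : ℝ) - max p 0)) z := by
  obtain ⟨D, hD, hRD⟩ := (hR.max_zero fun z hz => hz.2).exists_bound
  refine ⟨C * D, fun ε hε z hsz => ?_⟩
  by_cases hz : z ∈ tsupport g
  · obtain ⟨hmem, h0⟩ := add_mul_I_mem hs (hgK hz) hsz.le hε
    have hpos : 0 < |z.im| := abs_pos.2 (right_ne_zero_of_mul hsz.ne')
    rw [indicator_of_mem hz, norm_smul, sub_eq_add_neg, Real.rpow_add hpos, Real.rpow_natCast,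
      mul_mul_mul_comm]
    refine mul_le_mul (hgb z) ((hRD _ hmem h0).trans ?_) (norm_nonneg _)
      ((norm_nonneg _).trans (hgb z))
    rw [abs_im_add_mul_I hs hsz.le hε.1.le]
    exact mul_le_mul_of_nonneg_left (Real.rpow_le_rpow_of_nonpos hpos
      (le_add_of_nonneg_right hε.1.le) (neg_nonpos.2 (le_max_right _ _))) hD
  · rw [dbar_eq_zero_of_notMem_tsupport hz, zero_smul, norm_zero, indicator_of_notMem hz]

theorem tendsto_dbar_smul_shift {g : ℂ → ℂ} {z : ℂ} (hR : z ∈ tsupport g → ContinuousAt R z) :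
    Tendsto (fun ε : ℝ => dbar g z • R (z + (s * ε : ℝ) * I)) (𝓝[>] 0) (𝓝 (dbar g z • R z)) := by
  by_cases hz : z ∈ tsupport g
  · have hpath : Continuous fun ε : ℝ => z + (s * ε : ℝ) * I := by fun_prop
    have hpath := (hpath.tendsto 0).mono_left (nhdsWithin_le_nhds (s := Ioi (0 : ℝ)))
    simp only [mul_zero, ofReal_zero, zero_mul, add_zero] at hpath
    exact ((hR hz).tendsto.comp hpath).const_smul _
  · simp only [dbar_eq_zero_of_notMem_tsupport hz, zero_smul, tendsto_const_nhds]

/-- Stokes' theorem applies to the translates of `R` away from the real axis; the vanishing of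
`∂_{z̄} g` on the axis makes their limit dominated. -/
theorem HasModerateGrowth.tendsto_integral_halfPlane [CompleteSpace F] {g : ℂ → ℂ} {m : ℕ} {C : ℝ}
    (hR : HasModerateGrowth R (re ⁻¹' K ∩ {z | |z.im| ≤ 2 * r}) p)
    (hd : ∀ z ∈ re ⁻¹' K ∩ {z | |z.im| ≤ 2 * r}, z.im ≠ 0 → DifferentiableAt ℂ R z)
    (hr : 0 < r) (hs : s = 1 ∨ s = -1) (hg : ContDiff ℝ ∞ g) (hgc : HasCompactSupport g)
    (hgK : tsupport g ⊆ re ⁻¹' K ∩ {z | |z.im| ≤ r}) (hgb : ∀ z, ‖dbar g z‖ ≤ C * |z.im| ^ m)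
    (hp : p < m + 1) :
    Tendsto (fun ε : ℝ => (s : ℂ) • (2 * I)⁻¹ • ∫ x : ℝ, g x • R (x + (s * ε : ℝ) * I)) (𝓝[>] 0)
      (𝓝 (∫ z in {z : ℂ | 0 < s * z.im}, dbar g z • R z)) := by
  have hev : ∀ᶠ ε : ℝ in 𝓝[>] 0, ε ∈ Ioo 0 r := Ioo_mem_nhdsGT hr
  have hshift {ε : ℝ} (hε : ε ∈ Ioo 0 r) (z : ℂ) (hz : z ∈ tsupport g) (hsz : 0 ≤ s * z.im) :
      DifferentiableAt ℂ (fun w => R (w + (s * ε : ℝ) * I)) z := by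
    obtain ⟨hmem, h0⟩ := add_mul_I_mem hs (hgK hz) hsz hε
    exact (hd _ hmem h0).comp z (differentiableAt_id.add_const _)
  obtain ⟨W, hbound⟩ := hR.exists_norm_dbar_smul_shift_le hs hgK hgb
  have hq : max p 0 < m + 1 := max_lt hp (by positivity)
  have hdom : IntegrableOn (fun z : ℂ => W * |z.im| ^ ((m : ℝ) - max p 0)) (tsupport g) :=
    (integrableOn_abs_im_rpow hgc.isCompact (by linarith)).const_mul _
  have hlim (z : ℂ) (hsz : 0 < s * z.im) :
      Tendsto (fun ε : ℝ => dbar g z • R (z + (s * ε : ℝ) * I)) (𝓝[>] 0) (𝓝 (dbar g z • R z)) := by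
    refine tendsto_dbar_smul_shift fun hz => hR.continuousAt z ⟨(hgK hz).1, ?_⟩
      (right_ne_zero_of_mul hsz.ne')
    have hzr : |z.im| ≤ r := (hgK hz).2
    change |z.im| ≤ 2 * r
    linarith
  refine (tendsto_integral_filter_of_dominated_convergence _
    (hev.mono fun ε hε => (integrableOn_dbar_smul_halfPlane hg hgc
      (hshift hε)).aestronglyMeasurable)
    (hev.mono fun ε hε => ae_restrict_of_forall_mem (measurableSet_halfPlane s) (hbound ε hε))
    ((integrable_indicator_iff (isClosed_tsupport g).measurableSet).2 hdom).integrableOn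
    (ae_restrict_of_forall_mem (measurableSet_halfPlane s) hlim)).congr' ?_
  exact hev.mono fun ε hε => integral_halfPlane_dbar_smul hs hg hgc (hshift hε)

theorem integrable_smul_of_continuousAt {f : ℝ → ℂ} (hf : Continuous f) (hfc : HasCompactSupport f)
    {h : ℝ → F} (hh : ∀ x ∈ tsupport f, ContinuousAt h x) : Integrable fun x => f x • h x := by
  refine Continuous.integrable_of_hasCompactSupport (continuous_iff_continuousAt.2 fun x => ?_)
    hfc.smul_right
  by_cases hx : x ∈ tsupport f
  · exact hf.continuousAt.smul (hh x hx)
  · refine (continuousAt_const (y := (0 : F))).congr ?_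
    filter_upwards [notMem_tsupport_iff_eventuallyEq.1 hx] with y hy
    rw [hy, Pi.zero_apply, zero_smul]

theorem HasModerateGrowth.tendsto_integral_jump [CompleteSpace F] {f : ℝ → ℂ} {N : ℕ} {τ : ℝ → ℂ}
    (hR : HasModerateGrowth R (re ⁻¹' tsupport f ∩ {z | |z.im| ≤ 2 * r}) p)
    (hd : ∀ z ∈ re ⁻¹' tsupport f ∩ {z | |z.im| ≤ 2 * r}, z.im ≠ 0 → DifferentiableAt ℂ R z)
    (hr : 0 < r) (hf : ContDiff ℝ ∞ f) (hfc : HasCompactSupport f) (hτ : IsCutoff τ)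
    (hτr : ∀ z ∈ tsupport (chi τ), z.re ∈ tsupport f → |z.im| ≤ r) (hp : p < N + 1) :
    Tendsto (fun ε : ℝ => (2 * Real.pi * I)⁻¹ •
      ∫ x : ℝ, f x • (R (x + ε * I) - R (x - ε * I))) (𝓝[>] 0)
      (𝓝 ((Real.pi : ℂ)⁻¹ • ∫ z, dbar (almostAnalyticExt f N τ) z • R z)) := by
  have hsub : tsupport (almostAnalyticExt f N τ) ⊆ re ⁻¹' tsupport f ∩ {z | |z.im| ≤ r} :=
    fun z hz =>
      have hz := tsupport_almostAnalyticExt_subset f N τ hz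
      ⟨hz.1, hτr z hz.2 hz.1⟩
  obtain ⟨C, -, hC⟩ := exists_dbar_almostAnalyticExt_bound hf hfc N hτ
  have hlim {s : ℝ} (hs : s = 1 ∨ s = -1) := hR.tendsto_integral_halfPlane hd hr hs
    (contDiff_almostAnalyticExt hf N hτ) (hasCompactSupport_almostAnalyticExt hfc N hτ) hsub hC hp
  have hsub' : tsupport (almostAnalyticExt f N τ) ⊆ re ⁻¹' tsupport f ∩ {z | |z.im| ≤ 2 * r} :=
    hsub.trans (inter_subset_inter_right _ fun z (hz : |z.im| ≤ r) => hz.trans (by linarith))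
  have hi := (hR.mono hsub').integrable_dbar_smul hf hfc hτ hp
  have hlim := ((hlim (Or.inl rfl)).add (hlim (Or.inr rfl))).const_smul (Real.pi : ℂ)⁻¹
  rw [← integral_eq_add_halfPlanes hi] at hlim
  refine hlim.congr' ?_
  filter_upwards [Ioo_mem_nhdsGT hr] with ε hε
  have hint {s : ℝ} (hs : s = 1 ∨ s = -1) :
      Integrable fun x : ℝ => f x • R (x + (s * ε : ℝ) * I) := by
    refine integrable_smul_of_continuousAt hf.continuous hfc fun x hx => ?_
    obtain ⟨hmem, h0⟩ := add_mul_I_mem (K := tsupport f) (z := x) hs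
      ⟨hx, by simpa using hr.le⟩ (by simp) hε
    exact ContinuousAt.comp (f := fun x : ℝ => (x : ℂ) + (s * ε : ℝ) * I)
      (hR.continuousAt _ hmem h0) (by fun_prop)
  have hplus := hint (Or.inl rfl)
  have hminus := hint (Or.inr rfl)
  simp only [almostAnalyticExt_ofReal f N hτ]
  simp only [one_mul, neg_mul, ofReal_neg, ofReal_one, one_smul, neg_smul, ← sub_eq_add_neg]
    at hplus hminus ⊢
  simp_rw [smul_sub (f _)]
  rw [integral_sub hplus hminus, ← smul_sub, smul_smul, ← mul_inv]
  ring_nf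

end BoundaryLimit

section Primitive

open MeasureTheory Set

variable {F : Type*} [NormedAddCommGroup F] [NormedSpace ℝ F] {g : ℝ → F} {l u B : ℝ}

/-- The primitive of `g` that vanishes at `-∞`. -/
noncomputable def primitive (g : ℝ → F) (x : ℝ) : F := ∫ t in Iic x, g t

theorem primitive_deriv [CompleteSpace F] (hg : ContDiff ℝ 1 g) (hgc : HasCompactSupport g) :
    primitive (deriv g) = g :=
  funext (hgc.integral_Iic_deriv_eq hg)

theorem hasDerivAt_primitive [CompleteSpace F] (hg : Continuous g) (hgi : Integrable g) (x : ℝ) :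
    HasDerivAt (primitive g) (g x) x := by
  have hprim : primitive g = fun x => (∫ t in (0 : ℝ)..x, g t) + primitive g 0 := by
    ext x
    rw [← intervalIntegral.integral_Iic_sub_Iic hgi.integrableOn hgi.integrableOn, primitive,
      primitive, sub_add_cancel]
  rw [hprim]
  exact (intervalIntegral.integral_hasDerivAt_right (hg.intervalIntegrable _ _)
    (hg.stronglyMeasurableAtFilter _ _) hg.continuousAt).add_const _

theorem contDiff_primitive [CompleteSpace F] (hg : ContDiff ℝ ∞ g) (hgi : Integrable g) :
    ContDiff ℝ ∞ (primitive g) := by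
  have hd := hasDerivAt_primitive hg.continuous hgi
  rw [contDiff_infty_iff_deriv, funext fun x => (hd x).deriv]
  exact ⟨fun x => (hd x).differentiableAt, hg⟩

theorem tsupport_primitive_subset (hs : tsupport g ⊆ Icc l u) (h0 : ∫ x, g x = 0) :
    tsupport (primitive g) ⊆ Icc l u := by
  have hz {t : ℝ} (ht : t ∉ Icc l u) : g t = 0 :=
    image_eq_zero_of_notMem_tsupport fun h => ht (hs h)
  refine closure_minimal (fun x hx => ?_) isClosed_Icc
  contrapose! hx
  rw [Function.notMem_support]
  rcases lt_or_ge x l with h | h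
  · exact setIntegral_eq_zero_of_forall_eq_zero fun t ht => hz fun h' =>
      (h'.1.trans ht).not_gt h
  · refine (setIntegral_eq_integral_of_forall_compl_eq_zero fun t ht => hz fun h' => ?_).trans h0
    exact hx ⟨h, (not_le.1 ht).le.trans h'.2⟩

theorem norm_setIntegral_le_of_tsupport_subset_Icc (hlu : l ≤ u) (hs : tsupport g ⊆ Icc l u)
    (hB : ∀ x, ‖g x‖ ≤ B) (s : Set ℝ) : ‖∫ x in s, g x‖ ≤ (u - l) * B := by
  have hle : (volume.restrict s) (Icc l u) ≤ volume (Icc l u) := Measure.restrict_apply_le s _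
  have hIcc : ∫ x in Icc l u, g x ∂(volume.restrict s) = ∫ x in s, g x :=
    setIntegral_eq_integral_of_forall_compl_eq_zero fun t ht =>
      image_eq_zero_of_notMem_tsupport fun h => ht (hs h)
  calc ‖∫ x in s, g x‖ ≤ B * (volume.restrict s).real (Icc l u) :=
        hIcc ▸ norm_setIntegral_le_of_norm_le_const (hle.trans_lt (by simp)) fun x _ => hB x
    _ ≤ B * volume.real (Icc l u) := mul_le_mul_of_nonneg_left
        (ENNReal.toReal_mono (by simp) hle) ((norm_nonneg _).trans (hB 0))
    _ = (u - l) * B := by rw [Real.volume_real_Icc_of_le hlu, mul_comm]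

theorem norm_iteratedDeriv_primitive_le [CompleteSpace F] (hlu : l ≤ u) (hg : ContDiff ℝ ∞ g)
    (hs : tsupport g ⊆ Icc l u) {m : ℕ} (hB : ∀ k ≤ m, ∀ x, ‖iteratedDeriv k g x‖ ≤ B) (x : ℝ) :
    ‖iteratedDeriv m (primitive g) x‖ ≤ (1 + (u - l)) * B := by
  have hB0 : 0 ≤ B := (norm_nonneg _).trans (hB 0 m.zero_le 0)
  have hul : 0 ≤ (u - l) * B := mul_nonneg (sub_nonneg.2 hlu) hB0
  rw [add_mul, one_mul]
  cases m with
  | zero =>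
    simp only [nonpos_iff_eq_zero, forall_eq, iteratedDeriv_zero] at hB ⊢
    exact le_add_of_nonneg_of_le hB0 (norm_setIntegral_le_of_tsupport_subset_Icc hlu hs hB _)
  | succ m =>
    have hgi : Integrable g := hg.continuous.integrable_of_hasCompactSupport
      (isCompact_Icc.of_isClosed_subset (isClosed_tsupport g) hs)
    rw [iteratedDeriv_succ', funext fun x => (hasDerivAt_primitive hg.continuous hgi x).deriv]
    exact le_add_of_le_of_nonneg (hB m m.le_succ x) hul

end Primitive

section Centered

open MeasureTheory Set

variable {f g f₀ : ℝ → ℂ}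

/-- If `f₀` has integral one, the projection of `f` along `f₀` to the functions with integral zero.
These are the functions with a compactly supported primitive. -/
noncomputable def centered (f₀ f : ℝ → ℂ) : ℝ → ℂ := f - (∫ x, f x) • f₀

theorem integrable_centered (hf₀ : Integrable f₀) (hf : Integrable f) :
    Integrable (centered f₀ f) :=
  hf.sub (hf₀.smul _)

theorem integral_centered (hf₀ : Integrable f₀) (h1 : ∫ x, f₀ x = 1) (hf : Integrable f) :
    ∫ x, centered f₀ f x = 0 := by
  change ∫ x, (f x - (∫ y, f y) * f₀ x) = 0
  rw [integral_sub hf (hf₀.const_mul _), integral_const_mul, h1, mul_one, sub_self]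

theorem centered_add (hf : Integrable f) (hg : Integrable g) :
    centered f₀ (f + g) = centered f₀ f + centered f₀ g := by
  simp only [centered, Pi.add_apply, integral_add hf hg]
  module

theorem centered_smul (c : ℂ) : centered f₀ (c • f) = c • centered f₀ f := by
  simp only [centered, Pi.smul_apply, integral_smul]
  module

theorem centered_of_integral_eq_zero (h0 : ∫ x, f x = 0) : centered f₀ f = f := by
  rw [centered, h0, zero_smul, sub_zero]

theorem contDiff_centered (hf₀ : ContDiff ℝ ∞ f₀) (hf : ContDiff ℝ ∞ f) :
    ContDiff ℝ ∞ (centered f₀ f) :=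
  hf.sub (contDiff_const.smul hf₀)

theorem tsupport_centered_subset (f₀ f : ℝ → ℂ) :
    tsupport (centered f₀ f) ⊆ tsupport f ∪ tsupport f₀ :=
  (tsupport_sub f _).trans
    (union_subset_union_right _ (tsupport_smul_subset_right (fun _ => ∫ x, f x) f₀))

theorem norm_iteratedDeriv_centered_le {l u B D : ℝ} {k : ℕ} (hlu : l ≤ u)
    (hf₀ : ContDiff ℝ ∞ f₀) (hf : ContDiff ℝ ∞ f) (hs : tsupport f ⊆ Icc l u)
    (h0 : ∀ x, ‖f x‖ ≤ B) (hk : ∀ x, ‖iteratedDeriv k f x‖ ≤ B)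
    (hD : ∀ x, ‖iteratedDeriv k f₀ x‖ ≤ D) (x : ℝ) :
    ‖iteratedDeriv k (centered f₀ f) x‖ ≤ (1 + (u - l) * D) * B := by
  have hint : ‖∫ y, f y‖ ≤ (u - l) * B := by
    simpa only [setIntegral_univ] using norm_setIntegral_le_of_tsupport_subset_Icc hlu hs h0 univ
  have hf₀' : ContDiff ℝ ∞ ((∫ y, f y) • f₀) := contDiff_const.smul hf₀
  rw [centered, iteratedDeriv_sub (hf.contDiffAt.of_le (mod_cast le_top))
    (hf₀'.contDiffAt.of_le (mod_cast le_top)), iteratedDeriv_const_smul_field]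
  calc _ ≤ ‖iteratedDeriv k f x‖ + ‖∫ y, f y‖ * ‖iteratedDeriv k f₀ x‖ := by
        rw [← norm_smul]
        exact norm_sub_le _ _
    _ ≤ B + (u - l) * B * D := by
        have := (norm_nonneg _).trans hint
        gcongr
        exacts [hk x, hD x]
    _ = (1 + (u - l) * D) * B := by ring

end Centered

section Distributions

open MeasureTheory Set TopologicalSpace

variable {Ω : Opens ℝ}

theorem integrable_testFunction (f : 𝓓(Ω, ℂ)) : Integrable f :=
  f.continuous.integrable_of_hasCompactSupport f.hasCompactSupport

theorem exists_clm_of_norm_le_jetNorm {L : 𝓓(Ω, ℂ) → ℂ} (hadd : ∀ f g, L (f + g) = L f + L g)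
    (hsmul : ∀ (c : ℂ) f, L (c • f) = c • L f)
    (hL : ∀ K : Set ℝ, IsCompact K → K ⊆ Ω → ∃ (m : ℕ) (W : ℝ), 0 ≤ W ∧
      ∀ f : 𝓓(Ω, ℂ), tsupport f ⊆ K → ∀ B : ℝ, (∀ x, jetNorm f m x ≤ B) → ‖L f‖ ≤ W * B) :
    ∃ T : 𝓓(Ω, ℂ) →L[ℂ] ℂ, ∀ f, T f = L f := by
  refine ⟨TestFunction.mkCLM ℂ L hadd hsmul fun K hK => ?_, fun f => rfl⟩
  obtain ⟨m, W, hW, hb⟩ := hL K K.isCompact hK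
  refine (ContDiffMapSupportedIn.mkCLMtoNormedSpace (𝕜 := ℂ) (L ∘ TestFunction.ofSupportedIn hK)
    (fun f g => hadd (TestFunction.ofSupportedIn hK f) (TestFunction.ofSupportedIn hK g))
    (fun c f => hsmul c (TestFunction.ofSupportedIn hK f))
    ⟨Finset.range (m + 1), W * (m + 1), by positivity, fun f => ?_⟩).continuous
  rw [mul_assoc]
  refine hb _ f.tsupport_subset _ fun x => ?_
  refine (Finset.sum_le_card_nsmul _ _ _ fun k hk => ?_).trans_eq (by
    rw [Finset.card_range, nsmul_eq_mul, Nat.cast_add_one])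
  rw [← norm_iteratedFDeriv_eq_norm_iteratedDeriv]
  exact (ContDiffMapSupportedIn.norm_iteratedFDeriv_apply_le_seminorm_top (𝕜 := ℂ)).trans
    (Finset.le_sup (f := fun i => N[ℂ; ℂ]_{K, i}) hk f)

theorem exists_Icc_of_isCompact {s K : Set ℝ} (hs : s.OrdConnected) (hK : IsCompact K)
    (hKs : K ⊆ s) (hne : s.Nonempty) : ∃ l u, l ≤ u ∧ K ⊆ Icc l u ∧ Icc l u ⊆ s := by
  rcases K.eq_empty_or_nonempty with rfl | hK0
  · obtain ⟨x, hx⟩ := hne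
    exact ⟨x, x, le_rfl, empty_subset _, by simpa using hx⟩
  · exact ⟨sInf K, sSup K, csInf_le_csSup hK0 hK.bddBelow hK.bddAbove,
      subset_Icc_csInf_csSup hK.bddBelow hK.bddAbove,
      hs.out (hKs (hK.sInf_mem hK0)) (hKs (hK.sSup_mem hK0))⟩

theorem exists_integral_eq_one (hne : (Ω : Set ℝ).Nonempty) : ∃ f₀ : 𝓓(Ω, ℂ), ∫ x, f₀ x = 1 := by
  obtain ⟨x, hx⟩ := hne
  obtain ⟨r, hr, hrΩ⟩ := Metric.isOpen_iff.1 Ω.isOpen x hx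
  let φ : ContDiffBump x := ⟨r / 4, r / 2, by positivity, by linarith⟩
  have hs : tsupport (fun y => ((φ.normed volume y : ℝ) : ℂ)) ⊆ Metric.closedBall x (r / 2) := by
    rw [← φ.tsupport_normed_eq (μ := volume)]
    exact closure_mono fun y hy h => hy (by simp only [h, Complex.ofReal_zero])
  refine ⟨⟨fun y => ((φ.normed volume y : ℝ) : ℂ),
    Complex.ofRealCLM.contDiff.comp φ.contDiff_normed,
    (isCompact_closedBall x (r / 2)).of_isClosed_subset (isClosed_tsupport _) hs,
    hs.trans ((Metric.closedBall_subset_ball (by linarith)).trans hrΩ)⟩, ?_⟩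
  change ∫ y, ((φ.normed volume y : ℝ) : ℂ) = 1
  rw [integral_complex_ofReal, φ.integral_normed, Complex.ofReal_one]

theorem exists_clm_eq_primitive_centered_supportedIn {f₀ : ℝ → ℂ} (hf₀ : ContDiff ℝ ∞ f₀)
    (h1 : ∫ x, f₀ x = 1) {K : Compacts ℝ} {l u : ℝ} (hlu : l ≤ u) (hs : tsupport f₀ ⊆ Icc l u)
    (hK : (K : Set ℝ) ⊆ Icc l u) :
    ∃ P : 𝓓_{K}(ℝ, ℂ) →L[ℂ] 𝓓_{⟨Icc l u, isCompact_Icc⟩}(ℝ, ℂ),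
      ∀ f, (P f : ℝ → ℂ) = primitive (centered f₀ f) := by
  have hf₀c : HasCompactSupport f₀ := isCompact_Icc.of_isClosed_subset (isClosed_tsupport _) hs
  have hi₀ : Integrable f₀ := hf₀.continuous.integrable_of_hasCompactSupport hf₀c
  have hi (f : 𝓓_{K}(ℝ, ℂ)) : Integrable f :=
    f.continuous.integrable_of_hasCompactSupport f.hasCompactSupport
  have hci (f : 𝓓_{K}(ℝ, ℂ)) : Integrable (centered f₀ f) := integrable_centered hi₀ (hi f)
  have hfs (f : 𝓓_{K}(ℝ, ℂ)) : tsupport f ⊆ Icc l u := f.tsupport_subset.trans hK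
  have hcs (f : 𝓓_{K}(ℝ, ℂ)) : tsupport (centered f₀ f) ⊆ Icc l u :=
    (tsupport_centered_subset f₀ f).trans (union_subset (hfs f) hs)
  refine ⟨ContDiffMapSupportedIn.mkCLM ℂ (fun f => primitive (centered f₀ f)) (fun f g x => ?_)
    (fun c f x => ?_) (fun f => contDiff_primitive (contDiff_centered hf₀ f.contDiff) (hci f))
    (fun f x hx => image_eq_zero_of_notMem_tsupport fun h =>
      hx (tsupport_primitive_subset (hcs f) (integral_centered hi₀ h1 (hi f)) h))
    fun i _ => ?_, fun f => rfl⟩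
  · rw [FunLike.coe_add, centered_add (hi f) (hi g)]
    exact integral_add (hci f).integrableOn (hci g).integrableOn
  · rw [FunLike.coe_smul, centered_smul]
    exact integral_smul c _
  · obtain ⟨D, hD, hfD⟩ := exists_jetNorm_le hf₀ hf₀c i
    have hul := sub_nonneg.2 hlu
    refine ⟨Finset.range (i + 1), (1 + (u - l)) * (1 + (u - l) * D),
      mul_nonneg (add_nonneg zero_le_one hul) (add_nonneg zero_le_one (mul_nonneg hul hD)),
      fun f x _ => ?_⟩
    have hB (k : ℕ) (hk : k ≤ i) (x : ℝ) : ‖iteratedDeriv k f x‖ ≤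
        ((Finset.range (i + 1)).sup fun j => N[ℂ; ℂ]_{K, j}) f := by
      rw [← norm_iteratedFDeriv_eq_norm_iteratedDeriv]
      exact (ContDiffMapSupportedIn.norm_iteratedFDeriv_apply_le_seminorm_top (𝕜 := ℂ)).trans
        (Finset.le_sup (f := fun i => N[ℂ; ℂ]_{K, i}) (Finset.mem_range_succ_iff.2 hk) f)
    rw [norm_iteratedFDeriv_eq_norm_iteratedDeriv, mul_assoc]
    exact norm_iteratedDeriv_primitive_le hlu (contDiff_centered hf₀ f.contDiff) (hcs f)
      (fun k hk => norm_iteratedDeriv_centered_le hlu hf₀ f.contDiff (hfs f)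
        (fun x => by simpa using hB 0 i.zero_le x) (hB k hk)
        fun x => (norm_iteratedDeriv_le_jetNorm f₀ hk x).trans (hfD x)) x

theorem exists_clm_eq_primitive_centered (hΩ : (Ω : Set ℝ).OrdConnected) {f₀ : 𝓓(Ω, ℂ)}
    (h1 : ∫ x, f₀ x = 1) :
    ∃ P : 𝓓(Ω, ℂ) →L[ℂ] 𝓓(Ω, ℂ), ∀ f, (P f : ℝ → ℂ) = primitive (centered f₀ f) := by
  have hne : (Ω : Set ℝ).Nonempty := by
    rw [nonempty_iff_ne_empty]
    intro h
    have hf₀ := tsupport_eq_empty_iff.1 (subset_empty_iff.1 (f₀.tsupport_subset.trans_eq h))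
    simp [hf₀] at h1
  have hK (K : Compacts ℝ) (hKΩ : (K : Set ℝ) ⊆ Ω) : ∃ P : 𝓓_{K}(ℝ, ℂ) →L[ℂ] 𝓓(Ω, ℂ),
      ∀ f, (P f : ℝ → ℂ) = primitive (centered f₀ f) := by
    obtain ⟨l, u, hlu, hlK, hluΩ⟩ := exists_Icc_of_isCompact hΩ
      (K.isCompact.union f₀.hasCompactSupport) (union_subset hKΩ f₀.tsupport_subset) hne
    obtain ⟨P, hP⟩ := exists_clm_eq_primitive_centered_supportedIn f₀.contDiff h1 hlu
      (subset_union_right.trans hlK) (subset_union_left.trans hlK)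
    exact ⟨(TestFunction.ofSupportedInCLM ℂ hluΩ).comp P, hP⟩
  choose P hP using hK
  let suppC (f : 𝓓(Ω, ℂ)) : Compacts ℝ := ⟨tsupport f, f.hasCompactSupport⟩
  let toFun (f : 𝓓(Ω, ℂ)) : 𝓓(Ω, ℂ) := P (suppC f) f.tsupport_subset
    (.of_support_subset f.contDiff subset_closure)
  have hfun (f : 𝓓(Ω, ℂ)) : (toFun f : ℝ → ℂ) = primitive (centered f₀ f) := hP _ _ _
  refine ⟨TestFunction.limitCLM ℂ toFun P fun K hKΩ f => DFunLike.coe_injective ?_, hfun⟩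
  rw [hfun, hP]
  rfl

theorem distDeriv_apply (η : 𝓓(Ω, ℂ) →L[ℂ] ℂ) (f : 𝓓(Ω, ℂ)) :
    distDeriv η f = -η (TestFunction.lineDerivCLM ℂ (1 : ℝ) f : 𝓓(Ω, ℂ)) := rfl

theorem coe_lineDerivCLM_one (f : 𝓓(Ω, ℂ)) :
    ((TestFunction.lineDerivCLM ℂ (1 : ℝ) f : 𝓓(Ω, ℂ)) : ℝ → ℂ) = deriv f := by
  ext x
  rw [TestFunction.lineDerivCLM_apply_of_le (by simp)]
  have hd : DifferentiableAt ℝ f x := f.contDiff.differentiable (by simp) x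
  rw [hd.lineDeriv_eq_fderiv, fderiv_eq_smul_deriv, one_smul]

theorem integral_deriv_testFunction (f : 𝓓(Ω, ℂ)) : ∫ x, deriv f x = 0 := by
  have hd : Differentiable ℝ f := f.contDiff.differentiable (by simp)
  have hc : Continuous (deriv f) := f.contDiff.continuous_deriv (by simp)
  exact integral_eq_zero_of_hasDerivAt_of_integrable (fun x => (hd x).hasDerivAt)
    (hc.integrable_of_hasCompactSupport f.hasCompactSupport.deriv) (integrable_testFunction f)

theorem exists_distDeriv_eq_iff (hΩ : (Ω : Set ℝ).OrdConnected) (T : 𝓓(Ω, ℂ) →L[ℂ] ℂ) :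
    ∃ ξ : 𝓓(Ω, ℂ) →L[ℂ] ℂ, ∀ η : 𝓓(Ω, ℂ) →L[ℂ] ℂ,
      distDeriv η = T ↔ ∃ C : ℂ, ∀ f : 𝓓(Ω, ℂ), η f = ξ f + C * ∫ x, f x := by
  rcases (Ω : Set ℝ).eq_empty_or_nonempty with hΩ0 | hne
  · have hz (f : 𝓓(Ω, ℂ)) : f = 0 := DFunLike.coe_injective
      (tsupport_eq_empty_iff.1 (subset_empty_iff.1 (f.tsupport_subset.trans_eq hΩ0)))
    refine ⟨0, fun η => ⟨fun _ => ⟨0, fun f => by simp [hz f]⟩, fun _ => ?_⟩⟩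
    ext f
    rw [hz f, map_zero, map_zero]
  obtain ⟨f₀, h1⟩ := exists_integral_eq_one hne
  obtain ⟨P, hP⟩ := exists_clm_eq_primitive_centered hΩ h1
  refine ⟨-(T.comp P), fun η => ⟨fun h => ⟨η f₀, fun f => ?_⟩, fun ⟨C, hC⟩ => ?_⟩⟩
  · have hf : f = (TestFunction.lineDerivCLM ℂ (1 : ℝ) (P f) : 𝓓(Ω, ℂ)) + (∫ y, f y) • f₀ := by
      have hd := hasDerivAt_primitive
        (contDiff_centered f₀.contDiff f.contDiff).continuous
        (integrable_centered (integrable_testFunction f₀) (integrable_testFunction f))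
      refine DFunLike.coe_injective ?_
      rw [FunLike.coe_add, coe_lineDerivCLM_one, hP, funext fun x => (hd x).deriv]
      exact (sub_add_cancel _ _).symm
    have hη : T (P f) = -η (TestFunction.lineDerivCLM ℂ (1 : ℝ) (P f) : 𝓓(Ω, ℂ)) := by
      rw [← h, distDeriv_apply]
    change η f = -T (P f) + _
    nth_rw 1 [hf]
    rw [map_add, map_smul, hη, neg_neg, smul_eq_mul, mul_comm]
  · ext f
    have hPf : P (TestFunction.lineDerivCLM ℂ (1 : ℝ) f : 𝓓(Ω, ℂ)) = f := by
      refine DFunLike.coe_injective ?_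
      rw [hP, coe_lineDerivCLM_one, centered_of_integral_eq_zero (integral_deriv_testFunction f),
        primitive_deriv (f.contDiff.of_le (by simp)) f.hasCompactSupport]
    rw [distDeriv_apply, hC, coe_lineDerivCLM_one, integral_deriv_testFunction, mul_zero, add_zero]
    change - -T (P _) = T f
    rw [neg_neg, hPf]

end Distributions

section TraceDistribution

open MeasureTheory Complex Set TopologicalSpace Filter

variable {E : Type*} [NormedAddCommGroup E] [InnerProductSpace ℂ E]

theorem ResolventEstimate.exists_strip_subset {A B : E →ₗ.[ℂ] E} {I : Set ℝ} {m n : ℝ}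
    (hA : ResolventEstimate A I m) (hB : ResolventEstimate B I n) :
    ∃ a > 0, strip a I ⊆ resolventSet A ∩ resolventSet B := by
  obtain ⟨a, ha, -, -, hρ, -⟩ := hA
  obtain ⟨b, hb, -, -, hρ', -⟩ := hB
  refine ⟨min a b, lt_min ha hb, fun z ⟨hzI, h0, hlt⟩ => ?_⟩
  exact ⟨hρ ⟨hzI, h0, hlt.trans_le (min_le_left a b)⟩,
    hρ' ⟨hzI, h0, hlt.trans_le (min_le_right a b)⟩⟩

theorem add_mul_I_mem_strip {a s x : ℝ} {I : Set ℝ} (hx : x ∈ I) (hs : s ≠ 0) (hsa : |s| < a) :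
    (x + s * Complex.I : ℂ) ∈ strip a I := by
  simpa [strip] using ⟨hx, hs, hsa⟩

variable [CompleteSpace E] {H₀ : E →ₗ.[ℂ] E} {V : E →L[ℂ] E} {I : Opens ℝ} {n : ℝ} {τ : ℝ → ℂ}

theorem hasModerateGrowth_sigma_chi (hV : IsTraceClass V)
    (hH : HasFunctionalCalculus (perturb H₀ V) I n) (hH₀ : HasFunctionalCalculus H₀ I n)
    (hτ : IsAdmissible (perturb H₀ V) I τ) (hτ₀ : IsAdmissible H₀ I τ) {K : Set ℝ}
    (hK : IsCompact K) (hKI : K ⊆ I) :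
    HasModerateGrowth (sigma (perturb H₀ V) H₀) (re ⁻¹' K ∩ tsupport (chi τ)) (n + 1 + (n + 1)) :=
  .sigma hV (hH.hasModerateGrowth hτ hK hKI) (hH₀.hasModerateGrowth hτ₀ hK hKI)
    fun _ hz h0 => ⟨hτ.mem_resolventSet hH (hKI hz.1) hz.2 h0,
      hτ₀.mem_resolventSet hH₀ (hKI hz.1) hz.2 h0⟩

theorem hasModerateGrowth_sigma_strip (hV : IsTraceClass V)
    (hH : HasFunctionalCalculus (perturb H₀ V) I n) (hH₀ : HasFunctionalCalculus H₀ I n)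
    {K : Set ℝ} (hK : IsCompact K) (hKI : K ⊆ I) {r : ℝ}
    (hρ : ∀ z ∈ re ⁻¹' K ∩ {z | |z.im| ≤ r}, z.im ≠ 0 →
      z ∈ resolventSet (perturb H₀ V) ∩ resolventSet H₀) :
    HasModerateGrowth (sigma (perturb H₀ V) H₀) (re ⁻¹' K ∩ {z | |z.im| ≤ r})
      (n + 1 + (n + 1)) := by
  have hQ : IsCompact (re ⁻¹' K ∩ {z : ℂ | |z.im| ≤ r}) := by
    convert hK.reProdIm (isCompact_Icc (a := -r) (b := r)) using 1
    ext z
    simp only [mem_inter_iff, mem_preimage, mem_ofPred_eq, abs_le, mem_reProdIm, mem_Icc]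
  exact .sigma hV
    (hH.resolventEstimate.hasModerateGrowth hQ (fun z hz => hKI hz.1) fun z hz h0 => (hρ z hz h0).1)
    (hH₀.resolventEstimate.hasModerateGrowth hQ (fun z hz => hKI hz.1)
      fun z hz h0 => (hρ z hz h0).2) hρ

theorem exists_clm_eq_trace_funcCalc_sub (hV : IsTraceClass V)
    (hH : HasFunctionalCalculus (perturb H₀ V) I n) (hH₀ : HasFunctionalCalculus H₀ I n) :
    ∃ T : 𝓓(I, ℂ) →L[ℂ] ℂ, ∀ f : 𝓓(I, ℂ),
      T f = trace (funcCalc (perturb H₀ V) I f - funcCalc H₀ I f) := by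
  refine exists_clm_of_norm_le_jetNorm (trace_funcCalc_sub_add hV hH hH₀)
    (trace_funcCalc_sub_smul hH hH₀) fun K hK hKI => ?_
  obtain ⟨τ, hτ, hτ₀, -⟩ := exists_isAdmissible_abs_im_le hH.exists_isAdmissible
    hH₀.exists_isAdmissible hK one_pos
  obtain ⟨N, hN⟩ := exists_nat_gt (max n (n + 1 + (n + 1)))
  obtain ⟨hN, hN'⟩ := max_lt_iff.1 hN
  have hp : n + 1 + (n + 1) < N + 1 := hN'.trans (lt_add_one _)
  obtain ⟨W, hW, hle⟩ := (hasModerateGrowth_sigma_chi hV hH hH₀ hτ hτ₀ hK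
    hKI).exists_norm_integral_dbar_smul_le hK hτ.1 hp
  refine ⟨N + 1, ‖(Real.pi : ℂ)⁻¹‖ * W, by positivity, fun f hfK B hB => ?_⟩
  rw [trace_funcCalc_sub hV hH hH₀ hτ hτ₀ f hN hp, norm_mul, mul_assoc]
  exact mul_le_mul_of_nonneg_left (hle f f.contDiff hfK B hB) (norm_nonneg _)

theorem trace_funcCalc_sub_eq_zero {A B : E →ₗ.[ℂ] E} (hA : HasFunctionalCalculus A I n)
    (hB : HasFunctionalCalculus B I n) (f : 𝓓(I, ℂ))
    (hρ : ∀ x ∈ tsupport f, (x : ℂ) ∈ resolventSet A ∩ resolventSet B) :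
    trace (funcCalc A I f - funcCalc B I f) = 0 := by
  rw [hA.funcCalc_eq_zero f fun x hx => (hρ x hx).1, hB.funcCalc_eq_zero f fun x hx => (hρ x hx).2,
    sub_zero]
  simp only [trace, zero_apply, inner_zero_right, tsum_zero]

theorem locallyIntegrableOn_sigma (hV : IsTraceClass V) {s : ℝ}
    (hρ : ∀ x ∈ I, (x + s * Complex.I : ℂ) ∈ resolventSet (perturb H₀ V) ∩ resolventSet H₀) :
    LocallyIntegrableOn (fun x : ℝ => sigma (perturb H₀ V) H₀ (x + s * Complex.I)) I := by
  have hline : Continuous fun x : ℝ => (x + s * Complex.I : ℂ) := by fun_prop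
  refine ContinuousOn.locallyIntegrableOn (fun x hx => ?_) I.isOpen.measurableSet
  exact ((differentiableAt_sigma hV (hρ x hx)).continuousAt.comp_of_eq hline.continuousAt
    rfl).continuousWithinAt

theorem eventually_locallyIntegrableOn_sigma (hV : IsTraceClass V) {a : ℝ} (ha : 0 < a)
    (hρ : strip a I ⊆ resolventSet (perturb H₀ V) ∩ resolventSet H₀) :
    ∀ᶠ ε : ℝ in 𝓝[>] 0,
      (∀ x ∈ I, (x + ε * Complex.I : ℂ) ∈ resolventSet (perturb H₀ V) ∩ resolventSet H₀ ∧
        (x - ε * Complex.I : ℂ) ∈ resolventSet (perturb H₀ V) ∩ resolventSet H₀) ∧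
      LocallyIntegrableOn (fun x : ℝ => sigma (perturb H₀ V) H₀ (x + ε * Complex.I)) I ∧
      LocallyIntegrableOn (fun x : ℝ => sigma (perturb H₀ V) H₀ (x - ε * Complex.I)) I := by
  filter_upwards [Ioo_mem_nhdsGT ha] with ε hε
  have hpos (x : ℝ) (hx : x ∈ I) := hρ (add_mul_I_mem_strip hx hε.1.ne'
    ((abs_of_pos hε.1).trans_lt hε.2))
  have hneg (x : ℝ) (hx : x ∈ I) := hρ (add_mul_I_mem_strip hx (neg_ne_zero.2 hε.1.ne')
    ((abs_neg ε).trans_lt ((abs_of_pos hε.1).trans_lt hε.2)))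
  have hneg' := locallyIntegrableOn_sigma hV hneg
  simp only [ofReal_neg, neg_mul, ← sub_eq_add_neg] at hneg hneg'
  exact ⟨fun x hx => ⟨hpos x hx, hneg x hx⟩, locallyIntegrableOn_sigma hV hpos, hneg'⟩

theorem tendsto_integral_sigma_jump (hV : IsTraceClass V)
    (hH : HasFunctionalCalculus (perturb H₀ V) I n) (hH₀ : HasFunctionalCalculus H₀ I n)
    (f : 𝓓(I, ℂ)) :
    Tendsto (fun ε : ℝ => (2 * Real.pi * Complex.I)⁻¹ *
      ∫ x : ℝ, f x * (sigma (perturb H₀ V) H₀ (x + ε * Complex.I) -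
        sigma (perturb H₀ V) H₀ (x - ε * Complex.I))) (𝓝[>] 0)
      (𝓝 (trace (funcCalc (perturb H₀ V) I f - funcCalc H₀ I f))) := by
  obtain ⟨a, ha, hstrip⟩ := hH.resolventEstimate.exists_strip_subset hH₀.resolventEstimate
  have hr : 0 < a / 3 := by positivity
  have hρ (z : ℂ) (hz : z ∈ re ⁻¹' tsupport f ∩ {z | |z.im| ≤ 2 * (a / 3)}) (h0 : z.im ≠ 0) :
      z ∈ resolventSet (perturb H₀ V) ∩ resolventSet H₀ :=
    hstrip ⟨f.tsupport_subset hz.1, abs_pos.2 h0,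
      (show |z.im| ≤ _ from hz.2).trans_lt (by linarith)⟩
  obtain ⟨τ, hτ, hτ₀, hτr⟩ := exists_isAdmissible_abs_im_le hH.exists_isAdmissible
    hH₀.exists_isAdmissible f.hasCompactSupport hr
  obtain ⟨N, hN⟩ := exists_nat_gt (max n (n + 1 + (n + 1)))
  obtain ⟨hN, hN'⟩ := max_lt_iff.1 hN
  have hp : n + 1 + (n + 1) < N + 1 := hN'.trans (lt_add_one _)
  rw [trace_funcCalc_sub hV hH hH₀ hτ hτ₀ f hN hp]
  exact (hasModerateGrowth_sigma_strip hV hH hH₀ f.hasCompactSupport f.tsupport_subset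
    hρ).tendsto_integral_jump (fun z hz h0 => differentiableAt_sigma hV (hρ z hz h0)) hr f.contDiff
    f.hasCompactSupport hτ.1 hτr hp

end TraceDistribution

end SSF

theorem mainTheorem1_general {E : Type*} [NormedAddCommGroup E] [InnerProductSpace ℂ E]
    [CompleteSpace E] {H₀ : E →ₗ.[ℂ] E} {V : E →L[ℂ] E} (hV : SSF.IsTraceClass V)
    {I : TopologicalSpace.Opens ℝ} (hI : (I : Set ℝ).OrdConnected) {n : ℝ}
    (hH : SSF.HasFunctionalCalculus (SSF.perturb H₀ V) I n)
    (hH₀ : SSF.HasFunctionalCalculus H₀ I n) :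
    (∀ f : 𝓓(I, ℂ),
      SSF.IsHSValue (SSF.perturb H₀ V) I n f (SSF.funcCalc (SSF.perturb H₀ V) I f) ∧
        SSF.IsHSValue H₀ I n f (SSF.funcCalc H₀ I f)) ∧
    (∀ f : 𝓓(I, ℂ),
      SSF.IsTraceClass (SSF.funcCalc (SSF.perturb H₀ V) I f - SSF.funcCalc H₀ I f)) ∧
    (∀ z ∈ SSF.resolventSet (SSF.perturb H₀ V) ∩ SSF.resolventSet H₀,
      SSF.IsTraceClass (SSF.resolvent (SSF.perturb H₀ V) z - SSF.resolvent H₀ z)) ∧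
    ∃ T : 𝓓(I, ℂ) →L[ℂ] ℂ,
      (∀ f : 𝓓(I, ℂ),
        T f = SSF.trace (SSF.funcCalc (SSF.perturb H₀ V) I f - SSF.funcCalc H₀ I f)) ∧
      (∀ f : 𝓓(I, ℂ),
        (∀ x ∈ tsupport f,
          (x : ℂ) ∈ SSF.resolventSet (SSF.perturb H₀ V) ∩ SSF.resolventSet H₀) → T f = 0) ∧
      (∃ ξ : 𝓓(I, ℂ) →L[ℂ] ℂ, ∀ η : 𝓓(I, ℂ) →L[ℂ] ℂ,
        SSF.distDeriv η = T ↔ ∃ C : ℂ, ∀ f : 𝓓(I, ℂ), η f = ξ f + C * ∫ x, f x) ∧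
      (∀ᶠ ε : ℝ in 𝓝[>] 0,
        (∀ x ∈ I,
          (x + ε * Complex.I : ℂ) ∈
            SSF.resolventSet (SSF.perturb H₀ V) ∩ SSF.resolventSet H₀ ∧
          (x - ε * Complex.I : ℂ) ∈
            SSF.resolventSet (SSF.perturb H₀ V) ∩ SSF.resolventSet H₀) ∧
        MeasureTheory.LocallyIntegrableOn
          (fun x : ℝ => SSF.sigma (SSF.perturb H₀ V) H₀ (x + ε * Complex.I)) I ∧
        MeasureTheory.LocallyIntegrableOn
          (fun x : ℝ => SSF.sigma (SSF.perturb H₀ V) H₀ (x - ε * Complex.I)) I) ∧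
      (∀ f : 𝓓(I, ℂ), Filter.Tendsto
        (fun ε : ℝ => (2 * Real.pi * Complex.I)⁻¹ *
          ∫ x : ℝ, f x * (SSF.sigma (SSF.perturb H₀ V) H₀ (x + ε * Complex.I) -
            SSF.sigma (SSF.perturb H₀ V) H₀ (x - ε * Complex.I)))
        (𝓝[>] 0) (𝓝 (T f))) := by
  obtain ⟨T, hT⟩ := SSF.exists_clm_eq_trace_funcCalc_sub hV hH hH₀
  obtain ⟨a, ha, hstrip⟩ := hH.resolventEstimate.exists_strip_subset hH₀.resolventEstimate
  exact ⟨fun f => ⟨hH.isHSValue_funcCalc f, hH₀.isHSValue_funcCalc f⟩,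
    SSF.isTraceClass_funcCalc_sub hV hH hH₀,
    fun z hz => SSF.isTraceClass_resolvent_sub hV hz,
    T, hT,
    fun f hf => (hT f).trans (SSF.trace_funcCalc_sub_eq_zero hH hH₀ f hf),
    SSF.exists_distDeriv_eq_iff hI T,
    SSF.eventually_locallyIntegrableOn_sigma hV ha hstrip,
    fun f => hT f ▸ SSF.tendsto_integral_sigma_jump hV hH hH₀ f⟩

theorem mainTheorem1 {E : Type*} [NormedAddCommGroup E] [InnerProductSpace ℂ E] [CompleteSpace E]
    [TopologicalSpace.SeparableSpace E]
    (H₀ H : E →ₗ.[ℂ] E) (V : E →L[ℂ] E)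
    (hH₀ : IsSelfAdjoint H₀) (hbelow : SSF.IsBoundedBelow H₀) (hH : H = SSF.perturb H₀ V)
    (I : TopologicalSpace.Opens ℝ) (hI : (I : Set ℝ).OrdConnected)
    (hyp1 : (SSF.nonrealEigenvalues H I).Finite)
    (n : ℝ) (hn : 0 < n) (hyp2 : SSF.ResolventEstimate H I n)
    (hyp3 : SSF.IsTraceClass V) :
    -- `f(H)` and `f(H₀)` are well defined by the Helffer–Sjöstrand formula
    (∀ f : 𝓓(I, ℂ), SSF.IsHSValue H I n f (SSF.funcCalc H I f) ∧
      SSF.IsHSValue H₀ I n f (SSF.funcCalc H₀ I f)) ∧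
    -- their difference is trace class
    (∀ f : 𝓓(I, ℂ), SSF.IsTraceClass (SSF.funcCalc H I f - SSF.funcCalc H₀ I f)) ∧
    -- the resolvent difference is trace class, so that `σ` is well defined
    (∀ z ∈ SSF.resolventSet H ∩ SSF.resolventSet H₀,
      SSF.IsTraceClass (SSF.resolvent H z - SSF.resolvent H₀ z)) ∧
    -- `f ↦ Tr (f(H) - f(H₀))` is a distribution `T` on `I`
    ∃ T : 𝓓(I, ℂ) →L[ℂ] ℂ,
      (∀ f : 𝓓(I, ℂ), T f = SSF.trace (SSF.funcCalc H I f - SSF.funcCalc H₀ I f)) ∧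
      -- which vanishes on `I ∩ ρ(H) ∩ ρ(H₀)`
      (∀ f : 𝓓(I, ℂ),
        (∀ x ∈ tsupport f, (x : ℂ) ∈ SSF.resolventSet H ∩ SSF.resolventSet H₀) → T f = 0) ∧
      -- it has a primitive `ξ`, unique up to an additive constant
      (∃ ξ : 𝓓(I, ℂ) →L[ℂ] ℂ, ∀ η : 𝓓(I, ℂ) →L[ℂ] ℂ,
        SSF.distDeriv η = T ↔ ∃ C : ℂ, ∀ f : 𝓓(I, ℂ), η f = ξ f + C * ∫ x, f x) ∧
      -- for small `ε` the functions `σ(· ± iε)` are locally integrable functions on `I`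
      (∀ᶠ ε : ℝ in 𝓝[>] 0,
        (∀ x ∈ I, (x + ε * Complex.I : ℂ) ∈ SSF.resolventSet H ∩ SSF.resolventSet H₀ ∧
          (x - ε * Complex.I : ℂ) ∈ SSF.resolventSet H ∩ SSF.resolventSet H₀) ∧
        MeasureTheory.LocallyIntegrableOn
          (fun x : ℝ => SSF.sigma H H₀ (x + ε * Complex.I)) I ∧
        MeasureTheory.LocallyIntegrableOn
          (fun x : ℝ => SSF.sigma H H₀ (x - ε * Complex.I)) I) ∧
      -- and `(2πi)⁻¹ (σ(· + iε) - σ(· - iε))` converges to `ξ' = T` in the sense of distributions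
      (∀ f : 𝓓(I, ℂ), Filter.Tendsto
        (fun ε : ℝ => (2 * Real.pi * Complex.I)⁻¹ *
          ∫ x : ℝ, f x * (SSF.sigma H H₀ (x + ε * Complex.I) -
            SSF.sigma H H₀ (x - ε * Complex.I)))
        (𝓝[>] 0) (𝓝 (T f))) := by
  subst hH
  exact mainTheorem1_general hyp3 hI
    (SSF.hasFunctionalCalculus_perturb hH₀ hyp3.isCompactOperator hyp2 hyp1)
    (SSF.hasFunctionalCalculus_of_isSelfAdjoint hH₀ I hn.le)
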